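/- Let $d,d'\ge 1$, $f:\mathbb R^d\times\mathbb R^{d'}\to\mathbb R^d$, $g:\mathbb R^d\times\mathbb R^{d'}\to\mathbb R^{d'}$, $\theta^*\in\mathbb R^d$, $\mu^*\in\mathbb R^{d'}$. Let random sequences be given on a probability space by $$\theta_{n+1}=\theta_n+\beta_nX_{n+1},\qquad \mu_{n+1}=\mu_n+\gamma_nY_{n+1}\qquad(n\ge 1),$$ with deterministic step sizes $\beta_n$, $\gamma_n$. Here $\|\cdot\|$ is the Euclidean norm, and for a real square matrix $A$ we write $\Lambda^{(A)}=-\max\{\operatorname{Re}\lambda:\lambda\in\operatorname{Sp}(A)\}$. Assume the following. (A1) $\theta_n\to\theta^*$ and $\mu_n\to\mu^*$ almost surely. (A2) (i) There are real matrices $Q_{11},Q_{12},Q_{21},Q_{22}$ of sizes $d\times d$, $d\times d'$, $d'\times d$, $d'\times d'$ such that, for $(\theta,\mu)$ in a neighborhood of $(\theta^*,\mu^*)$, $$f(\theta,\mu)=Q_{11}(\theta-\theta^*)+Q_{12}(\mu-\mu^*)+O(\|\theta-\theta^*\|^2+\|\mu-\mu^*\|^2),$$ $$g(\theta,\mu)=Q_{21}(\theta-\theta^*)+Q_{22}(\mu-\mu^*)+O(\|\theta-\theta^*\|^2+\|\mu-\mu^*\|^2).$$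 (ii) $\Lambda^{(Q_{22})}>0$ and $\Lambda^{(H)}>0$, where $H=Q_{11}-Q_{12}Q_{22}^{-1}Q_{21}$. (A3) (i) $\beta_n=\beta_0n^{-b}$ and $\gamma_n=\gamma_0n^{-a}$ for $n\ge1$, with $\beta_0,\gamma_0>0$ and $\frac12<a<b\le1$. (ii) If $b=1$, then $\beta_0>1/(2\Lambda^{(H)})$. (A4) $X_{n+1}=f(\theta_n,\mu_n)+\psi^{(\theta)}_n+V_{n+1}$ and $Y_{n+1}=g(\theta_n,\mu_n)+\psi^{(\mu)}_n+W_{n+1}$ for $n\ge 1$, and, with $\mathcal F_n$ the $\sigma$-field spanned by $V_i,W_i,\theta_i,\mu_i,\psi^{(\theta)}_i,\psi^{(\mu)}_i$, $0\le i\le n$ (the variables with index $0$ play no role in the recursion and are arbitrary random variables): (i) $\mathbb E(V_{n+1}\mid\mathcal F_n)=0$ and $\mathbb E(W_{n+1}\mid\mathcal F_n)=0$ a.s.; (ii) there is a positive semidefinite matrix $\Gamma$ with $$\lim_{n\to\infty}\mathbb E\left(\begin{pmatrix}V_{n+1}\\W_{n+1}\end{pmatrix}\begin{pmatrix}V_{n+1}^T&W_{n+1}^T\end{pmatrix}\Big|\mathcal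 F_n\right)=\Gamma\quad\text{a.s.};$$ (iii) there is $m>2/a$ with $\sup_n\mathbb E(\|V_{n+1}\|^m\mid\mathcal F_n)<\infty$ and $\sup_n\mathbb E(\|W_{n+1}\|^m\mid\mathcal F_n)<\infty$ a.s.; (iv) almost surely, $\psi^{(\theta)}_n=r^{(\theta)}_n+O(\|\theta_n-\theta^*\|^2+\|\mu_n-\mu^*\|^2)$ and $\psi^{(\mu)}_n=r^{(\mu)}_n+O(\|\theta_n-\theta^*\|^2+\|\mu_n-\mu^*\|^2)$, with $\|r^{(\theta)}_n\|+\|r^{(\mu)}_n\|=o(\sqrt{\beta_n})$. The conditional expectations of $V_{n+1}$, $W_{n+1}$ and of the products of their coordinates are taken in the general sense, which does not require integrability: $\mathbb E(Z\mid\mathcal F_n)=Z'$ a.s. means that there are countably many events of $\mathcal F_n$, with union of probability one, on each of which $Z$ is integrable, and such that $\mathbb E(Z\mathbf 1_A\mid\mathcal F_n)=Z'\mathbf 1_A$ a.s. for each event $A$ among them. The $O$ and $o$ in almost sure statements hold pathwise, with a constant that may depend on the path. Then $$\|\theta_n-\theta^*\|=O\left(\sqrt{\beta_n\log\Big[\sum_{k=1}^n\beta_k\Big]}\right)\quad\text{a.s.}$$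 and $$\|\mu_n-\mu^*\|=O\left(\sqrt{\gamma_n\log\Big[\sum_{k=1}^n\gamma_k\Big]}\right)\quad\text{a.s.}$$ -/

import Mathlib

open MeasureTheory Filter Topology Asymptotics

/-- For a real square matrix `A`, the number
`-max {Re z : z a complex eigenvalue of A}`. It is positive iff `A` is Hurwitz
(for an empty matrix the value is `0`). -/
noncomputable def spectralDecay {n : ℕ} (A : Matrix (Fin n) (Fin n) ℝ) : ℝ :=
  -sSup (Complex.re '' spectrum ℂ (A.map (fun x : ℝ => (x : ℂ))))

/-- The action of a real matrix on Euclidean vectors. -/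
noncomputable def matVec {p q : ℕ} (A : Matrix (Fin p) (Fin q) ℝ)
    (x : EuclideanSpace ℝ (Fin q)) : EuclideanSpace ℝ (Fin p) :=
  WithLp.toLp 2 (A.mulVec (fun i => x i))

/-- The step size `c * n ^ (-e)`, used for `n ≥ 1`. -/
noncomputable def stepSize (c e : ℝ) (n : ℕ) : ℝ := c * (n : ℝ) ^ (-e)

/-- The σ-field spanned by all `V_i, W_i, θ_i, μ_i, ψθ_i, ψμ_i` with `0 ≤ i ≤ n`. -/
@[reducible] def history {Ω : Type*} {d d' : ℕ}
    (V : ℕ → Ω → EuclideanSpace ℝ (Fin d)) (W : ℕ → Ω → EuclideanSpace ℝ (Fin d'))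
    (θ : ℕ → Ω → EuclideanSpace ℝ (Fin d)) (μ : ℕ → Ω → EuclideanSpace ℝ (Fin d'))
    (ψθ : ℕ → Ω → EuclideanSpace ℝ (Fin d)) (ψμ : ℕ → Ω → EuclideanSpace ℝ (Fin d'))
    (n : ℕ) : MeasurableSpace Ω :=
  ⨆ (i : ℕ) (_ : i ≤ n),
    MeasurableSpace.comap (V i) inferInstance ⊔ MeasurableSpace.comap (W i) inferInstance ⊔
    MeasurableSpace.comap (θ i) inferInstance ⊔ MeasurableSpace.comap (μ i) inferInstance ⊔
    MeasurableSpace.comap (ψθ i) inferInstance ⊔ MeasurableSpace.comap (ψμ i) inferInstance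

/-- `Y` is a version of the conditional expectation `E(X | 𝓖)`, in the usual sense that allows
`X` to be only conditionally (σ-)integrable: almost all of the space is covered by countably many
events of `𝓖`, on each of which `X` is integrable and `Y` agrees with the conditional expectation
of `X`. When `X` itself is integrable this says `P[X|𝓖] =ᵐ[P] Y`. -/
def IsCondExp {Ω : Type*} {m0 : MeasurableSpace Ω} (𝓖 : MeasurableSpace Ω) (P : Measure[m0] Ω)
    {E : Type*} [NormedAddCommGroup E] [NormedSpace ℝ E] [CompleteSpace E]
    (X Y : Ω → E) : Prop :=
  ∃ A : ℕ → Set Ω,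
    (∀ k, MeasurableSet[𝓖] (A k)) ∧ (∀ᵐ ω ∂P, ∃ k, ω ∈ A k) ∧
    (∀ k, IntegrableOn X (A k) P) ∧
    ∀ k, P[(A k).indicator X | 𝓖] =ᵐ[P] (A k).indicator Y

/-! Write `x = θ - θstar`, `y = μ - μstar` and `M = Q₁₂ Q₂₂⁻¹`. The proof separates a deterministic,
pathwise comparison from an almost sure bound on noise alone.

Pathwise part (`two_time_scale_rate`). The slow recursion contains `Q₁₂ y`, which is too large to be
treated as an error. Since `βₙ = εₙ γₙ` with `εₙ` of order `n ^ (a - b)`, subtracting `εₙ₋₁ M y`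
from `x` cancels this term, turns the drift `Q₁₁ x` into `H x`, and turns the noise `V` into `V - M
W`. The noise is then removed by subtracting sequences `s (n + 1) = (1 - n ^ (-e)) s n + n ^ (-e) D
n` driven by it. Their damping is that of `-1` and not of `H` or `Q₂₂`; the mismatch only adds to
the drift a term of the order of `s`. So the noise can be studied coordinate by coordinate, without
matrices.

The corrected variables are measured in norms that `1 + t H` and `1 + t Q₂₂` contract
(`exists_lyapunov_norm`), which leaves scalar inequalities. A contracting recursion with input of
order `v` stays of order `v` if `v` decays more slowly than the contraction. This is used twice.
`two_time_scale_scalar_fast` bounds both components by the fast rate, since the slow one feels the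
fast one only with vanishing coefficients. Then `n ^ (a - b) ‖y‖` and `‖y‖²` are known to be `O(n ^
(-b/2))`, because `a > 1/2 ≥ b/2`, and `two_time_scale_scalar` reaches the slow rate.

Noise part (`ae_exists_damped`). Increments are truncated at `(n + 1) ^ p` with `1/m < p < e/2`: by
Borel-Cantelli only finitely many are changed, the bias is negligible, and the conditional
exponential moments are of Gaussian type (`lintegral_exp_clip_le`). An exponential supermartingale
gives a maximal inequality (`measure_exists_sum_ge_le`), and Borel-Cantelli gives the rate. If `e <
1`, then `log ∑ γₖ` is comparable to `log n` and one bound for each `n` is enough. If `e = 1`, the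
logarithm is of order `log log n`, and one maximal bound for each dyadic block is needed. -/

/-! ### Hurwitz matrices and adapted norms -/

/-- `matVec A` as a continuous linear map. -/
noncomputable def matCLM {p q : ℕ} (A : Matrix (Fin p) (Fin q) ℝ) :
    EuclideanSpace ℝ (Fin q) →L[ℝ] EuclideanSpace ℝ (Fin p) :=
  LinearMap.toContinuousLinearMap
    { toFun := matVec A
      map_add' := fun x y => by
        ext i; simp [matVec, Matrix.mulVec, dotProduct, mul_add, Finset.sum_add_distrib]
      map_smul' := fun c x => by
        ext i; simp [matVec, Matrix.mulVec, dotProduct, Finset.mul_sum, mul_left_comm] }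

@[simp] lemma matCLM_apply {p q : ℕ} (A : Matrix (Fin p) (Fin q) ℝ)
    (x : EuclideanSpace ℝ (Fin q)) : matCLM A x = matVec A x := rfl

lemma matVec_mul {p q r : ℕ} (A : Matrix (Fin p) (Fin q) ℝ) (B : Matrix (Fin q) (Fin r) ℝ)
    (x : EuclideanSpace ℝ (Fin r)) : matVec (A * B) x = matVec A (matVec B x) := by
  ext i
  simp only [matVec]
  rw [← Matrix.mulVec_mulVec]

lemma matVec_sub_left {p q : ℕ} (A B : Matrix (Fin p) (Fin q) ℝ)
    (x : EuclideanSpace ℝ (Fin q)) : matVec (A - B) x = matVec A x - matVec B x := by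
  ext i; simp [matVec, Matrix.sub_mulVec]

/-- If the spectrum of `a` lies in `{re z ≤ -Λ}` and `l < Λ`, the powers of `1 + t a` decay like
`(1 - l t) ^ k` for some small `t`. -/
lemma exists_norm_pow_one_add_smul_le {𝔸 : Type*} [NormedRing 𝔸] [NormedAlgebra ℂ 𝔸]
    [CompleteSpace 𝔸] [Nontrivial 𝔸] (a : 𝔸) {Λ l : ℝ} (hΛ : ∀ z ∈ spectrum ℂ a, z.re ≤ -Λ)
    (hl : 0 < l) (hlΛ : l < Λ) :
    ∃ t > 0, l * t < 1 ∧ ∃ C, ∀ k : ℕ, ‖(1 + (t : ℂ) • a) ^ k‖ ≤ C * (1 - l * t) ^ k := by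
  set R : ℝ := ‖a‖ * ‖(1 : 𝔸)‖
  have hR : 0 ≤ R := by positivity
  -- On the spectrum `|1 + t w|² ≤ 1 - 2 t Λ + t² R²`. The second bound on `t` puts this strictly
  -- below `(1 - l t)²`; the first keeps `1 - l t` positive.
  set t : ℝ := min (1 / (2 * l)) ((Λ - l) / (R ^ 2 + 1))
  have ht : 0 < t := lt_min (by positivity) (div_pos (by linarith) (by positivity))
  have ht1 : l * t ≤ 1 / 2 := by
    have : t ≤ 1 / (2 * l) := min_le_left _ _
    calc l * t ≤ l * (1 / (2 * l)) := by gcongr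
      _ = 1 / 2 := by field_simp
  have ht2 : t * (R ^ 2 + 1) ≤ Λ - l := by
    have : t ≤ (Λ - l) / (R ^ 2 + 1) := min_le_right _ _
    rwa [le_div_iff₀ (by positivity)] at this
  refine ⟨t, ht, by linarith, ?_⟩
  have hρ : 0 < 1 - l * t := by linarith
  set ρ : NNReal := ⟨1 - l * t, hρ.le⟩
  have hspec : spectralRadius ℂ (1 + (t : ℂ) • a) < ρ := by
    apply spectrum.spectralRadius_lt_of_forall_lt
    intro z hz
    have h1 : (1 + (t : ℂ) • a) =
        Polynomial.aeval a (1 + Polynomial.C (t : ℂ) * Polynomial.X) := by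
      simp [Algebra.smul_def]
    rw [h1, spectrum.map_polynomial_aeval] at hz
    obtain ⟨w, hw, rfl⟩ := hz
    have hwre := hΛ w hw
    have hwn : ‖w‖ ≤ R := spectrum.norm_le_norm_mul_of_mem hw
    rw [← NNReal.coe_lt_coe]
    change ‖_‖ < 1 - l * t
    refine lt_of_pow_lt_pow_left₀ 2 hρ.le ?_
    simp only [Polynomial.eval_add, Polynomial.eval_one, Polynomial.eval_mul, Polynomial.eval_C,
      Polynomial.eval_X]
    have e1 : ‖(1 : ℂ) + t * w‖ ^ 2 = 1 + 2 * t * w.re + t ^ 2 * ‖w‖ ^ 2 := by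
      rw [← Complex.normSq_eq_norm_sq, ← Complex.normSq_eq_norm_sq, Complex.normSq_apply,
        Complex.normSq_apply]
      simp
      ring
    rw [e1]
    have e2 : ‖w‖ ^ 2 ≤ R ^ 2 := by gcongr
    have e3 : t * ‖w‖ ^ 2 ≤ t * R ^ 2 := by gcongr
    nlinarith [mul_pos ht ht, sq_nonneg (l * t)]
  -- Gelfand's formula: a spectral radius below `1 - l t` controls all large powers. The finitely
  -- many others are absorbed in the constant.
  have hG := (tendsto_order.1 (spectrum.pow_nnnorm_pow_one_div_tendsto_nhds_spectralRadius
    (1 + (t : ℂ) • a))).2 _ hspec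
  obtain ⟨N, hN⟩ := eventually_atTop.1 hG
  have hbig : ∀ k, N + 1 ≤ k → ‖(1 + (t : ℂ) • a) ^ k‖ ≤ (1 - l * t) ^ k := by
    intro k hk
    have h := hN k (by omega)
    have hk0 : (0 : ℝ) < k := by exact_mod_cast (by omega : 0 < k)
    rw [← ENNReal.coe_rpow_of_nonneg _ (by positivity)] at h
    have h2 := ENNReal.coe_lt_coe.1 h
    rw [← NNReal.coe_lt_coe, NNReal.coe_rpow, coe_nnnorm] at h2
    change _ < 1 - l * t at h2
    calc ‖(1 + (t : ℂ) • a) ^ k‖ = (‖(1 + (t : ℂ) • a) ^ k‖ ^ (1 / (k : ℝ))) ^ k := by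
          rw [← Real.rpow_natCast, ← Real.rpow_mul (norm_nonneg _)]
          field_simp
          simp
      _ ≤ _ := by gcongr
  refine ⟨1 + ∑ k ∈ Finset.range (N + 1), ‖(1 + (t : ℂ) • a) ^ k‖ / (1 - l * t) ^ k, fun k => ?_⟩
  have hs : 0 ≤ ∑ k ∈ Finset.range (N + 1), ‖(1 + (t : ℂ) • a) ^ k‖ / (1 - l * t) ^ k :=
    Finset.sum_nonneg fun _ _ => by positivity
  have hp : 0 < (1 - l * t) ^ k := by positivity
  rcases lt_or_ge k (N + 1) with hk | hk
  · have := Finset.single_le_sum (f := fun k => ‖(1 + (t : ℂ) • a) ^ k‖ / (1 - l * t) ^ k)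
      (fun _ _ => by positivity) (Finset.mem_range.2 hk)
    rw [← div_le_iff₀ hp]
    linarith
  · nlinarith [hbig k hk]

/-- The norm `x ↦ sup_k ρ⁻ᵏ ‖Tᵏ x‖` adapted to a power-bounded `T / ρ`. -/
lemma exists_adapted_norm {E : Type*} [NormedAddCommGroup E] [NormedSpace ℝ E] (T : E →L[ℝ] E)
    {ρ C : ℝ} (hρ : 0 < ρ) (hT : ∀ (k : ℕ) x, ‖(T ^ k) x‖ ≤ C * ρ ^ k * ‖x‖) :
    ∃ N : E → ℝ, (∀ x, ‖x‖ ≤ N x) ∧ (∀ x, N x ≤ C * ‖x‖) ∧ (∀ x y, N (x + y) ≤ N x + N y) ∧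
      (∀ c : ℝ, 0 ≤ c → ∀ x, N (c • x) ≤ c * N x) ∧ ∀ x, N (T x) ≤ ρ * N x := by
  have hb : ∀ x (k : ℕ), ‖(T ^ k) x‖ / ρ ^ k ≤ C * ‖x‖ := fun x k => by
    rw [div_le_iff₀ (by positivity)]
    linarith [hT k x]
  have hbdd : ∀ x, BddAbove (Set.range fun k : ℕ => ‖(T ^ k) x‖ / ρ ^ k) := fun x =>
    ⟨C * ‖x‖, by rintro _ ⟨k, rfl⟩; exact hb x k⟩
  refine ⟨fun x => ⨆ k : ℕ, ‖(T ^ k) x‖ / ρ ^ k, fun x => ?_, fun x => ciSup_le (hb x),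
    fun x y => ciSup_le fun k => ?_, fun c hc x => ciSup_le fun k => ?_,
    fun x => ciSup_le fun k => ?_⟩
  · simpa using le_ciSup (hbdd x) 0
  · calc ‖(T ^ k) (x + y)‖ / ρ ^ k ≤ ‖(T ^ k) x‖ / ρ ^ k + ‖(T ^ k) y‖ / ρ ^ k := by
          rw [← add_div, map_add]; gcongr; exact norm_add_le _ _
      _ ≤ _ := add_le_add (le_ciSup (hbdd x) k) (le_ciSup (hbdd y) k)
  · rw [map_smul, norm_smul, Real.norm_of_nonneg hc, mul_div_assoc]
    exact mul_le_mul_of_nonneg_left (le_ciSup (hbdd x) k) hc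
  · have h := le_ciSup (hbdd x) (k + 1)
    have e : (T ^ (k + 1)) x = (T ^ k) (T x) := by rw [pow_succ]; rfl
    rw [e] at h
    calc ‖(T ^ k) (T x)‖ / ρ ^ k = ρ * (‖(T ^ k) (T x)‖ / ρ ^ (k + 1)) := by
          field_simp
          ring
      _ ≤ _ := mul_le_mul_of_nonneg_left h hρ.le

/-- Complexification of a Euclidean vector. -/
noncomputable def complexify {n : ℕ} (x : EuclideanSpace ℝ (Fin n)) : EuclideanSpace ℂ (Fin n) :=
  WithLp.toLp 2 fun i => (x i : ℂ)

lemma norm_complexify {n : ℕ} (x : EuclideanSpace ℝ (Fin n)) : ‖complexify x‖ = ‖x‖ := by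
  simp [complexify, EuclideanSpace.norm_eq]

lemma toEuclideanCLM_complexify {n : ℕ} (A : Matrix (Fin n) (Fin n) ℝ)
    (x : EuclideanSpace ℝ (Fin n)) :
    Matrix.toEuclideanCLM (𝕜 := ℂ) (A.map (fun x : ℝ => (x : ℂ))) (complexify x) =
      complexify (matVec A x) := by
  ext i
  simp [complexify, matVec, Matrix.mulVec, dotProduct]

lemma re_le_neg_spectralDecay {n : ℕ} (A : Matrix (Fin n) (Fin n) ℝ) {z : ℂ}
    (hz : z ∈ spectrum ℂ (A.map (fun x : ℝ => (x : ℂ)))) : z.re ≤ -spectralDecay A := by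
  rw [spectralDecay, neg_neg]
  have hfin : (spectrum ℂ (A.map (fun x : ℝ => (x : ℂ)))).Finite := Matrix.finite_spectrum _
  exact le_csSup (hfin.image _).bddAbove (Set.mem_image_of_mem _ hz)

lemma spectralDecay_of_isEmpty {n : ℕ} (h : n = 0) (A : Matrix (Fin n) (Fin n) ℝ) :
    spectralDecay A = 0 := by
  subst h
  simp [spectralDecay]

/-- A singular matrix has the eigenvalue `0`. This makes `Q₂₂⁻¹` a true inverse in `H`. -/
lemma isUnit_det_of_spectralDecay_pos {n : ℕ} (A : Matrix (Fin n) (Fin n) ℝ)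
    (h : 0 < spectralDecay A) : IsUnit A.det := by
  by_contra hA
  have h0 : (0 : ℂ) ∈ spectrum ℂ (A.map (fun x : ℝ => (x : ℂ))) := by
    rw [spectrum.zero_mem_iff, Matrix.isUnit_iff_isUnit_det]
    have : (A.map (fun x : ℝ => (x : ℂ))).det = (A.det : ℂ) :=
      (RingHom.map_det Complex.ofRealHom A).symm
    rw [this]
    simpa using hA
  have := re_le_neg_spectralDecay A h0
  simp at this
  linarith

/-- A norm contracted at rate `l` by `1 + t A`, for every `l < spectralDecay A`. -/
lemma exists_lyapunov_norm {n : ℕ} (A : Matrix (Fin n) (Fin n) ℝ) {l : ℝ} (hl : 0 < l)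
    (hlA : l < spectralDecay A) :
    ∃ (N : EuclideanSpace ℝ (Fin n) → ℝ) (C t₀ : ℝ), 0 < t₀ ∧ (∀ x, ‖x‖ ≤ N x) ∧
      (∀ x, N x ≤ C * ‖x‖) ∧ (∀ x y, N (x + y) ≤ N x + N y) ∧
      ∀ t, 0 ≤ t → t ≤ t₀ → ∀ x, N (x + t • matVec A x) ≤ (1 - l * t) * N x := by
  have hn : n ≠ 0 := fun h => by
    rw [spectralDecay_of_isEmpty h] at hlA; linarith
  have : NeZero n := ⟨hn⟩
  -- The eigenvalues are complex, so powers are bounded over `ℂ`; the isometric embedding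
  -- `complexify` brings the bound back to real vectors.
  set Ac := A.map (fun x : ℝ => (x : ℂ))
  set Tc := Matrix.toEuclideanCLM (𝕜 := ℂ) Ac with hTc
  have hsp : ∀ z ∈ spectrum ℂ Tc, z.re ≤ -spectralDecay A := fun z hz => by
    rw [hTc, AlgEquiv.spectrum_eq (Matrix.toEuclideanCLM (n := Fin n) (𝕜 := ℂ))] at hz
    exact re_le_neg_spectralDecay A hz
  obtain ⟨t₀, ht₀, hlt, C, hC⟩ := exists_norm_pow_one_add_smul_le Tc hsp hl hlA
  set T : EuclideanSpace ℝ (Fin n) →L[ℝ] EuclideanSpace ℝ (Fin n) := 1 + t₀ • matCLM A with hT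
  have hTx : ∀ x, T x = x + t₀ • matVec A x := fun x => by simp [hT]
  have hstep : ∀ x, (1 + (t₀ : ℂ) • Tc) (complexify x) = complexify (T x) := fun x => by
    have : (1 + (t₀ : ℂ) • Tc) (complexify x) = complexify x + (t₀ : ℂ) • Tc (complexify x) := by
      simp
    rw [this, toEuclideanCLM_complexify, hTx]
    ext i
    simp [complexify]
  have hpow : ∀ (k : ℕ) x, ((1 + (t₀ : ℂ) • Tc) ^ k) (complexify x) = complexify ((T ^ k) x) := by
    intro k
    induction k with
    | zero => intro x; simp
    | succ k ih =>
      intro x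
      rw [pow_succ, pow_succ]
      change ((1 + (t₀ : ℂ) • Tc) ^ k) ((1 + (t₀ : ℂ) • Tc) (complexify x)) =
        complexify ((T ^ k) (T x))
      rw [hstep, ih]
  have hTk : ∀ (k : ℕ) x, ‖(T ^ k) x‖ ≤ C * (1 - l * t₀) ^ k * ‖x‖ := fun k x => by
    rw [← norm_complexify, ← hpow, ← norm_complexify x]
    exact (ContinuousLinearMap.le_opNorm _ _).trans
      (mul_le_mul_of_nonneg_right (hC k) (norm_nonneg _))
  obtain ⟨N, h1, h2, h3, h4, h5⟩ := exists_adapted_norm T (by linarith) hTk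
  refine ⟨N, C, t₀, ht₀, h1, h2, h3, fun t ht0 ht x => ?_⟩
  -- For `t ≤ t₀`, `1 + t A` is a convex combination of `1` and `T = 1 + t₀ A`, so contraction at
  -- the single value `t₀` gives it for all smaller steps.
  have e : x + t • matVec A x = (1 - t / t₀) • x + (t / t₀) • T x := by
    rw [hTx, smul_add, smul_smul, div_mul_cancel₀ _ ht₀.ne', sub_smul, one_smul]
    abel
  have hq : t / t₀ ≤ 1 := by rw [div_le_one ht₀]; exact ht
  have hq0 : 0 ≤ t / t₀ := by positivity
  rw [e]
  calc N ((1 - t / t₀) • x + (t / t₀) • T x)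
      ≤ (1 - t / t₀) * N x + t / t₀ * ((1 - l * t₀) * N x) :=
        (h3 _ _).trans (add_le_add (h4 _ (by linarith) _)
          ((h4 _ hq0 _).trans (mul_le_mul_of_nonneg_left (h5 x) hq0)))
    _ = (1 - l * t) * N x := by field_simp; ring

/-! ### Asymptotics of the rates -/

/-- The partial sums of the step sizes. -/
noncomputable def stepSum (c e : ℝ) (n : ℕ) : ℝ := ∑ k ∈ Finset.Icc 1 n, stepSize c e k

/-- The rate `√(γₙ log ∑ γₖ)`. -/
noncomputable def lilRate (c e : ℝ) (n : ℕ) : ℝ :=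
  Real.sqrt (stepSize c e n * Real.log (stepSum c e n))

lemma stepSize_nonneg {c : ℝ} (hc : 0 < c) (e : ℝ) (n : ℕ) : 0 ≤ stepSize c e n := by
  unfold stepSize; positivity

lemma stepSize_pos {c : ℝ} (hc : 0 < c) (e : ℝ) {n : ℕ} (hn : 1 ≤ n) : 0 < stepSize c e n := by
  have : (0 : ℝ) < n := by exact_mod_cast hn
  unfold stepSize; positivity

lemma stepSum_mono {c : ℝ} (hc : 0 < c) (e : ℝ) : Monotone (stepSum c e) := fun _ _ h =>
  Finset.sum_le_sum_of_subset_of_nonneg (Finset.Icc_subset_Icc_right h)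
    fun k _ _ => stepSize_nonneg hc e k

lemma le_stepSum_log {c e : ℝ} (hc : 0 < c) (he1 : e ≤ 1) (n : ℕ) :
    c * Real.log (n + 1) ≤ stepSum c e n := by
  have h := log_add_one_le_harmonic n
  calc c * Real.log (n + 1) ≤ c * (harmonic n : ℝ) := by
        gcongr; exact_mod_cast h
    _ = ∑ k ∈ Finset.Icc 1 n, c * (k : ℝ)⁻¹ := by
        rw [harmonic_eq_sum_Icc, ← Finset.mul_sum]; push_cast; rfl
    _ ≤ stepSum c e n := by
        refine Finset.sum_le_sum fun k hk => ?_
        have hk1 : (1 : ℝ) ≤ k := by exact_mod_cast (Finset.mem_Icc.1 hk).1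
        unfold stepSize
        gcongr
        rw [← Real.rpow_neg_one]
        exact Real.rpow_le_rpow_of_exponent_le hk1 (by linarith)

lemma le_stepSum_rpow {c e : ℝ} (hc : 0 < c) (he : 0 ≤ e) {n : ℕ} (hn : 1 ≤ n) :
    c * (n : ℝ) ^ (1 - e) ≤ stepSum c e n := by
  have hn0 : (0 : ℝ) < n := by exact_mod_cast hn
  calc c * (n : ℝ) ^ (1 - e) = ∑ k ∈ Finset.Icc 1 n, c * (n : ℝ) ^ (-e) := by
        rw [Finset.sum_const, Nat.card_Icc, nsmul_eq_mul, sub_eq_add_neg, Real.rpow_add hn0]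
        simp
        ring
    _ ≤ stepSum c e n := by
        refine Finset.sum_le_sum fun k hk => ?_
        obtain ⟨hk1, hk2⟩ := Finset.mem_Icc.1 hk
        unfold stepSize
        gcongr c * ?_
        exact Real.rpow_le_rpow_of_nonpos (by exact_mod_cast hk1) (by exact_mod_cast hk2)
          (by linarith)

lemma stepSum_le {c e : ℝ} (hc : 0 < c) (he : 0 ≤ e) (n : ℕ) : stepSum c e n ≤ c * n := by
  calc stepSum c e n ≤ ∑ k ∈ Finset.Icc 1 n, c := by
        refine Finset.sum_le_sum fun k hk => ?_
        have hk1 : (1 : ℝ) ≤ k := by exact_mod_cast (Finset.mem_Icc.1 hk).1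
        unfold stepSize
        exact mul_le_of_le_one_right hc.le (Real.rpow_le_one_of_one_le_of_nonpos hk1 (by linarith))
    _ = c * n := by simp [mul_comm]

lemma tendsto_stepSum {c e : ℝ} (hc : 0 < c) (he1 : e ≤ 1) :
    Tendsto (stepSum c e) atTop atTop := by
  refine tendsto_atTop_mono (le_stepSum_log hc he1) ?_
  refine Tendsto.const_mul_atTop hc (Real.tendsto_log_atTop.comp ?_)
  exact tendsto_atTop_add_const_right _ _ tendsto_natCast_atTop_atTop

lemma tendsto_log_stepSum {c e : ℝ} (hc : 0 < c) (he1 : e ≤ 1) :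
    Tendsto (fun n => Real.log (stepSum c e n)) atTop atTop :=
  Real.tendsto_log_atTop.comp (tendsto_stepSum hc he1)

lemma sqrt_stepSize {c : ℝ} (hc : 0 < c) (e : ℝ) (n : ℕ) :
    Real.sqrt (stepSize c e n) = Real.sqrt c * (n : ℝ) ^ (-(e / 2)) := by
  rw [stepSize, Real.sqrt_mul hc.le, Real.sqrt_eq_rpow ((n : ℝ) ^ (-e)), ← Real.rpow_mul (by simp)]
  congr 2; ring

lemma lilRate_eq {c : ℝ} (hc : 0 < c) (e : ℝ) (n : ℕ) :
    lilRate c e n = Real.sqrt c * ((n : ℝ) ^ (-(e / 2)) *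
      Real.sqrt (Real.log (stepSum c e n))) := by
  rw [lilRate, Real.sqrt_mul (stepSize_nonneg hc e n), sqrt_stepSize hc, mul_assoc]

/-- To bound by `lilRate` it suffices to bound the square of the logarithmic factor. -/
lemma isBigO_lilRate {c e : ℝ} (hc : 0 < c) (he1 : e ≤ 1) {L : ℕ → ℝ} {C : ℝ}
    (hL : ∀ᶠ n in atTop, L n ≤ C * Real.log (stepSum c e n)) :
    (fun n : ℕ => (n : ℝ) ^ (-(e / 2)) * Real.sqrt (L n)) =O[atTop] lilRate c e := by
  refine IsBigO.of_bound (Real.sqrt (max C 0) / Real.sqrt c) ?_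
  filter_upwards [hL, (tendsto_log_stepSum hc he1).eventually_gt_atTop 0] with n hn h0
  have hsc : 0 < Real.sqrt c := Real.sqrt_pos.2 hc
  rw [lilRate_eq hc, Real.norm_of_nonneg (by positivity), Real.norm_of_nonneg (by positivity)]
  have h : Real.sqrt (L n) ≤ Real.sqrt (max C 0) * Real.sqrt (Real.log (stepSum c e n)) := by
    rw [← Real.sqrt_mul (le_max_right _ _)]
    apply Real.sqrt_le_sqrt
    exact hn.trans (mul_le_mul_of_nonneg_right (le_max_left _ _) h0.le)
  calc (n : ℝ) ^ (-(e / 2)) * Real.sqrt (L n)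
      ≤ (n : ℝ) ^ (-(e / 2)) * (Real.sqrt (max C 0) * Real.sqrt (Real.log (stepSum c e n))) := by
        gcongr
    _ = _ := by field_simp

lemma rpow_isBigO_lilRate {c e : ℝ} (hc : 0 < c) (he1 : e ≤ 1) :
    (fun n : ℕ => (n : ℝ) ^ (-(e / 2))) =O[atTop] lilRate c e := by
  have := isBigO_lilRate (L := fun _ => 1) (C := 1) hc he1
    (by simpa using (tendsto_log_stepSum hc he1).eventually_ge_atTop 1)
  simpa using this

/-- The logarithm costs less than any power; this allows rates of different exponents to be
compared. -/
lemma lilRate_isBigO_rpow {c e : ℝ} (hc : 0 < c) (he : 0 ≤ e) (he1 : e ≤ 1) {δ : ℝ} (hδ : 0 < δ) :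
    lilRate c e =O[atTop] fun n : ℕ => (n : ℝ) ^ (-(e / 2) + δ) := by
  have h1 := (isLittleO_log_rpow_atTop (r := 2 * δ) (by linarith)).bound one_pos
  have h2 := (tendsto_rpow_atTop (y := 2 * δ) (by linarith)).eventually_ge_atTop |Real.log c|
  have h3 := tendsto_natCast_atTop_atTop (R := ℝ)
  refine IsBigO.of_bound (Real.sqrt c * Real.sqrt 2) ?_
  filter_upwards [h3.eventually h1, h3.eventually h2, eventually_ge_atTop 1,
    (tendsto_stepSum hc he1).eventually_gt_atTop 0] with n h1 h2 hn hpos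
  have hn0 : (0 : ℝ) < n := by exact_mod_cast hn
  have hlog : Real.log (stepSum c e n) ≤ 2 * (n : ℝ) ^ (2 * δ) := by
    rw [one_mul, Real.norm_of_nonneg (by positivity : 0 ≤ (n : ℝ) ^ (2 * δ))] at h1
    calc Real.log (stepSum c e n) ≤ Real.log (c * n) :=
          Real.log_le_log hpos (stepSum_le hc he n)
      _ = Real.log c + Real.log n := Real.log_mul hc.ne' hn0.ne'
      _ ≤ _ := by linarith [le_abs_self (Real.log c), Real.le_norm_self (Real.log n)]
  rw [lilRate_eq hc, Real.norm_of_nonneg (by positivity), Real.norm_of_nonneg (by positivity),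
    Real.rpow_add hn0]
  have h4 : Real.sqrt (Real.log (stepSum c e n)) ≤ Real.sqrt 2 * (n : ℝ) ^ δ := by
    refine (Real.sqrt_le_sqrt hlog).trans_eq ?_
    rw [Real.sqrt_mul (by norm_num), Real.sqrt_eq_rpow ((n : ℝ) ^ (2 * δ)),
      ← Real.rpow_mul hn0.le]
    congr 2; ring
  calc Real.sqrt c * ((n : ℝ) ^ (-(e / 2)) * Real.sqrt (Real.log (stepSum c e n)))
      ≤ Real.sqrt c * ((n : ℝ) ^ (-(e / 2)) * (Real.sqrt 2 * (n : ℝ) ^ δ)) := by gcongr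
    _ = _ := by ring

lemma eventually_lilRate_pos {c e : ℝ} (hc : 0 < c) (he1 : e ≤ 1) :
    ∀ᶠ n in atTop, 0 < lilRate c e n := by
  filter_upwards [(tendsto_log_stepSum hc he1).eventually_gt_atTop 0, eventually_ge_atTop 1]
    with n h hn
  exact Real.sqrt_pos.2 (mul_pos (stepSize_pos hc e hn) h)

/-- `n ^ (-p)` decreases by a factor at least `1 - p / n`. -/
lemma rpow_neg_succ_ge {p : ℝ} (hp : 0 ≤ p) {n : ℕ} (hn : 1 ≤ n) :
    (n : ℝ) ^ (-p) * (1 - p / n) ≤ ((n + 1 : ℕ) : ℝ) ^ (-p) := by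
  have hn0 : (0 : ℝ) < n := by exact_mod_cast hn
  have h1 : (((n + 1 : ℕ) : ℝ)) = n * (1 + 1 / n) := by push_cast; field_simp
  have h2 : (0 : ℝ) < 1 + 1 / n := by positivity
  rw [h1, Real.mul_rpow hn0.le h2.le]
  gcongr
  rw [Real.rpow_def_of_pos h2]
  have h3 : Real.log (1 + 1 / n) ≤ 1 / n := by
    have := Real.log_le_sub_one_of_pos h2
    linarith
  have h4 : -(p / n) ≤ Real.log (1 + 1 / n) * -p := by
    have := mul_le_mul_of_nonneg_left h3 hp
    have e : p * (1 / n) = p / n := by ring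
    linarith
  linarith [Real.add_one_le_exp (Real.log (1 + 1 / n) * -p)]

/-- The logarithmic factor increases with `n`, so only the power contributes to the decay. -/
lemma eventually_lilRate_succ_ge {c e : ℝ} (hc : 0 < c) (he : 0 ≤ e) (he1 : e ≤ 1) :
    ∀ᶠ n : ℕ in atTop, lilRate c e n * (1 - e / 2 / n) ≤ lilRate c e (n + 1) := by
  filter_upwards [eventually_ge_atTop 1, (tendsto_stepSum hc he1).eventually_gt_atTop 0]
    with n hn hpos
  rw [lilRate_eq hc, lilRate_eq hc]
  have h1 := rpow_neg_succ_ge (p := e / 2) (by linarith) hn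
  have h2 : Real.sqrt (Real.log (stepSum c e n)) ≤ Real.sqrt (Real.log (stepSum c e (n + 1))) :=
    Real.sqrt_le_sqrt (Real.log_le_log hpos (stepSum_mono hc e n.le_succ))
  calc Real.sqrt c * ((n : ℝ) ^ (-(e / 2)) * Real.sqrt (Real.log (stepSum c e n))) *
        (1 - e / 2 / n)
      = Real.sqrt c * (((n : ℝ) ^ (-(e / 2)) * (1 - e / 2 / n)) *
          Real.sqrt (Real.log (stepSum c e n))) := by ring
    _ ≤ Real.sqrt c * (((n + 1 : ℕ) : ℝ) ^ (-(e / 2)) *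
          Real.sqrt (Real.log (stepSum c e (n + 1)))) := by
        gcongr

/-- Slow variation relative to the steps `c n ^ (-e')`. -/
lemma eventually_mul_one_sub_le {v : ℕ → ℝ} {p c e l : ℝ} (hc : 0 < c) (he1 : e ≤ 1)
    (hl : 0 < l) (hp : e = 1 → p ≤ l * c) (hv0 : ∀ᶠ n in atTop, 0 < v n)
    (hv : ∀ᶠ n : ℕ in atTop, v n * (1 - p / n) ≤ v (n + 1)) :
    ∀ᶠ n in atTop, v n * (1 - l * stepSize c e n) ≤ v (n + 1) := by
  have key : ∀ᶠ n : ℕ in atTop, p / n ≤ l * stepSize c e n := by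
    rcases he1.eq_or_lt with rfl | he
    · filter_upwards [eventually_ge_atTop 1] with n hn
      have hn0 : (0 : ℝ) < n := by exact_mod_cast hn
      rw [stepSize, Real.rpow_neg_one, div_eq_mul_inv, ← mul_assoc]
      gcongr
      exact hp rfl
    · have h1 := (tendsto_rpow_atTop (y := 1 - e) (by linarith)).comp
        (tendsto_natCast_atTop_atTop (R := ℝ))
      filter_upwards [h1.eventually_ge_atTop (p / (l * c)), eventually_ge_atTop 1] with n h hn
      have hn0 : (0 : ℝ) < n := by exact_mod_cast hn
      rw [div_le_iff₀ (by positivity)] at h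
      rw [div_le_iff₀ hn0, stepSize]
      calc p ≤ (n : ℝ) ^ (1 - e) * (l * c) := h
        _ = _ := by rw [sub_eq_add_neg, Real.rpow_add hn0, Real.rpow_one]; ring
  filter_upwards [key, hv, hv0] with n h1 h2 h3
  refine le_trans ?_ h2
  gcongr

/-! ### Deterministic recursions -/

/-- The bound `α ≤ S v` propagates: one step contracts `α` at rate `l` while `v` loses at most rate
`l'`, and the gap `l - l'` absorbs the input once `S (l - l') ≥ C`. -/
lemma isBigO_of_contracting {α v g : ℕ → ℝ} {l l' C : ℝ} (hll : l' < l) (hα : ∀ n, 0 ≤ α n)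
    (hg : ∀ᶠ n in atTop, 0 ≤ g n ∧ l * g n ≤ 1) (hv : ∀ᶠ n in atTop, 0 < v n)
    (hvs : ∀ᶠ n in atTop, v n * (1 - l' * g n) ≤ v (n + 1))
    (hrec : ∀ᶠ n in atTop, α (n + 1) ≤ (1 - l * g n) * α n + g n * (C * v n)) :
    α =O[atTop] v := by
  obtain ⟨N, hN⟩ := eventually_atTop.1 (((hg.and hv).and hvs).and hrec)
  set S := max (α N / v N) (max C 0 / (l - l'))
  have hgap : 0 < l - l' := by linarith
  have hS : 0 ≤ S := le_max_of_le_right (by positivity)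
  have hSC : C ≤ S * (l - l') := by
    have : max C 0 / (l - l') ≤ S := le_max_right _ _
    rw [div_le_iff₀ hgap] at this
    exact (le_max_left _ _).trans this
  have key : ∀ n, N ≤ n → α n ≤ S * v n := by
    intro n hn
    induction n, hn using Nat.le_induction with
    | base =>
      have hvN := (hN N le_rfl).1.1.2
      rw [← div_le_iff₀ hvN]
      exact le_max_left _ _
    | succ n hn ih =>
      obtain ⟨⟨⟨⟨h1, h2⟩, h3⟩, h4⟩, h5⟩ := hN n hn
      calc α (n + 1) ≤ (1 - l * g n) * α n + g n * (C * v n) := h5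
        _ ≤ (1 - l * g n) * (S * v n) + g n * (S * (l - l') * v n) := by
            gcongr
        _ = S * (v n * (1 - l' * g n)) := by ring
        _ ≤ S * v (n + 1) := by gcongr
  refine IsBigO.of_bound S ?_
  filter_upwards [eventually_ge_atTop N] with n hn
  rw [Real.norm_of_nonneg (hα n), Real.norm_of_nonneg (hN n hn).1.1.2.le]
  exact key n hn

/-- The coupling is triangular up to small terms: `α` acts on `B` with a fixed constant, but `B`
acts on `α` with an arbitrarily small one. Hence the pair of bounds `α ≤ S v`, `B ≤ L S v` is
preserved for a suitable ratio `L`. -/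
lemma isBigO_of_coupled_contracting {α B v g h : ℕ → ℝ} {l₁ l₁' l₂ l₂' C : ℝ} (hC : 0 < C)
    (hl₁ : l₁' < l₁) (hl₂ : l₂' < l₂) (hα : ∀ n, 0 ≤ α n) (hB : ∀ n, 0 ≤ B n)
    (hg : ∀ᶠ n in atTop, 0 ≤ g n ∧ l₁ * g n ≤ 1) (hh : ∀ᶠ n in atTop, 0 ≤ h n ∧ l₂ * h n ≤ 1)
    (hv : ∀ᶠ n in atTop, 0 < v n)
    (hv₁ : ∀ᶠ n in atTop, v n * (1 - l₁' * g n) ≤ v (n + 1))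
    (hv₂ : ∀ᶠ n in atTop, v n * (1 - l₂' * h n) ≤ v (n + 1))
    (hrα : ∀ δ > 0, ∀ᶠ n in atTop,
      α (n + 1) ≤ (1 - l₁ * g n) * α n + g n * (C * v n + δ * (α n + B n)))
    (hrB : ∀ δ > 0, ∀ᶠ n in atTop,
      B (n + 1) ≤ (1 - l₂ * h n) * B n + h n * (C * v n + C * α n + δ * B n)) :
    α =O[atTop] v ∧ B =O[atTop] v := by
  set G₁ := l₁ - l₁' with hG₁
  set G₂ := l₂ - l₂' with hG₂
  have hG₁0 : 0 < G₁ := by linarith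
  have hG₂0 : 0 < G₂ := by linarith
  -- `2 C = (G₂ / 2) L`: half of the gap `G₂` absorbs `C v + C α`, the other half absorbs `δ B`.
  set L := 4 * C / G₂ with hL
  have hL0 : 0 < L := by positivity
  -- With `α + B ≤ (1 + L) S v`, this `δ` spends half of `G₁`; the other half pays for `C v` because
  -- `2 C ≤ S G₁`.
  obtain ⟨N, hN⟩ := eventually_atTop.1 ((((((hg.and hh).and hv).and hv₁).and hv₂).and
    (hrα (G₁ / (2 * (1 + L))) (by positivity))).and (hrB (G₂ / 2) (by positivity)))
  set S := max (max (α N / v N) (B N / v N / L)) (max 1 (2 * C / G₁))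
  have hS1 : 1 ≤ S := (le_max_left _ _).trans (le_max_right _ _)
  have hSC : 2 * C ≤ S * G₁ := by
    have : 2 * C / G₁ ≤ S := (le_max_right _ _).trans (le_max_right _ _)
    rwa [div_le_iff₀ hG₁0] at this
  have key : ∀ n, N ≤ n → α n ≤ S * v n ∧ B n ≤ L * (S * v n) := by
    intro n hn
    induction n, hn using Nat.le_induction with
    | base =>
      have hvN := (hN N le_rfl).1.1.1.1.2
      constructor
      · rw [← div_le_iff₀ hvN]
        exact (le_max_left _ _).trans (le_max_left _ _)
      · have : B N / v N / L ≤ S := (le_max_right _ _).trans (le_max_left _ _)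
        rw [div_le_iff₀ hL0, div_le_iff₀ hvN] at this
        linarith
    | succ n hn ih =>
      obtain ⟨⟨⟨⟨⟨⟨⟨hg0, hg1⟩, hh0, hh1⟩, hv0⟩, hs1⟩, hs2⟩, h5⟩, h6⟩ := hN n hn
      obtain ⟨ih1, ih2⟩ := ih
      constructor
      · calc α (n + 1)
            ≤ (1 - l₁ * g n) * α n + g n * (C * v n + G₁ / (2 * (1 + L)) * (α n + B n)) := h5
          _ ≤ (1 - l₁ * g n) * (S * v n) + g n * (S * G₁ / 2 * v n +
                G₁ / (2 * (1 + L)) * (S * v n + L * (S * v n))) := by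
              gcongr
              linarith
          _ = S * (v n * (1 - l₁' * g n)) := by
              rw [hG₁]; field_simp; ring
          _ ≤ S * v (n + 1) := by gcongr
      · calc B (n + 1) ≤ (1 - l₂ * h n) * B n + h n * (C * v n + C * α n + G₂ / 2 * B n) := h6
          _ ≤ (1 - l₂ * h n) * (L * (S * v n)) + h n * (C * (S * v n) + C * (S * v n) +
                G₂ / 2 * (L * (S * v n))) := by
              have : v n ≤ S * v n := le_mul_of_one_le_left hv0.le hS1
              gcongr
          _ = L * S * (v n * (1 - l₂' * h n)) := by
              have : 2 * C = G₂ / 2 * L := by rw [hL]; field_simp; ring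
              have e : h n * (C * (S * v n) + C * (S * v n) + G₂ / 2 * (L * (S * v n))) =
                h n * (S * v n) * (2 * C + G₂ / 2 * L) := by ring
              rw [e, this, hG₂]; ring
          _ ≤ L * S * v (n + 1) := by gcongr
          _ = _ := by ring
  constructor
  · refine IsBigO.of_bound S ?_
    filter_upwards [eventually_ge_atTop N] with n hn
    rw [Real.norm_of_nonneg (hα n), Real.norm_of_nonneg (hN n hn).1.1.1.1.2.le]
    exact (key n hn).1
  · refine IsBigO.of_bound (L * S) ?_
    filter_upwards [eventually_ge_atTop N] with n hn
    rw [Real.norm_of_nonneg (hB n), Real.norm_of_nonneg (hN n hn).1.1.1.1.2.le]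
    linarith [(key n hn).2]

lemma tendsto_stepSize {c e : ℝ} (he : 0 < e) : Tendsto (stepSize c e) atTop (𝓝 0) := by
  have := ((tendsto_rpow_neg_atTop he).comp (tendsto_natCast_atTop_atTop (R := ℝ))).const_mul c
  rw [mul_zero] at this
  exact this

lemma eventually_mul_stepSize_le {c e : ℝ} (he : 0 < e) (l : ℝ) {t : ℝ} (ht : 0 < t) :
    ∀ᶠ n in atTop, l * stepSize c e n ≤ t := by
  have := (tendsto_stepSize (c := c) he).const_mul l
  rw [mul_zero] at this
  exact (this.eventually_lt_const ht).mono fun _ h => h.le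

lemma rpow_natCast_isBigO {p q : ℝ} (h : p ≤ q) :
    (fun n : ℕ => (n : ℝ) ^ p) =O[atTop] fun n : ℕ => (n : ℝ) ^ q := by
  refine IsBigO.of_bound 1 ?_
  filter_upwards [eventually_ge_atTop 1] with n hn
  have : (1 : ℝ) ≤ n := by exact_mod_cast hn
  rw [Real.norm_of_nonneg (by positivity), Real.norm_of_nonneg (by positivity), one_mul]
  exact Real.rpow_le_rpow_of_exponent_le this h

lemma rpow_mul_isBigO {p q r : ℝ} (h : p + q ≤ r) :
    (fun n : ℕ => (n : ℝ) ^ p * (n : ℝ) ^ q) =O[atTop] fun n : ℕ => (n : ℝ) ^ r := by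
  refine IsBigO.trans (IsBigO.of_bound 1 ?_) (rpow_natCast_isBigO h)
  filter_upwards [eventually_ge_atTop 1] with n hn
  have : (0 : ℝ) < n := by exact_mod_cast hn
  rw [one_mul, Real.rpow_add this]

lemma exists_forall_le_mul_of_isBigO {u v : ℕ → ℝ} (h : u =O[atTop] v)
    (hv : ∀ᶠ n in atTop, 0 < v n) : ∃ c > 0, ∀ᶠ n in atTop, u n ≤ c * v n := by
  obtain ⟨c, hc, hb⟩ := h.exists_pos
  refine ⟨c, hc, ?_⟩
  filter_upwards [hb.bound, hv] with n h1 h2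
  rw [Real.norm_of_nonneg h2.le] at h1
  exact (Real.le_norm_self _).trans h1

/-! ### The scalar comparison system -/

/-- Here `δ` stands for quantities tending to `0` and `w` for a multiple of the target rate. The
point is that both `α` and `B` come back with a factor `δ`, as the slow half of
`isBigO_of_coupled_contracting` requires. -/
lemma slow_drift_le {K δ α B w X Y Z U R : ℝ} (hK : 0 < K) (hδ : 0 ≤ δ) (hδ1 : δ ≤ 1)
    (hα : 0 ≤ α) (hB : 0 ≤ B) (hw : 0 ≤ w) (hX : X ≤ α + w + K * (δ * (B + w)))
    (hY : Y ≤ B + w) (hZ : Z ≤ w) (hU : U ≤ δ * Y) (hR : R ≤ K * (δ * (X + Y) + w)) :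
    K * (Z + U + R) ≤ (2 * K + 4 * K ^ 2 + K ^ 3) * w +
      δ * (K + K ^ 2 + K ^ 3) * (α + B) := by
  have hδw : δ * w ≤ w := mul_le_of_le_one_left hw hδ1
  have hδ2 : δ * (δ * (B + w)) ≤ δ * B + w := by
    calc δ * (δ * (B + w)) ≤ 1 * (δ * (B + w)) := by gcongr
      _ ≤ _ := by linarith
  have hU' : U ≤ δ * B + w := by
    have := mul_le_mul_of_nonneg_left hY hδ
    linarith
  have hXY : δ * (X + Y) ≤ δ * α + δ * B + 2 * w + K * (δ * B + w) := by
    have h1 := mul_le_mul_of_nonneg_left hX hδ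
    have h2 := mul_le_mul_of_nonneg_left hY hδ
    have h3 := mul_le_mul_of_nonneg_left hδ2 hK.le
    nlinarith
  have hR' : R ≤ K * (δ * α + δ * B + 2 * w + K * (δ * B + w) + w) :=
    hR.trans (mul_le_mul_of_nonneg_left (by linarith) hK.le)
  calc K * (Z + U + R) ≤ K * (w + (δ * B + w) +
        K * (δ * α + δ * B + 2 * w + K * (δ * B + w) + w)) := by gcongr
    _ = (2 * K + 3 * K ^ 2 + K ^ 3) * w + K ^ 2 * (δ * α) +
          (K + K ^ 2 + K ^ 3) * (δ * B) := by ring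
    _ ≤ (2 * K + 4 * K ^ 2 + K ^ 3) * w + (K + K ^ 2 + K ^ 3) * (δ * α) +
          (K + K ^ 2 + K ^ 3) * (δ * B) := by
        have : 0 < K ^ 3 := by positivity
        gcongr
        · norm_num
        · linarith
    _ = _ := by ring

/-- In the fast equation `X` enters at full strength, so only the coefficient of `B` is small and
that of `α` is a constant. -/
lemma fast_drift_le {K δ α B w X Y O R : ℝ} (hK : 0 < K) (hδ : 0 ≤ δ) (hδ1 : δ ≤ 1)
    (hα : 0 ≤ α) (hB : 0 ≤ B) (hw : 0 ≤ w) (hX : X ≤ α + w + K * (δ * (B + w)))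
    (hY : Y ≤ B + w) (hO : O ≤ w) (hR : R ≤ K * (δ * (X + Y) + w)) :
    K * (O + X + R) ≤ (2 * K + 4 * K ^ 2 + K ^ 3) * w + (K + K ^ 2) * α +
      δ * ((K + K ^ 2 + K ^ 3) + (K + K ^ 2 + K ^ 3)) * B := by
  have hδw : δ * w ≤ w := mul_le_of_le_one_left hw hδ1
  have hδα : δ * α ≤ α := mul_le_of_le_one_left hα hδ1
  have hδ2 : δ * (δ * (B + w)) ≤ δ * B + w := by
    calc δ * (δ * (B + w)) ≤ 1 * (δ * (B + w)) := by gcongr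
      _ ≤ _ := by linarith
  have hXY : δ * (X + Y) ≤ α + δ * B + 2 * w + K * (δ * B + w) := by
    have h1 := mul_le_mul_of_nonneg_left hX hδ
    have h2 := mul_le_mul_of_nonneg_left hY hδ
    have h3 := mul_le_mul_of_nonneg_left hδ2 hK.le
    nlinarith
  have hX' : X ≤ α + w + K * (δ * B + w) :=
    hX.trans (by gcongr; linarith)
  have hR' : R ≤ K * (α + δ * B + 2 * w + K * (δ * B + w) + w) :=
    hR.trans (mul_le_mul_of_nonneg_left (by linarith) hK.le)
  calc K * (O + X + R) ≤ K * (w + (α + w + K * (δ * B + w)) +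
        K * (α + δ * B + 2 * w + K * (δ * B + w) + w)) := by gcongr
    _ = (2 * K + 4 * K ^ 2 + K ^ 3) * w + (K + K ^ 2) * α +
          (K ^ 2 + K ^ 2 + K ^ 3) * (δ * B) := by ring
    _ ≤ (2 * K + 4 * K ^ 2 + K ^ 3) * w + (K + K ^ 2) * α +
          ((K + K ^ 2 + K ^ 3) + (K + K ^ 2 + K ^ 3)) * (δ * B) := by
        have : 0 < K ^ 3 := by positivity
        refine add_le_add le_rfl (mul_le_mul_of_nonneg_right ?_ (mul_nonneg hδ hB))
        nlinarith [sq_nonneg K]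
    _ = _ := by ring

/-- A first bound of both components, with the slower of the two rates. -/
lemma two_time_scale_scalar_fast {α B X Y Z O R : ℕ → ℝ} {β₀ γ₀ a b K l₁ l₁' l₂ : ℝ}
    (hβ₀ : 0 < β₀) (hγ₀ : 0 < γ₀) (ha : 1 / 2 < a) (hab : a < b) (hb : b ≤ 1)
    (hl₁' : 0 < l₁') (hl₁ : l₁' < l₁) (hl₂ : 0 < l₂) (hb1 : b = 1 → 1 / 2 ≤ l₁' * β₀)
    (hK : 0 < K) (hα : ∀ n, 0 ≤ α n) (hB : ∀ n, 0 ≤ B n) (hX0 : ∀ n, 0 ≤ X n)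
    (hY0 : ∀ n, 0 ≤ Y n)
    (hX : Tendsto X atTop (𝓝 0)) (hY : Tendsto Y atTop (𝓝 0))
    (hZ : Z =O[atTop] lilRate β₀ b) (hO : O =O[atTop] lilRate γ₀ a)
    (hR : ∀ᶠ n : ℕ in atTop, R n ≤ K * (X n ^ 2 + Y n ^ 2 + (n : ℝ) ^ (-(b / 2))))
    (hXα : ∀ᶠ n : ℕ in atTop, X n ≤ α n + Z n + K * ((n : ℝ) ^ (a - b) * Y n))
    (hYB : ∀ᶠ n in atTop, Y n ≤ B n + O n)
    (hrα : ∀ᶠ n : ℕ in atTop, α (n + 1) ≤ (1 - l₁ * stepSize β₀ b n) * α n +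
      stepSize β₀ b n * (K * (Z n + (n : ℝ) ^ (a - b) * Y n + R n)))
    (hrB : ∀ᶠ n in atTop, B (n + 1) ≤ (1 - l₂ * stepSize γ₀ a n) * B n +
      stepSize γ₀ a n * (K * (O n + X n + R n))) :
    α =O[atTop] lilRate γ₀ a ∧ B =O[atTop] lilRate γ₀ a := by
  have ha1 : a ≤ 1 := by linarith
  have ha0 : 0 ≤ a := by linarith
  have hb0 : 0 ≤ b := by linarith
  have hu := eventually_lilRate_pos (e := b) hβ₀ hb
  have hv := eventually_lilRate_pos (e := a) hγ₀ ha1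
  have hκ : Tendsto (fun n : ℕ => (n : ℝ) ^ (a - b)) atTop (𝓝 0) := by
    have := (tendsto_rpow_neg_atTop (y := b - a) (by linarith)).comp
      (tendsto_natCast_atTop_atTop (R := ℝ))
    simpa [Function.comp_def] using this
  have hgβ : ∀ᶠ n in atTop, 0 ≤ stepSize β₀ b n ∧ l₁ * stepSize β₀ b n ≤ 1 :=
    (eventually_mul_stepSize_le (by linarith) l₁ one_pos).mono
      fun n h => ⟨stepSize_nonneg hβ₀ b n, h⟩
  have hgγ : ∀ᶠ n in atTop, 0 ≤ stepSize γ₀ a n ∧ l₂ * stepSize γ₀ a n ≤ 1 :=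
    (eventually_mul_stepSize_le (by linarith) l₂ one_pos).mono
      fun n h => ⟨stepSize_nonneg hγ₀ a n, h⟩
  -- The rate loses a fraction `a / (2n)` per step. If `b = 1` this must not exceed `l₁' β₀ / n`,
  -- which holds as `a ≤ 1`. For the fast step the critical case `a = 1` is excluded by `a < b ≤ 1`.
  have hvβ := eventually_mul_one_sub_le hβ₀ hb hl₁' (fun h => by linarith [hb1 h]) hv
    (eventually_lilRate_succ_ge hγ₀ ha0 ha1)
  have hvγ := eventually_mul_one_sub_le (l := l₂ / 2) hγ₀ ha1 (by linarith)
    (fun h => by linarith) hv (eventually_lilRate_succ_ge hγ₀ ha0 ha1)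
  have huv : lilRate β₀ b =O[atTop] lilRate γ₀ a :=
    ((lilRate_isBigO_rpow hβ₀ hb0 hb (δ := (b - a) / 2) (by linarith)).trans
      (rpow_natCast_isBigO (by linarith))).trans (rpow_isBigO_lilRate hγ₀ ha1)
  obtain ⟨c₁, hc₁, hZ'⟩ := exists_forall_le_mul_of_isBigO (hZ.trans huv) hv
  obtain ⟨c₂, hc₂, hO'⟩ := exists_forall_le_mul_of_isBigO hO hv
  obtain ⟨c₃, hc₃, hn'⟩ := exists_forall_le_mul_of_isBigO
    ((rpow_isBigO_lilRate hβ₀ hb).trans huv) hv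
  set c := c₁ + c₂ + c₃
  set P := K + K ^ 2 + K ^ 3 with hP
  have hP0 : 0 < P := by positivity
  -- Convergence to zero makes `X²`, `Y²` and `n ^ (a - b) Y` at most `δ` times linear terms. This
  -- is the only use of (A1) in this first bound.
  have hev : ∀ δ > 0, ∀ᶠ n : ℕ in atTop,
      (X n ≤ α n + c * lilRate γ₀ a n + K * (δ * (B n + c * lilRate γ₀ a n))) ∧
      Y n ≤ B n + c * lilRate γ₀ a n ∧ Z n ≤ c * lilRate γ₀ a n ∧ O n ≤ c * lilRate γ₀ a n ∧
      (n : ℝ) ^ (a - b) * Y n ≤ δ * Y n ∧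
      R n ≤ K * (δ * (X n + Y n) + c * lilRate γ₀ a n) := by
    intro δ hδ
    filter_upwards [hZ', hO', hn', hR, hXα, hYB, hX.eventually_lt_const hδ,
      hY.eventually_lt_const hδ, hκ.eventually_lt_const hδ, hv] with n z1 z2 z3 z4 z5 z6 z7 z8 z9 z10
    have k1 : c₁ * lilRate γ₀ a n ≤ c * lilRate γ₀ a n := by gcongr; simp [c]; linarith
    have k2 : c₂ * lilRate γ₀ a n ≤ c * lilRate γ₀ a n := by gcongr; simp [c]; linarith
    have k3 : c₃ * lilRate γ₀ a n ≤ c * lilRate γ₀ a n := by gcongr; simp [c]; linarith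
    have k4 : (n : ℝ) ^ (a - b) * Y n ≤ δ * Y n := mul_le_mul_of_nonneg_right z9.le (hY0 n)
    have k5 : Y n ≤ B n + c * lilRate γ₀ a n := by linarith
    refine ⟨?_, k5, by linarith, by linarith, k4, ?_⟩
    · refine z5.trans (add_le_add (by linarith) (mul_le_mul_of_nonneg_left ?_ hK.le))
      exact k4.trans (mul_le_mul_of_nonneg_left k5 hδ.le)
    · refine z4.trans (mul_le_mul_of_nonneg_left ?_ hK.le)
      have := mul_le_mul_of_nonneg_right z7.le (hX0 n)
      have := mul_le_mul_of_nonneg_right z8.le (hY0 n)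
      nlinarith
  have hc : 0 < c := by positivity
  refine isBigO_of_coupled_contracting (C := (2 * K + 4 * K ^ 2 + K ^ 3) * c + (K + K ^ 2) +
    (2 * K + 4 * K ^ 2 + 2 * K ^ 3) * c)
    (by positivity) hl₁ (by linarith : l₂ / 2 < l₂) hα hB hgβ hgγ hv hvβ hvγ ?_ ?_
  · intro δ hδ
    have hδ'0 : 0 < min 1 (δ / P) := by positivity
    have hδ'P : min 1 (δ / P) * P ≤ δ := by
      rw [← le_div_iff₀ hP0]; exact min_le_right _ _
    filter_upwards [hev _ hδ'0, hrα, hgβ, hv] with n ⟨e1, e2, e3, e4, e5, e6⟩ hr hg hv0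
    refine hr.trans (add_le_add le_rfl (mul_le_mul_of_nonneg_left ?_ hg.1))
    refine (slow_drift_le hK hδ'0.le (min_le_left _ _) (hα n) (hB n) (by positivity)
      e1 e2 e3 e5 e6).trans (add_le_add ?_ ?_)
    · rw [← mul_assoc]
      gcongr
      have : 0 ≤ (K + K ^ 2) + (2 * K + 4 * K ^ 2 + 2 * K ^ 3) * c := by positivity
      linarith
    · exact mul_le_mul_of_nonneg_right hδ'P (add_nonneg (hα n) (hB n))
  · intro δ hδ
    have hδ'0 : 0 < min 1 (δ / (P + P)) := by positivity
    have hδ'P : min 1 (δ / (P + P)) * (P + P) ≤ δ := by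
      rw [← le_div_iff₀ (by positivity)]; exact min_le_right _ _
    filter_upwards [hev _ hδ'0, hrB, hgγ, hv] with n ⟨e1, e2, e3, e4, e5, e6⟩ hr hg hv0
    refine hr.trans (add_le_add le_rfl (mul_le_mul_of_nonneg_left ?_ hg.1))
    refine (fast_drift_le hK hδ'0.le (min_le_left _ _) (hα n) (hB n) (by positivity)
      e1 e2 e4 e6).trans (add_le_add (add_le_add ?_ ?_) ?_)
    · rw [← mul_assoc]
      have : 0 ≤ (K + K ^ 2) + (2 * K + 4 * K ^ 2 + 2 * K ^ 3) * c := by positivity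
      gcongr
      linarith
    · have : 0 ≤ (2 * K + 4 * K ^ 2 + K ^ 3) * c +
        (2 * K + 4 * K ^ 2 + 2 * K ^ 3) * c := by positivity
      refine mul_le_mul_of_nonneg_right ?_ (hα n)
      linarith
    · exact mul_le_mul_of_nonneg_right hδ'P (hB n)

/-- The scalar comparison system of the two-time-scale recursion. -/
lemma two_time_scale_scalar {α B X Y Z O R : ℕ → ℝ} {β₀ γ₀ a b K l₁ l₁' l₂ : ℝ}
    (hβ₀ : 0 < β₀) (hγ₀ : 0 < γ₀) (ha : 1 / 2 < a) (hab : a < b) (hb : b ≤ 1)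
    (hl₁' : 0 < l₁') (hl₁ : l₁' < l₁) (hl₂ : 0 < l₂) (hb1 : b = 1 → 1 / 2 ≤ l₁' * β₀)
    (hK : 0 < K) (hα : ∀ n, 0 ≤ α n) (hB : ∀ n, 0 ≤ B n) (hX0 : ∀ n, 0 ≤ X n)
    (hY0 : ∀ n, 0 ≤ Y n)
    (hX : Tendsto X atTop (𝓝 0)) (hY : Tendsto Y atTop (𝓝 0))
    (hZ : Z =O[atTop] lilRate β₀ b) (hO : O =O[atTop] lilRate γ₀ a)
    (hR : ∀ᶠ n : ℕ in atTop, R n ≤ K * (X n ^ 2 + Y n ^ 2 + (n : ℝ) ^ (-(b / 2))))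
    (hXα : ∀ᶠ n : ℕ in atTop, X n ≤ α n + Z n + K * ((n : ℝ) ^ (a - b) * Y n))
    (hYB : ∀ᶠ n in atTop, Y n ≤ B n + O n)
    (hrα : ∀ᶠ n : ℕ in atTop, α (n + 1) ≤ (1 - l₁ * stepSize β₀ b n) * α n +
      stepSize β₀ b n * (K * (Z n + (n : ℝ) ^ (a - b) * Y n + R n)))
    (hrB : ∀ᶠ n in atTop, B (n + 1) ≤ (1 - l₂ * stepSize γ₀ a n) * B n +
      stepSize γ₀ a n * (K * (O n + X n + R n))) :
    X =O[atTop] lilRate β₀ b ∧ Y =O[atTop] lilRate γ₀ a := by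
  have ha1 : a ≤ 1 := by linarith
  have ha0 : 0 ≤ a := by linarith
  have hb0 : 0 ≤ b := by linarith
  have hu := eventually_lilRate_pos (e := b) hβ₀ hb
  have hv := eventually_lilRate_pos (e := a) hγ₀ ha1
  have hgβ : ∀ᶠ n in atTop, 0 ≤ stepSize β₀ b n ∧ l₁ * stepSize β₀ b n ≤ 1 :=
    (eventually_mul_stepSize_le (by linarith) l₁ one_pos).mono
      fun n h => ⟨stepSize_nonneg hβ₀ b n, h⟩
  have huβ := eventually_mul_one_sub_le hβ₀ hb hl₁' (fun h => by linarith [hb1 h]) hu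
    (eventually_lilRate_succ_ge hβ₀ hb0 hb)
  have hfirst := two_time_scale_scalar_fast hβ₀ hγ₀ ha hab hb hl₁' hl₁ hl₂ hb1 hK hα hB hX0 hY0
    hX hY hZ hO hR hXα hYB hrα hrB
  have hYO : Y =O[atTop] lilRate γ₀ a := by
    refine IsBigO.trans ?_ (hfirst.2.add hO)
    refine IsBigO.of_bound 1 ?_
    filter_upwards [hYB] with n h
    rw [Real.norm_of_nonneg (hY0 n), one_mul]
    exact h.trans (Real.le_norm_self _)
  refine ⟨?_, hYO⟩
  -- the sharp bound for the slow component
  have hδ : ∃ δ > 0, δ < (b - a) / 2 ∧ 2 * δ < a - b / 2 := by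
    refine ⟨min ((b - a) / 4) ((a - b / 2) / 4), lt_min (by linarith) (by linarith), ?_, ?_⟩
    · exact (min_le_left _ _).trans_lt (by linarith)
    · have := min_le_right ((b - a) / 4) ((a - b / 2) / 4); linarith
  obtain ⟨δ, hδ0, hδ1, hδ2⟩ := hδ
  have hYδ := hYO.trans (lilRate_isBigO_rpow hγ₀ ha0 ha1 hδ0)
  have hκY : (fun n : ℕ => (n : ℝ) ^ (a - b) * Y n) =O[atTop] lilRate β₀ b := by
    exact (((isBigO_refl _ _).mul hYδ).trans (rpow_mul_isBigO (by linarith))).trans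
      (rpow_isBigO_lilRate hβ₀ hb)
  have hYsq : (fun n => Y n ^ 2) =O[atTop] lilRate β₀ b := by
    have : (fun n => Y n ^ 2) = fun n => Y n * Y n := by ext; ring
    rw [this]
    exact ((hYδ.mul hYδ).trans (rpow_mul_isBigO (by linarith))).trans
      (rpow_isBigO_lilRate hβ₀ hb)
  have hαO : α =O[atTop] lilRate β₀ b := by
    obtain ⟨c₁, hc₁, hZ'⟩ := exists_forall_le_mul_of_isBigO hZ hu
    obtain ⟨c₂, hc₂, hκ'⟩ := exists_forall_le_mul_of_isBigO hκY hu
    obtain ⟨c₃, hc₃, hY'⟩ := exists_forall_le_mul_of_isBigO hYsq hu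
    obtain ⟨c₄, hc₄, hn'⟩ := exists_forall_le_mul_of_isBigO (rpow_isBigO_lilRate hβ₀ hb) hu
    -- The remaining `K² X²` is at most `K² δ' α` plus terms of the right order; it lowers the
    -- contraction rate from `l₁` to no less than the midpoint of `l₁` and `l₁'`.
    set δ' := min 1 ((l₁ - l₁') / 2 / K ^ 2) with hδ'
    have hδ'0 : 0 < δ' := lt_min one_pos (div_pos (by linarith) (by positivity))
    have hδ'1 : δ' ≤ 1 := min_le_left _ _
    have hδ'K : δ' * K ^ 2 ≤ (l₁ - l₁') / 2 := by
      rw [← le_div_iff₀ (by positivity)]; exact min_le_right _ _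
    refine isBigO_of_contracting (l := (l₁ + l₁') / 2) (l' := l₁')
      (C := K * (c₁ + c₂ + K * (c₁ + K * c₂ + c₃ + c₄))) (by linarith) hα ?_ hu huβ ?_
    · filter_upwards [hgβ] with n h
      refine ⟨h.1, le_trans ?_ h.2⟩
      exact mul_le_mul_of_nonneg_right (by linarith) h.1
    · filter_upwards [hZ', hκ', hY', hn', hR, hXα, hX.eventually_lt_const hδ'0, hrα, hgβ, hu]
        with n z1 z2 z3 z4 z5 z6 z7 z8 z9 z10
      set u := lilRate β₀ b n
      have hXn := hX0 n
      have hαn := hα n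
      have f1 : X n ^ 2 ≤ δ' * α n + (c₁ + K * c₂) * u := by
        have g1 : X n ≤ α n + (c₁ + K * c₂) * u := by
          refine z6.trans ?_
          have := mul_le_mul_of_nonneg_left z2 hK.le
          linarith
        calc X n ^ 2 = X n * X n := by ring
          _ ≤ δ' * (α n + (c₁ + K * c₂) * u) := by gcongr
          _ = δ' * α n + δ' * ((c₁ + K * c₂) * u) := by ring
          _ ≤ _ := by
            exact add_le_add le_rfl (mul_le_of_le_one_left (by positivity) hδ'1)
      calc α (n + 1) ≤ (1 - l₁ * stepSize β₀ b n) * α n +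
              stepSize β₀ b n * (K * (Z n + (n : ℝ) ^ (a - b) * Y n + R n)) := z8
        _ ≤ (1 - l₁ * stepSize β₀ b n) * α n + stepSize β₀ b n * (K * (c₁ * u + c₂ * u +
              K * (δ' * α n + (c₁ + K * c₂) * u + c₃ * u + c₄ * u))) := by
            have := z9.1
            gcongr
            refine z5.trans ?_
            gcongr
        _ = (1 - (l₁ - δ' * K ^ 2) * stepSize β₀ b n) * α n + stepSize β₀ b n *
              (K * (c₁ + c₂ + K * (c₁ + K * c₂ + c₃ + c₄)) * u) := by ring
        _ ≤ _ := by
            have := z9.1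
            gcongr
            linarith
  refine IsBigO.trans ?_ ((hαO.add hZ).add (hκY.const_mul_left K))
  refine IsBigO.of_bound 1 ?_
  filter_upwards [hXα] with n h
  rw [Real.norm_of_nonneg (hX0 n), one_mul]
  exact h.trans (Real.le_norm_self _)

/-! ### Decoupling of the vector recursion -/

lemma stepSize_eq_mul (c e : ℝ) (n : ℕ) : stepSize c e n = c * stepSize 1 e n := by
  simp [stepSize]

/-- Meant for `p = b - a`: the coefficient `ε` of the change of variables has the same order at `n -
1` and at `n`, and its increment carries an extra factor `1 / n`. -/
lemma pred_rpow_neg_le {p : ℝ} (hp0 : 0 ≤ p) (hp1 : p ≤ 1) {n : ℕ} (hn : 2 ≤ n) :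
    ((n - 1 : ℕ) : ℝ) ^ (-p) ≤ 2 * (n : ℝ) ^ (-p) ∧
      |((n - 1 : ℕ) : ℝ) ^ (-p) - (n : ℝ) ^ (-p)| ≤ 4 * (n : ℝ)⁻¹ * (n : ℝ) ^ (-p) := by
  obtain ⟨k, rfl⟩ : ∃ k, n = k + 1 := ⟨n - 1, by omega⟩
  have hk : 1 ≤ k := by omega
  have hk0 : (0 : ℝ) < k := by exact_mod_cast hk
  have hk1 : (1 : ℝ) ≤ k := by exact_mod_cast hk
  simp only [Nat.add_sub_cancel]
  have hn0 : (0 : ℝ) < (k + 1 : ℕ) := by positivity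
  have h2 : ((k + 1 : ℕ) : ℝ) ≤ 2 * k := by push_cast; linarith
  have h1 : (k : ℝ) ^ (-p) ≤ 2 * ((k + 1 : ℕ) : ℝ) ^ (-p) := by
    have h3 : (2 * k : ℝ) ^ (-p) ≤ ((k + 1 : ℕ) : ℝ) ^ (-p) :=
      Real.rpow_le_rpow_of_nonpos hn0 h2 (by linarith)
    rw [Real.mul_rpow (by norm_num) hk0.le] at h3
    have h4 : (2 : ℝ)⁻¹ ≤ 2 ^ (-p) := by
      rw [← Real.rpow_neg_one]
      exact Real.rpow_le_rpow_of_exponent_le (by norm_num) (by linarith)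
    have h5 : 0 ≤ (k : ℝ) ^ (-p) := by positivity
    nlinarith
  refine ⟨h1, ?_⟩
  have hle : ((k + 1 : ℕ) : ℝ) ^ (-p) ≤ (k : ℝ) ^ (-p) :=
    Real.rpow_le_rpow_of_nonpos hk0 (by push_cast; linarith) (by linarith)
  rw [abs_of_nonneg (by linarith)]
  have h6 := rpow_neg_succ_ge hp0 hk
  have h7 : p / k ≤ 2 * ((k + 1 : ℕ) : ℝ)⁻¹ := by
    rw [div_le_iff₀ hk0, ← div_eq_mul_inv, div_mul_eq_mul_div, le_div_iff₀ hn0]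
    nlinarith
  calc (k : ℝ) ^ (-p) - ((k + 1 : ℕ) : ℝ) ^ (-p) ≤ (p / k) * (k : ℝ) ^ (-p) := by linarith
    _ ≤ (2 * ((k + 1 : ℕ) : ℝ)⁻¹) * (2 * ((k + 1 : ℕ) : ℝ) ^ (-p)) := by gcongr
    _ = _ := by ring

/-- The pathwise rate of a linearised two-time-scale recursion, given the rates of the
recursions driven by the noise alone. -/
theorem two_time_scale_rate {E F : Type*} [NormedAddCommGroup E] [NormedSpace ℝ E]
    [NormedAddCommGroup F] [NormedSpace ℝ F]
    (Q₁₁ H : E →L[ℝ] E) (Q₁₂ M : F →L[ℝ] E) (Q₂₁ : E →L[ℝ] F) (Q₂₂ : F →L[ℝ] F)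
    (hM : ∀ y, M (Q₂₂ y) = Q₁₂ y) (hH : ∀ x, H x = Q₁₁ x - M (Q₂₁ x))
    {N₁ : E → ℝ} {C₁ t₁ l₁ l₁' : ℝ} (ht₁ : 0 < t₁) (hN₁ : ∀ x, ‖x‖ ≤ N₁ x)
    (hN₁C : ∀ x, N₁ x ≤ C₁ * ‖x‖) (hN₁a : ∀ x y, N₁ (x + y) ≤ N₁ x + N₁ y)
    (hN₁c : ∀ t, 0 ≤ t → t ≤ t₁ → ∀ x, N₁ (x + t • H x) ≤ (1 - l₁ * t) * N₁ x)
    {N₂ : F → ℝ} {C₂ t₂ l₂ : ℝ} (ht₂ : 0 < t₂) (hN₂ : ∀ x, ‖x‖ ≤ N₂ x)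
    (hN₂C : ∀ x, N₂ x ≤ C₂ * ‖x‖) (hN₂a : ∀ x y, N₂ (x + y) ≤ N₂ x + N₂ y)
    (hN₂c : ∀ t, 0 ≤ t → t ≤ t₂ → ∀ x, N₂ (x + t • Q₂₂ x) ≤ (1 - l₂ * t) * N₂ x)
    {β₀ γ₀ a b : ℝ} (hβ₀ : 0 < β₀) (hγ₀ : 0 < γ₀) (ha : 1 / 2 < a) (hab : a < b) (hb : b ≤ 1)
    (hl₁' : 0 < l₁') (hl₁ : l₁' < l₁) (hl₂ : 0 < l₂) (hb1 : b = 1 → 1 / 2 ≤ l₁' * β₀)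
    {x Rx V sV : ℕ → E} {y Ry W sW tW : ℕ → F}
    (hx : ∀ᶠ n in atTop,
      x (n + 1) = x n + stepSize β₀ b n • (Q₁₁ (x n) + Q₁₂ (y n) + Rx n + V n))
    (hy : ∀ᶠ n in atTop,
      y (n + 1) = y n + stepSize γ₀ a n • (Q₂₁ (x n) + Q₂₂ (y n) + Ry n + W n))
    (hx0 : Tendsto x atTop (𝓝 0)) (hy0 : Tendsto y atTop (𝓝 0))
    {K : ℝ} (hR : ∀ᶠ n : ℕ in atTop,
      ‖Rx n‖ + ‖Ry n‖ ≤ K * (‖x n‖ ^ 2 + ‖y n‖ ^ 2 + (n : ℝ) ^ (-(b / 2))))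
    (hsV : ∀ᶠ n in atTop, sV (n + 1) = (1 - stepSize 1 b n) • sV n + stepSize 1 b n • V n)
    (hsW : ∀ᶠ n in atTop, sW (n + 1) = (1 - stepSize 1 b n) • sW n + stepSize 1 b n • W n)
    (htW : ∀ᶠ n in atTop, tW (n + 1) = (1 - stepSize 1 a n) • tW n + stepSize 1 a n • W n)
    (hsVO : sV =O[atTop] lilRate β₀ b) (hsWO : sW =O[atTop] lilRate β₀ b)
    (htWO : tW =O[atTop] lilRate γ₀ a) :
    x =O[atTop] lilRate β₀ b ∧ y =O[atTop] lilRate γ₀ a := by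
  set ζ : ℕ → E := fun n => β₀ • (sV n - M (sW n)) with hζ
  set ω : ℕ → F := fun n => γ₀ • tW n with hω
  set ε : ℕ → ℝ := fun n => β₀ / γ₀ * (n : ℝ) ^ (a - b) with hε
  -- The shift to `n - 1` puts the coefficient `εₙ` in front of `y (n + 1)`, where `εₙ γₙ = βₙ`
  -- makes the cancellation of `Q₁₂ y` exact.
  set x' : ℕ → E := fun n => x n - ε (n - 1) • M (y n) - ζ n with hx'
  set y' : ℕ → F := fun n => y n - ω n with hy'
  have hζO : (fun n => ‖ζ n‖) =O[atTop] lilRate β₀ b :=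
    ((hsVO.sub ((M.isBigO_comp sW atTop).trans hsWO)).const_smul_left β₀).norm_left
  have hωO : (fun n => ‖ω n‖) =O[atTop] lilRate γ₀ a := (htWO.const_smul_left γ₀).norm_left
  have hεγ : ∀ n, 1 ≤ n → stepSize β₀ b n = ε n * stepSize γ₀ a n := fun n hn => by
    have hn0 : (0 : ℝ) < n := by exact_mod_cast hn
    simp only [hε, stepSize]
    rw [show (-b) = (a - b) + -a by ring, Real.rpow_add hn0]
    field_simp
  -- the recursions of the corrected variables
  have hx'rec : ∀ᶠ n in atTop, x' (n + 1) = (x' n + stepSize β₀ b n • H (x' n)) +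
      ((ε (n - 1) - ε n) • M (y n) + stepSize β₀ b n • (ε (n - 1) • H (M (y n)) + H (ζ n) +
        β₀⁻¹ • ζ n + Rx n - M (Ry n))) := by
    filter_upwards [hx, hy, hsV, hsW, eventually_ge_atTop 1] with n h1 h2 h3 h4 hn
    -- The factor `β₀` in `ζ` rescales the unit-step sequences, so that `ζ` receives the same noise
    -- as the slow variable.
    have hζn : ζ (n + 1) = ζ n + stepSize β₀ b n • (V n - M (W n) - β₀⁻¹ • ζ n) := by
      simp only [hζ, h3, h4, map_add, map_smul, smul_sub, smul_smul]
      rw [stepSize_eq_mul β₀, inv_mul_cancel₀ hβ₀.ne']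
      module
    have he : ε n • M (y (n + 1)) = ε n • M (y n) +
        stepSize β₀ b n • (M (Q₂₁ (x n)) + Q₁₂ (y n) + M (Ry n) + M (W n)) := by
      rw [h2, hεγ n hn, map_add, map_smul, map_add, map_add, map_add, hM]
      module
    simp only [hx', Nat.add_sub_cancel]
    rw [he, hζn, h1]
    simp only [map_sub, map_smul, hH]
    module
  have hy'rec : ∀ᶠ n in atTop, y' (n + 1) = (y' n + stepSize γ₀ a n • Q₂₂ (y' n)) +
      stepSize γ₀ a n • (Q₂₂ (ω n) + γ₀⁻¹ • ω n + Q₂₁ (x n) + Ry n) := by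
    filter_upwards [hy, htW] with n h1 h2
    simp only [hy', hω, h1, h2, map_sub, map_smul, smul_smul]
    rw [stepSize_eq_mul γ₀, inv_mul_cancel₀ hγ₀.ne']
    module
  -- scalar bounds
  set k : ℝ := β₀ / γ₀ with hk
  have hk0 : 0 < k := by positivity
  have hεb : ∀ n : ℕ, 2 ≤ n → |ε (n - 1)| ≤ 2 * k * (n : ℝ) ^ (a - b) ∧
      |ε (n - 1) - ε n| ≤ stepSize β₀ b n * (4 * k / β₀ * (n : ℝ) ^ (a - b)) := by
    intro n hn
    have hn1 : (1 : ℝ) ≤ n := by exact_mod_cast (by omega : 1 ≤ n)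
    obtain ⟨h1, h2⟩ := pred_rpow_neg_le (p := b - a) (by linarith) (by linarith) hn
    rw [neg_sub] at h1 h2
    constructor
    · rw [abs_of_nonneg (by positivity)]
      calc ε (n - 1) ≤ k * (2 * (n : ℝ) ^ (a - b)) := by simp only [hε]; gcongr
        _ = _ := by ring
    -- As `b ≤ 1`, the factor `1 / n` is at most a multiple of the step, so the variation of `ε` is
    -- part of the drift.
    · have h3 : (n : ℝ)⁻¹ ≤ (n : ℝ) ^ (-b) := by
        rw [← Real.rpow_neg_one]
        exact Real.rpow_le_rpow_of_exponent_le hn1 (by linarith)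
      calc |ε (n - 1) - ε n| = k * |((n - 1 : ℕ) : ℝ) ^ (a - b) - (n : ℝ) ^ (a - b)| := by
            simp only [hε]
            rw [← mul_sub, abs_mul, abs_of_pos hk0]
        _ ≤ k * (4 * (n : ℝ) ^ (-b) * (n : ℝ) ^ (a - b)) := by
            refine mul_le_mul_of_nonneg_left (h2.trans ?_) hk0.le
            gcongr
        _ = _ := by rw [stepSize]; field_simp
  set A₁ : ℝ := |C₁| * (4 * k / β₀ * ‖M‖ + 2 * k * ‖H‖ * ‖M‖ + ‖H‖ + β₀⁻¹ + 1 + ‖M‖) with hA₁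
  set A₂ : ℝ := |C₂| * (‖Q₂₂‖ + γ₀⁻¹ + ‖Q₂₁‖ + 1) with hA₂
  have hA₁0 : 0 ≤ A₁ := by positivity
  have hA₂0 : 0 ≤ A₂ := by positivity
  set K' : ℝ := 1 + A₁ + A₂ + 2 * k * ‖M‖ + |K| with hK'
  have hK'0 : 0 < K' := by positivity
  have hAK₁ : A₁ ≤ K' := by
    have : 0 ≤ 2 * k * ‖M‖ := by positivity
    linarith [abs_nonneg K]
  have hAK₂ : A₂ ≤ K' := by
    have : 0 ≤ 2 * k * ‖M‖ := by positivity
    linarith [abs_nonneg K]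
  have hMK : 2 * k * ‖M‖ ≤ K' := by linarith [abs_nonneg K]
  have hKK : K ≤ K' := by
    have : 0 ≤ 2 * k * ‖M‖ := by positivity
    linarith [le_abs_self K]
  have hmain := two_time_scale_scalar (α := fun n => N₁ (x' n)) (B := fun n => N₂ (y' n))
    (X := fun n => ‖x n‖) (Y := fun n => ‖y n‖) (Z := fun n => ‖ζ n‖) (O := fun n => ‖ω n‖)
    (R := fun n => ‖Rx n‖ + ‖Ry n‖) (K := K') hβ₀ hγ₀ ha hab hb hl₁' hl₁ hl₂ hb1 hK'0
    (fun n => (norm_nonneg _).trans (hN₁ _)) (fun n => (norm_nonneg _).trans (hN₂ _))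
    (fun n => norm_nonneg _) (fun n => norm_nonneg _) (tendsto_zero_iff_norm_tendsto_zero.1 hx0)
    (tendsto_zero_iff_norm_tendsto_zero.1 hy0) hζO hωO
    ?_ ?_ ?_ ?_ ?_
  · exact ⟨hmain.1.of_norm_left, hmain.2.of_norm_left⟩
  · filter_upwards [hR] with n h
    exact h.trans (by gcongr)
  · filter_upwards [eventually_ge_atTop 2] with n hn
    have e : x n = x' n + ζ n + ε (n - 1) • M (y n) := by simp only [hx']; abel
    calc ‖x n‖ = ‖x' n + ζ n + ε (n - 1) • M (y n)‖ := by rw [← e]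
      _ ≤ ‖x' n‖ + ‖ζ n‖ + ‖ε (n - 1) • M (y n)‖ := norm_add₃_le
      _ ≤ N₁ (x' n) + ‖ζ n‖ + (2 * k * (n : ℝ) ^ (a - b)) * (‖M‖ * ‖y n‖) := by
          rw [norm_smul (ε (n - 1)), Real.norm_eq_abs]
          exact add_le_add (add_le_add (hN₁ _) le_rfl)
            (mul_le_mul (hεb n hn).1 (M.le_opNorm _) (norm_nonneg _) (by positivity))
      _ = N₁ (x' n) + ‖ζ n‖ + 2 * k * ‖M‖ * ((n : ℝ) ^ (a - b) * ‖y n‖) := by ring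
      _ ≤ _ := by gcongr
  · refine Eventually.of_forall fun n => ?_
    have e : y n = y' n + ω n := by simp only [hy']; abel
    calc ‖y n‖ = ‖y' n + ω n‖ := by rw [← e]
      _ ≤ ‖y' n‖ + ‖ω n‖ := norm_add_le _ _
      _ ≤ _ := by gcongr; exact hN₂ _
  · have ht := eventually_mul_stepSize_le (c := β₀) (e := b) (by linarith) 1 ht₁
    filter_upwards [hx'rec, ht, eventually_ge_atTop 2] with n h ht hn
    rw [one_mul] at ht
    have hs := stepSize_nonneg hβ₀ b n
    set s := stepSize β₀ b n
    set κ := (n : ℝ) ^ (a - b) with hκ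
    have hκ0 : 0 ≤ κ := by positivity
    obtain ⟨e1, e2⟩ := hεb n hn
    have hHM : ‖H (M (y n))‖ ≤ ‖H‖ * (‖M‖ * ‖y n‖) :=
      (H.le_opNorm _).trans (by gcongr; exact M.le_opNorm _)
    have herr : ‖(ε (n - 1) - ε n) • M (y n) + s • (ε (n - 1) • H (M (y n)) + H (ζ n) +
        β₀⁻¹ • ζ n + Rx n - M (Ry n))‖ ≤
        s * ((4 * k / β₀ * ‖M‖ + 2 * k * ‖H‖ * ‖M‖) * (κ * ‖y n‖) + (‖H‖ + β₀⁻¹) * ‖ζ n‖ +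
          ‖Rx n‖ + ‖M‖ * ‖Ry n‖) := by
      calc _ ≤ ‖(ε (n - 1) - ε n) • M (y n)‖ + ‖s • (ε (n - 1) • H (M (y n)) + H (ζ n) +
              β₀⁻¹ • ζ n + Rx n - M (Ry n))‖ := norm_add_le _ _
        _ ≤ s * (4 * k / β₀ * κ) * (‖M‖ * ‖y n‖) + s * (2 * k * κ * (‖H‖ * (‖M‖ * ‖y n‖)) +
              ‖H‖ * ‖ζ n‖ + β₀⁻¹ * ‖ζ n‖ + ‖Rx n‖ + ‖M‖ * ‖Ry n‖) := by
            rw [norm_smul, norm_smul, Real.norm_of_nonneg hs, Real.norm_eq_abs]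
            refine add_le_add (mul_le_mul e2 (M.le_opNorm _) (norm_nonneg _) (by positivity))
              (mul_le_mul_of_nonneg_left ?_ hs)
            refine (norm_sub_le _ _).trans (add_le_add ((norm_add₄_le).trans
              (add_le_add (add_le_add (add_le_add ?_ (H.le_opNorm _)) ?_) le_rfl)) (M.le_opNorm _))
            · rw [norm_smul, Real.norm_eq_abs]
              gcongr
            · rw [norm_smul, Real.norm_of_nonneg (by positivity)]
        _ = _ := by ring
    calc N₁ (x' (n + 1)) ≤ (1 - l₁ * s) * N₁ (x' n) + |C₁| *
          (s * ((4 * k / β₀ * ‖M‖ + 2 * k * ‖H‖ * ‖M‖) * (κ * ‖y n‖) + (‖H‖ + β₀⁻¹) * ‖ζ n‖ +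
          ‖Rx n‖ + ‖M‖ * ‖Ry n‖)) := by
          rw [h]
          refine (hN₁a _ _).trans (add_le_add (hN₁c s hs ht _) ?_)
          refine (hN₁C _).trans ((mul_le_mul_of_nonneg_right (le_abs_self _)
            (norm_nonneg _)).trans (mul_le_mul_of_nonneg_left herr (abs_nonneg _)))
      _ = (1 - l₁ * s) * N₁ (x' n) + s * (|C₁| * (‖H‖ + β₀⁻¹) * ‖ζ n‖ +
          |C₁| * (4 * k / β₀ * ‖M‖ + 2 * k * ‖H‖ * ‖M‖) * (κ * ‖y n‖) +
          (|C₁| * ‖Rx n‖ + |C₁| * ‖M‖ * ‖Ry n‖)) := by ring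
      _ ≤ (1 - l₁ * s) * N₁ (x' n) + s * (K' * ‖ζ n‖ + K' * (κ * ‖y n‖) +
          (K' * ‖Rx n‖ + K' * ‖Ry n‖)) := by
          have p1 : 0 ≤ 4 * k / β₀ * ‖M‖ := by positivity
          have p2 : 0 ≤ 2 * k * ‖H‖ * ‖M‖ := by positivity
          have p3 : 0 ≤ β₀⁻¹ := by positivity
          have p4 := norm_nonneg H
          have p5 := norm_nonneg M
          have q1 : |C₁| * (‖H‖ + β₀⁻¹) ≤ K' := le_trans (mul_le_mul_of_nonneg_left (by linarith) (abs_nonneg _)) hAK₁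
          have q2 : |C₁| * (4 * k / β₀ * ‖M‖ + 2 * k * ‖H‖ * ‖M‖) ≤ K' :=
            le_trans (mul_le_mul_of_nonneg_left (by linarith) (abs_nonneg _)) hAK₁
          have q3 : |C₁| ≤ K' :=
            le_trans (le_mul_of_one_le_right (abs_nonneg _) (by linarith)) hAK₁
          have q4 : |C₁| * ‖M‖ ≤ K' := le_trans (mul_le_mul_of_nonneg_left (by linarith) (abs_nonneg _)) hAK₁
          have q5 : 0 ≤ κ * ‖y n‖ := by positivity
          refine add_le_add le_rfl (mul_le_mul_of_nonneg_left ?_ hs)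
          exact add_le_add (add_le_add (mul_le_mul_of_nonneg_right q1 (norm_nonneg _))
            (mul_le_mul_of_nonneg_right q2 q5)) (add_le_add
            (mul_le_mul_of_nonneg_right q3 (norm_nonneg _))
            (mul_le_mul_of_nonneg_right q4 (norm_nonneg _)))
      _ = _ := by ring
  · have ht := eventually_mul_stepSize_le (c := γ₀) (e := a) (by linarith) 1 ht₂
    filter_upwards [hy'rec, ht] with n h ht
    rw [one_mul] at ht
    have hs := stepSize_nonneg hγ₀ a n
    set s := stepSize γ₀ a n
    have herr : ‖s • (Q₂₂ (ω n) + γ₀⁻¹ • ω n + Q₂₁ (x n) + Ry n)‖ ≤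
        s * (‖Q₂₂‖ * ‖ω n‖ + γ₀⁻¹ * ‖ω n‖ + ‖Q₂₁‖ * ‖x n‖ + ‖Ry n‖) := by
      rw [norm_smul, Real.norm_of_nonneg hs]
      refine mul_le_mul_of_nonneg_left ((norm_add₄_le).trans (add_le_add (add_le_add
        (add_le_add (Q₂₂.le_opNorm _) ?_) (Q₂₁.le_opNorm _)) le_rfl)) hs
      rw [norm_smul, Real.norm_of_nonneg (by positivity)]
    calc N₂ (y' (n + 1)) ≤ (1 - l₂ * s) * N₂ (y' n) + |C₂| *
          (s * (‖Q₂₂‖ * ‖ω n‖ + γ₀⁻¹ * ‖ω n‖ + ‖Q₂₁‖ * ‖x n‖ + ‖Ry n‖)) := by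
          rw [h]
          refine (hN₂a _ _).trans (add_le_add (hN₂c s hs ht _) ?_)
          refine (hN₂C _).trans ((mul_le_mul_of_nonneg_right (le_abs_self _)
            (norm_nonneg _)).trans (mul_le_mul_of_nonneg_left herr (abs_nonneg _)))
      _ = (1 - l₂ * s) * N₂ (y' n) + s * (|C₂| * (‖Q₂₂‖ + γ₀⁻¹) * ‖ω n‖ +
          |C₂| * ‖Q₂₁‖ * ‖x n‖ + |C₂| * ‖Ry n‖) := by ring
      _ ≤ (1 - l₂ * s) * N₂ (y' n) + s * (K' * ‖ω n‖ + K' * ‖x n‖ +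
          (K' * ‖Rx n‖ + K' * ‖Ry n‖)) := by
          have p3 : 0 ≤ γ₀⁻¹ := by positivity
          have p4 := norm_nonneg Q₂₂
          have p5 := norm_nonneg Q₂₁
          have q1 : |C₂| * (‖Q₂₂‖ + γ₀⁻¹) ≤ K' := le_trans (mul_le_mul_of_nonneg_left (by linarith) (abs_nonneg _)) hAK₂
          have q2 : |C₂| * ‖Q₂₁‖ ≤ K' := le_trans (mul_le_mul_of_nonneg_left (by linarith) (abs_nonneg _)) hAK₂
          have q3 : |C₂| ≤ K' :=
            le_trans (le_mul_of_one_le_right (abs_nonneg _) (by linarith)) hAK₂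
          have q6 : |C₂| * ‖Ry n‖ ≤ K' * ‖Rx n‖ + K' * ‖Ry n‖ := by
            have := mul_le_mul_of_nonneg_right q3 (norm_nonneg (Ry n))
            have : 0 ≤ K' * ‖Rx n‖ := by positivity
            linarith
          refine add_le_add le_rfl (mul_le_mul_of_nonneg_left ?_ hs)
          exact add_le_add (add_le_add (mul_le_mul_of_nonneg_right q1 (norm_nonneg _))
            (mul_le_mul_of_nonneg_right q2 (norm_nonneg _))) q6
      _ = _ := by ring

open scoped ENNReal

/-! ### Truncated martingale increments -/

/-- A maximal inequality for nonnegative supermartingales. -/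
lemma mul_measure_exists_le_lintegral {Ω : Type*} {m0 : MeasurableSpace Ω} {P : Measure Ω}
    {ℱ : ℕ → MeasurableSpace Ω} (hℱ : Monotone ℱ) (hle : ∀ n, ℱ n ≤ m0) {X : ℕ → Ω → ℝ≥0∞}
    (hX : ∀ n, Measurable[ℱ n] (X n)) {N : ℕ}
    (hstep : ∀ n < N, ∀ F, MeasurableSet[ℱ n] F → ∫⁻ ω in F, X (n + 1) ω ∂P ≤ ∫⁻ ω in F, X n ω ∂P)
    (t : ℝ≥0∞) : t * P {ω | ∃ n ≤ N, t ≤ X n ω} ≤ ∫⁻ ω, X 0 ω ∂P := by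
  set T : ℕ → Set Ω := fun n => {ω | ∃ k ≤ n, t ≤ X k ω} with hT
  have hTm : ∀ n, MeasurableSet[ℱ n] (T n) := fun n => by
    have : T n = ⋃ k ∈ Set.Iic n, {ω | t ≤ X k ω} := by ext; simp [hT]
    rw [this]
    refine MeasurableSet.biUnion (Set.to_countable _) fun k hk => ?_
    exact hℱ hk _ (hX k measurableSet_Ici)
  -- The left side bounds from below the expectation of the process stopped on first reaching level
  -- `t`; it is handled without stopping times.
  have key : ∀ n ≤ N, t * P (T n) + ∫⁻ ω in (T n)ᶜ, X n ω ∂P ≤ ∫⁻ ω, X 0 ω ∂P := by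
    intro n
    induction n with
    | zero =>
      intro _
      rw [← lintegral_add_compl (μ := P) (X 0) (hle 0 _ (hTm 0))]
      refine add_le_add ?_ le_rfl
      calc t * P (T 0) = ∫⁻ _ in T 0, t ∂P := by simp
        _ ≤ _ := setLIntegral_mono' (hle 0 _ (hTm 0)) fun ω hω => by
            obtain ⟨k, hk, h⟩ := hω
            rwa [Nat.le_zero.1 hk] at h
    | succ n ih =>
      intro hn
      refine le_trans ?_ (ih (by omega))
      set U : Set Ω := {ω | t ≤ X (n + 1) ω}
      have hU : MeasurableSet U := hle (n + 1) _
        (hX (n + 1) measurableSet_Ici)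
      have e1 : T (n + 1) = T n ∪ ((T n)ᶜ ∩ U) := by
        ext ω
        simp only [hT, U, Set.mem_union, Set.mem_inter_iff, Set.mem_compl_iff]
        constructor
        · rintro ⟨k, hk, h⟩
          by_cases h' : ω ∈ {ω | ∃ k ≤ n, t ≤ X k ω}
          · exact Or.inl h'
          · rcases Nat.le_succ_iff.1 hk with hk | rfl
            · exact absurd ⟨k, hk, h⟩ h'
            · exact Or.inr ⟨h', h⟩
        · rintro (⟨k, hk, h⟩ | ⟨_, h⟩)
          · exact ⟨k, hk.trans n.le_succ, h⟩
          · exact ⟨n + 1, le_rfl, h⟩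
      have e2 : (T (n + 1))ᶜ = (T n)ᶜ \ U := by
        rw [e1]; ext; simp; tauto
      have h1 : ∫⁻ ω in (T n)ᶜ, X (n + 1) ω ∂P ≤ ∫⁻ ω in (T n)ᶜ, X n ω ∂P :=
        hstep n (by omega) _ (hTm n).compl
      rw [e2]
      calc t * P (T (n + 1)) + ∫⁻ ω in (T n)ᶜ \ U, X (n + 1) ω ∂P
          ≤ t * (P (T n) + P ((T n)ᶜ ∩ U)) + ∫⁻ ω in (T n)ᶜ \ U, X (n + 1) ω ∂P := by
            rw [e1]; gcongr; exact measure_union_le _ _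
        _ = t * P (T n) + (t * P ((T n)ᶜ ∩ U) + ∫⁻ ω in (T n)ᶜ \ U, X (n + 1) ω ∂P) := by ring
        _ ≤ t * P (T n) + (∫⁻ ω in (T n)ᶜ ∩ U, X (n + 1) ω ∂P +
              ∫⁻ ω in (T n)ᶜ \ U, X (n + 1) ω ∂P) := by
            gcongr
            calc t * P ((T n)ᶜ ∩ U) = ∫⁻ _ in (T n)ᶜ ∩ U, t ∂P := by simp
              _ ≤ _ := setLIntegral_mono' ((hle n _ (hTm n)).compl.inter hU) fun ω hω => hω.2
        _ = t * P (T n) + ∫⁻ ω in (T n)ᶜ, X (n + 1) ω ∂P := by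
            rw [lintegral_inter_add_sdiff _ _ hU]
        _ ≤ _ := by gcongr
  exact le_trans le_self_add (key N le_rfl)

/-- The hypothesis expresses a conditional expectation of `g` at most `C` through events only: on
`𝓖`, the measure with density `g` is dominated by `C • P`. A `𝓖`-measurable `Z` sees nothing but
these restrictions to `𝓖`. -/
lemma lintegral_mul_le_of_setLIntegral_le {Ω : Type*} {𝓖 m0 : MeasurableSpace Ω} {P : Measure Ω}
    (h𝓖 : 𝓖 ≤ m0) {g Z : Ω → ℝ≥0∞} (hg : Measurable g) (hZ : Measurable[𝓖] Z) {C : ℝ≥0∞}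
    (h : ∀ F, MeasurableSet[𝓖] F → ∫⁻ ω in F, g ω ∂P ≤ C * P F) :
    ∫⁻ ω, g ω * Z ω ∂P ≤ C * ∫⁻ ω, Z ω ∂P := by
  have hle : (P.withDensity g).trim h𝓖 ≤ C • P.trim h𝓖 := by
    refine @Measure.le_intro _ 𝓖 _ _ fun F hF _ => ?_
    rw [trim_measurableSet_eq h𝓖 hF, withDensity_apply _ (h𝓖 F hF), Measure.smul_apply,
      trim_measurableSet_eq h𝓖 hF, smul_eq_mul]
    exact h F hF
  calc ∫⁻ ω, g ω * Z ω ∂P = ∫⁻ ω, Z ω ∂(P.withDensity g) := by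
        rw [lintegral_withDensity_eq_lintegral_mul _ hg (hZ.mono h𝓖 le_rfl)]; rfl
    _ = ∫⁻ ω, Z ω ∂((P.withDensity g).trim h𝓖) := (lintegral_trim h𝓖 hZ).symm
    _ ≤ ∫⁻ ω, Z ω ∂(C • P.trim h𝓖) := lintegral_mono' hle le_rfl
    _ = C * ∫⁻ ω, Z ω ∂P := by rw [lintegral_smul_measure, lintegral_trim h𝓖 hZ, smul_eq_mul]

/-- An exponential maximal inequality for weighted sums of increments which satisfy conditional
exponential moment bounds. -/
lemma measure_exists_sum_ge_le {Ω : Type*} {m0 : MeasurableSpace Ω} {P : Measure Ω}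
    [IsProbabilityMeasure P] {ℱ : ℕ → MeasurableSpace Ω} (hℱ : Monotone ℱ) (hle : ∀ n, ℱ n ≤ m0)
    {D : ℕ → Ω → ℝ} (hD : ∀ n, Measurable[ℱ (n + 1)] (D n)) {c b : ℕ → ℝ} {κ : ℝ}
    (hexp : ∀ n, ∀ l : ℝ, |l| * c n ≤ 1 → ∀ F, MeasurableSet[ℱ n] F →
      ∫⁻ ω in F, ENNReal.ofReal (Real.exp (l * D n ω)) ∂P ≤
        ENNReal.ofReal (Real.exp (|l| * b n + l ^ 2 * κ)) * P F)
    {w : ℕ → ℝ} (hw : ∀ n, 0 ≤ w n) (l : ℝ) {N : ℕ} (hl : ∀ k < N, |l| * (w k * c k) ≤ 1) (x : ℝ) :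
    P {ω | ∃ n ≤ N, (∑ k ∈ Finset.range n, (|l| * (w k * b k) + l ^ 2 * (w k ^ 2 * κ))) + x ≤
      l * ∑ k ∈ Finset.range n, w k * D k ω} ≤ ENNReal.ofReal (Real.exp (-x)) := by
  set A : ℕ → ℝ := fun k => |l| * (w k * b k) + l ^ 2 * (w k ^ 2 * κ) with hA
  -- The compensator `A` is the sum of the exponents in `hexp`, which makes `X` a supermartingale
  -- starting from `1`.
  set X : ℕ → Ω → ℝ≥0∞ := fun n ω => ENNReal.ofReal (Real.exp
    (l * ∑ k ∈ Finset.range n, w k * D k ω - ∑ k ∈ Finset.range n, A k)) with hXdef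
  have hX : ∀ n, Measurable[ℱ n] (X n) := fun n => by
    refine ENNReal.measurable_ofReal.comp (Real.measurable_exp.comp ?_)
    refine Measurable.sub_const (Measurable.const_mul ?_ l) _
    refine Finset.measurable_fun_sum _ fun k hk => Measurable.const_mul ?_ _
    exact (hD k).mono (hℱ (Finset.mem_range.1 hk)) le_rfl
  have hstep : ∀ n < N, ∀ F, MeasurableSet[ℱ n] F →
      ∫⁻ ω in F, X (n + 1) ω ∂P ≤ ∫⁻ ω in F, X n ω ∂P := by
    intro n hn F hF
    have hF0 := hle n F hF
    have hg : Measurable fun ω => ENNReal.ofReal (Real.exp ((l * w n) * D n ω)) :=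
      ENNReal.measurable_ofReal.comp (Real.measurable_exp.comp
        (((hD n).mono (hle (n + 1)) le_rfl).const_mul _))
    have hlw : |l * w n| = |l| * w n := by rw [abs_mul, abs_of_nonneg (hw n)]
    have h1 := lintegral_mul_le_of_setLIntegral_le (hle n) hg ((hX n).indicator hF)
      (hexp n (l * w n) (by rw [hlw, mul_assoc]; exact hl n hn))
    have e1 : |l * w n| * b n + (l * w n) ^ 2 * κ = A n := by rw [hlw, hA]; ring
    rw [e1, lintegral_indicator hF0] at h1
    have e2 : ∀ ω, F.indicator (X (n + 1)) ω = ENNReal.ofReal (Real.exp (-A n)) *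
        (ENNReal.ofReal (Real.exp ((l * w n) * D n ω)) * F.indicator (X n) ω) := by
      intro ω
      by_cases hω : ω ∈ F
      · simp only [hω, Set.indicator_of_mem, hXdef]
        rw [← ENNReal.ofReal_mul (Real.exp_pos _).le, ← ENNReal.ofReal_mul (Real.exp_pos _).le,
          ← Real.exp_add, ← Real.exp_add, Finset.sum_range_succ, Finset.sum_range_succ]
        congr 2; ring
      · simp [hω]
    rw [← lintegral_indicator hF0]
    simp_rw [e2]
    rw [lintegral_const_mul' _ _ ENNReal.ofReal_ne_top]
    calc _ ≤ ENNReal.ofReal (Real.exp (-A n)) *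
          (ENNReal.ofReal (Real.exp (A n)) * ∫⁻ ω in F, X n ω ∂P) := by gcongr
      _ = _ := by
        rw [← mul_assoc, ← ENNReal.ofReal_mul (Real.exp_pos _).le, ← Real.exp_add]
        simp
  have h := mul_measure_exists_le_lintegral hℱ hle hX hstep (ENNReal.ofReal (Real.exp x))
  have e0 : ∫⁻ ω, X 0 ω ∂P = 1 := by simp [hXdef]
  rw [e0] at h
  have hsub : {ω | ∃ n ≤ N, (∑ k ∈ Finset.range n, A k) + x ≤
      l * ∑ k ∈ Finset.range n, w k * D k ω} ⊆
      {ω | ∃ n ≤ N, ENNReal.ofReal (Real.exp x) ≤ X n ω} := by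
    rintro ω ⟨n, hn, h⟩
    exact ⟨n, hn, ENNReal.ofReal_le_ofReal (Real.exp_le_exp.2 (by linarith))⟩
  refine (measure_mono hsub).trans ?_
  rw [Real.exp_neg, ENNReal.ofReal_inv_of_pos (Real.exp_pos _)]
  rw [mul_comm] at h
  exact ENNReal.le_inv_iff_mul_le.2 h

/-- Almost sure bounds for a sequence of weighted sums. -/
lemma ae_eventually_abs_sum_le {Ω : Type*} {m0 : MeasurableSpace Ω} {P : Measure Ω}
    [IsProbabilityMeasure P] {ℱ : ℕ → MeasurableSpace Ω} (hℱ : Monotone ℱ) (hle : ∀ n, ℱ n ≤ m0)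
    {D : ℕ → Ω → ℝ} (hD : ∀ n, Measurable[ℱ (n + 1)] (D n)) {c b : ℕ → ℝ} {κ : ℝ}
    (hexp : ∀ n, ∀ l : ℝ, |l| * c n ≤ 1 → ∀ F, MeasurableSet[ℱ n] F →
      ∫⁻ ω in F, ENNReal.ofReal (Real.exp (l * D n ω)) ∂P ≤
        ENNReal.ofReal (Real.exp (|l| * b n + l ^ 2 * κ)) * P F)
    {w : ℕ → ℕ → ℝ} (hw : ∀ j n, 0 ≤ w j n) {l : ℕ → ℝ} {N : ℕ → ℕ}
    (hl0 : ∀ᶠ j in atTop, 0 < l j)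
    (hl : ∀ᶠ j in atTop, ∀ k < N j, l j * (w j k * c k) ≤ 1) :
    ∀ᵐ ω ∂P, ∀ᶠ j : ℕ in atTop, ∀ n ≤ N j, |∑ k ∈ Finset.range n, w j k * D k ω| ≤
      ∑ k ∈ Finset.range n, w j k * b k + l j * (κ * ∑ k ∈ Finset.range n, w j k ^ 2) +
        2 * Real.log j / l j := by
  obtain ⟨J, hJ⟩ := eventually_atTop.1 ((hl0.and hl).and (eventually_ge_atTop 1))
  -- The sign `s = ±1` selects the tail. The level `2 log j` gives probability at most `1 / j²`,
  -- which is summable. The clause `J ≤ j` empties the event while the conditions on `l` may fail.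
  set bad : ℝ → ℕ → Set Ω := fun s j => {ω | J ≤ j ∧ ∃ n ≤ N j,
    (∑ k ∈ Finset.range n, (|s * l j| * (w j k * b k) + (s * l j) ^ 2 * (w j k ^ 2 * κ))) +
      2 * Real.log j ≤ s * l j * ∑ k ∈ Finset.range n, w j k * D k ω} with hbad
  have hae : ∀ s : ℝ, |s| = 1 → ∀ᵐ ω ∂P, ∀ᶠ j in atTop, ω ∉ bad s j := by
    intro s hs
    refine ae_eventually_notMem (ne_top_of_le_ne_top
      (b := ∑' j : ℕ, ENNReal.ofReal (1 / (j : ℝ) ^ 2)) ?_ (ENNReal.tsum_le_tsum fun j => ?_))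
    · rw [← ENNReal.ofReal_tsum_of_nonneg (fun _ => by positivity)
        (Real.summable_one_div_nat_pow.2 one_lt_two)]
      exact ENNReal.ofReal_ne_top
    · by_cases hj : J ≤ j
      · obtain ⟨⟨h1, h2⟩, h3⟩ := hJ j hj
        have hj0 : (0 : ℝ) < j := by exact_mod_cast h3
        have habs : |s * l j| = l j := by rw [abs_mul, hs, one_mul, abs_of_pos h1]
        refine (measure_mono (fun ω hω => hω.2)).trans ((measure_exists_sum_ge_le hℱ hle hD hexp
          (hw j) (s * l j) (N := N j) (by rw [habs]; exact h2) (2 * Real.log j)).trans_eq ?_)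
        congr 1
        rw [Real.exp_neg, two_mul, Real.exp_add, Real.exp_log hj0]
        field_simp
      · simp [hbad, hj]
  filter_upwards [hae 1 (by simp), hae (-1) (by simp)] with ω h1 h2
  filter_upwards [h1, h2, eventually_ge_atTop J] with j h1 h2 hj n hn
  obtain ⟨⟨hlj, -⟩, -⟩ := hJ j hj
  simp only [hbad, Set.mem_ofPred_eq, not_and, not_exists, not_le, one_mul, neg_one_mul, abs_neg,
    abs_of_pos hlj, neg_sq, Finset.sum_add_distrib, ← Finset.mul_sum, ← Finset.sum_mul] at h1 h2
  have h1 := h1 hj n hn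
  have h2 := h2 hj n hn
  rw [abs_le]
  have e : l j * (2 * Real.log j / l j) = 2 * Real.log j := by field_simp
  constructor
  · refine le_of_mul_le_mul_left ?_ hlj
    nlinarith
  · refine le_of_mul_le_mul_left ?_ hlj
    nlinarith

/-- The increment `ξ` on `G`, truncated at level `c`. -/
noncomputable def clip {Ω : Type*} (G : Set Ω) (c : ℝ) (ξ : Ω → ℝ) : Ω → ℝ :=
  (G ∩ {ω | |ξ ω| ≤ c}).indicator ξ

lemma measurable_clip {Ω : Type*} [MeasurableSpace Ω] {G : Set Ω} {c : ℝ} {ξ : Ω → ℝ}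
    (hG : MeasurableSet G) (hξ : Measurable ξ) : Measurable (clip G c ξ) :=
  hξ.indicator (hG.inter (measurableSet_le hξ.abs measurable_const))

lemma abs_clip_le {Ω : Type*} {G : Set Ω} {c : ℝ} (hc : 0 ≤ c) (ξ : Ω → ℝ) (ω : Ω) :
    |clip G c ξ ω| ≤ c := by
  by_cases h : ω ∈ G ∩ {ω | |ξ ω| ≤ c}
  · rw [clip, Set.indicator_of_mem h]; exact h.2
  · rw [clip, Set.indicator_of_notMem h]; simpa using hc

/-- The condition `|l| c ≤ 1` allows `exp u ≤ 1 + u + u²` for `u = l * clip G c ξ`. The linear term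
is the bias due to truncation, at most `K c ^ (1 - m)`; the quadratic one is bounded through `ξ² ≤ 1
+ |ξ| ^ m`. -/
lemma lintegral_exp_clip_le {Ω : Type*} {𝓖 m0 : MeasurableSpace Ω} {P : Measure Ω}
    [IsProbabilityMeasure P] (h𝓖 : 𝓖 ≤ m0) {ξ : Ω → ℝ} (hξ : Measurable ξ) {G : Set Ω}
    (hG : MeasurableSet[𝓖] G) {m K c : ℝ} (hm : 2 ≤ m) (hK : 0 ≤ K) (hc : 0 < c)
    (hmom : ∀ F, MeasurableSet[𝓖] F → F ⊆ G →
      ∫⁻ ω in F, ‖ξ ω‖ₑ ^ m ∂P ≤ ENNReal.ofReal K * P F)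
    (hmean : ∀ F, MeasurableSet[𝓖] F → F ⊆ G → IntegrableOn ξ F P → ∫ ω in F, ξ ω ∂P = 0)
    {l : ℝ} (hl : |l| * c ≤ 1) {F : Set Ω} (hF : MeasurableSet[𝓖] F) :
    ∫⁻ ω in F, ENNReal.ofReal (Real.exp (l * clip G c ξ ω)) ∂P ≤
      ENNReal.ofReal (Real.exp (|l| * (K * c ^ (1 - m)) + l ^ 2 * (1 + K))) * P F := by
  have hF0 := h𝓖 F hF
  have hG0 := h𝓖 G hG
  have hFG := hF0.inter hG0
  set φ : Ω → ℝ := fun ω => |ξ ω| ^ m with hφ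
  have hφ0 : ∀ ω, 0 ≤ φ ω := fun ω => by positivity
  have hφm : Measurable φ := hξ.abs.pow_const m
  have hφe : ∀ ω, ‖ξ ω‖ₑ ^ m = ENNReal.ofReal (φ ω) := fun ω => by
    rw [Real.enorm_eq_ofReal_abs, ENNReal.ofReal_rpow_of_nonneg (abs_nonneg _) (by linarith)]
  have hφl : ∫⁻ ω in F ∩ G, ENNReal.ofReal (φ ω) ∂P ≤ ENNReal.ofReal K * P F := by
    simp_rw [← hφe]
    refine (hmom _ (@MeasurableSet.inter _ 𝓖 _ _ hF hG) Set.inter_subset_right).trans ?_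
    gcongr
    exact Set.inter_subset_left
  have hfin : ENNReal.ofReal K * P F ≠ ⊤ :=
    ENNReal.mul_ne_top ENNReal.ofReal_ne_top (measure_ne_top _ _)
  have hφint : IntegrableOn φ (F ∩ G) P := by
    refine ⟨hφm.aestronglyMeasurable, ?_⟩
    rw [hasFiniteIntegral_iff_ofReal (Eventually.of_forall hφ0)]
    exact hφl.trans_lt hfin.lt_top
  have hφI : ∫ ω in F ∩ G, φ ω ∂P ≤ K * P.real F := by
    rw [integral_eq_lintegral_of_nonneg_ae (Eventually.of_forall hφ0) hφm.aestronglyMeasurable]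
    refine (ENNReal.toReal_mono hfin hφl).trans_eq ?_
    rw [ENNReal.toReal_mul, ENNReal.toReal_ofReal hK]; rfl
  have hone : ∀ ω, |ξ ω| ^ 2 ≤ 1 + φ ω := fun ω => by
    rcases le_total |ξ ω| 1 with h | h
    · have := hφ0 ω
      nlinarith [abs_nonneg (ξ ω)]
    · have : |ξ ω| ^ (2 : ℝ) ≤ |ξ ω| ^ m := Real.rpow_le_rpow_of_exponent_le h hm
      rw [Real.rpow_two] at this
      simp only [hφ]
      linarith
  have hξint : IntegrableOn ξ (F ∩ G) P := by
    refine Integrable.mono' (g := fun ω => 2 + φ ω) ((integrable_const _).add hφint)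
      hξ.aestronglyMeasurable (Eventually.of_forall fun ω => ?_)
    have := hone ω
    rw [Real.norm_eq_abs]
    nlinarith [sq_nonneg (|ξ ω| - 1)]
  set η := clip G c ξ with hη
  have hηm : Measurable η := measurable_clip hG0 hξ
  have hηc : ∀ ω, |η ω| ≤ c := abs_clip_le hc.le ξ
  have hηint : ∀ S : Set Ω, IntegrableOn η S P := fun S =>
    Integrable.mono' (integrable_const c) hηm.aestronglyMeasurable (Eventually.of_forall hηc)
  have hη2int : ∀ S : Set Ω, IntegrableOn (fun ω => η ω ^ 2) S P := fun S =>
    Integrable.mono' (integrable_const (c ^ 2)) (hηm.pow_const 2).aestronglyMeasurable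
      (Eventually.of_forall fun ω => by
        rw [Real.norm_eq_abs, abs_pow]
        exact pow_le_pow_left₀ (abs_nonneg _) (hηc ω) 2)
  -- the conditional mean
  have hmean' : |∫ ω in F, η ω ∂P| ≤ K * c ^ (1 - m) * P.real F := by
    have e1 : ∫ ω in F, η ω ∂P = ∫ ω in F ∩ G, η ω ∂P := by
      rw [← setIntegral_indicator hG0]
      congr 1 with ω
      by_cases h : ω ∈ G
      · rw [Set.indicator_of_mem h]
      · rw [Set.indicator_of_notMem h, hη, clip, Set.indicator_of_notMem fun h' => h h'.1]
    have e2 : ∫ ω in F ∩ G, η ω ∂P = ∫ ω in F ∩ G, (η ω - ξ ω) ∂P := by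
      rw [integral_sub (hηint _) hξint, hmean _ (@MeasurableSet.inter _ 𝓖 _ _ hF hG)
        Set.inter_subset_right hξint, sub_zero]
    rw [e1, e2]
    calc |∫ ω in F ∩ G, (η ω - ξ ω) ∂P| ≤ ∫ ω in F ∩ G, |η ω - ξ ω| ∂P :=
          abs_integral_le_integral_abs
      _ ≤ ∫ ω in F ∩ G, c ^ (1 - m) * φ ω ∂P := by
          refine setIntegral_mono_on ((hηint _).sub hξint).abs (hφint.const_mul _) hFG ?_
          rintro ω ⟨-, hωG⟩
          by_cases h : |ξ ω| ≤ c
          · have hmem : ω ∈ G ∩ {ω | |ξ ω| ≤ c} := ⟨hωG, h⟩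
            have : η ω = ξ ω := Set.indicator_of_mem hmem ξ
            rw [this, sub_self, abs_zero]
            have := hφ0 ω
            positivity
          · have : η ω = 0 := Set.indicator_of_notMem (fun h' => h h'.2) ξ
            rw [this, zero_sub, abs_neg]
            have hlt : c < |ξ ω| := not_le.1 h
            have h0 : 0 < |ξ ω| := hc.trans hlt
            calc |ξ ω| = |ξ ω| ^ (1 - m) * |ξ ω| ^ m := by
                  rw [← Real.rpow_add h0]; simp
              _ ≤ c ^ (1 - m) * |ξ ω| ^ m := by
                  exact mul_le_mul_of_nonneg_right
                    (Real.rpow_le_rpow_of_nonpos hc hlt.le (by linarith)) (by positivity)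
      _ = c ^ (1 - m) * ∫ ω in F ∩ G, φ ω ∂P := integral_const_mul _ _
      _ ≤ c ^ (1 - m) * (K * P.real F) := by gcongr
      _ = _ := by ring
  -- the conditional variance
  have hvar : ∫ ω in F, η ω ^ 2 ∂P ≤ (1 + K) * P.real F := by
    have hind : IntegrableOn (G.indicator φ) F P := by
      rw [IntegrableOn, integrable_indicator_iff hG0, IntegrableOn, Measure.restrict_restrict hG0,
        Set.inter_comm]
      exact hφint
    calc ∫ ω in F, η ω ^ 2 ∂P ≤ ∫ ω in F, (1 + G.indicator φ ω) ∂P := by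
          refine setIntegral_mono (hη2int F) ((integrable_const _).add hind) fun ω => ?_
          by_cases h : ω ∈ G ∩ {ω | |ξ ω| ≤ c}
          · have e : η ω = ξ ω := Set.indicator_of_mem h ξ
            simp only [e, Set.indicator_of_mem h.1]
            have := hone ω
            rwa [sq_abs] at this
          · have e : η ω = 0 := Set.indicator_of_notMem h ξ
            simp only [e]
            have : 0 ≤ G.indicator φ ω := Set.indicator_nonneg (fun ω _ => hφ0 ω) ω
            linarith
      _ = P.real F + ∫ ω in F ∩ G, φ ω ∂P := by
          rw [integral_add (integrable_const _) hind, setIntegral_indicator hG0]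
          simp
      _ ≤ _ := by linarith
  have hexpint : IntegrableOn (fun ω => Real.exp (l * η ω)) F P := by
    refine Integrable.mono' (integrable_const (Real.exp (|l| * c)))
      (Real.measurable_exp.comp (hηm.const_mul l)).aestronglyMeasurable
      (Eventually.of_forall fun ω => ?_)
    rw [Real.norm_of_nonneg (Real.exp_pos _).le]
    refine Real.exp_le_exp.2 ((le_abs_self _).trans ?_)
    rw [abs_mul]
    gcongr
    exact hηc ω
  have hreal : ∫ ω in F, Real.exp (l * η ω) ∂P ≤
      Real.exp (|l| * (K * c ^ (1 - m)) + l ^ 2 * (1 + K)) * P.real F := by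
    calc ∫ ω in F, Real.exp (l * η ω) ∂P ≤ ∫ ω in F, (1 + l * η ω + l ^ 2 * η ω ^ 2) ∂P := by
          refine setIntegral_mono hexpint (((integrable_const _).add
            ((hηint F).const_mul l)).add ((hη2int F).const_mul _)) fun ω => ?_
          have h1 : |l * η ω| ≤ 1 := by
            rw [abs_mul]
            exact (mul_le_mul_of_nonneg_left (hηc ω) (abs_nonneg _)).trans hl
          have := (abs_le.1 (Real.abs_exp_sub_one_sub_id_le h1)).2
          simp only
          nlinarith
      _ = P.real F + l * ∫ ω in F, η ω ∂P + l ^ 2 * ∫ ω in F, η ω ^ 2 ∂P := by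
          have i1 : IntegrableOn (fun ω => 1 + l * η ω) F P :=
            (integrable_const _).add ((hηint F).const_mul l)
          rw [integral_add i1 ((hη2int F).const_mul _),
            integral_add (integrable_const _) ((hηint F).const_mul l),
            integral_const_mul, integral_const_mul]
          simp
      _ ≤ P.real F + |l| * (K * c ^ (1 - m) * P.real F) + l ^ 2 * ((1 + K) * P.real F) := by
          have h1 : l * ∫ ω in F, η ω ∂P ≤ |l| * (K * c ^ (1 - m) * P.real F) := by
            refine (le_abs_self _).trans ?_
            rw [abs_mul]
            gcongr
          gcongr
      _ = (|l| * (K * c ^ (1 - m)) + l ^ 2 * (1 + K) + 1) * P.real F := by ring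
      _ ≤ _ := by
          gcongr
          exact Real.add_one_le_exp _
  rw [← ofReal_integral_eq_lintegral_ofReal hexpint
    (Eventually.of_forall fun ω => (Real.exp_pos _).le)]
  refine (ENNReal.ofReal_le_ofReal hreal).trans_eq ?_
  rw [ENNReal.ofReal_mul (Real.exp_pos _).le, ofReal_measureReal]

/-- Only finitely many increments exceed the truncation levels. -/
lemma ae_eventually_abs_le {Ω : Type*} {m0 : MeasurableSpace Ω} {P : Measure Ω}
    [IsProbabilityMeasure P] {ξ : ℕ → Ω → ℝ} (hξ : ∀ n, Measurable (ξ n)) {G : ℕ → Set Ω}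
    (hG : ∀ n, MeasurableSet (G n)) {m K : ℝ} {c : ℕ → ℝ} (hm : 0 < m) (hc : ∀ n, 0 < c n)
    (hmom : ∀ n, ∫⁻ ω in G n, ‖ξ n ω‖ₑ ^ m ∂P ≤ ENNReal.ofReal K)
    (hsum : Summable fun n => (c n) ^ (-m)) :
    ∀ᵐ ω ∂P, ∀ᶠ n in atTop, ω ∈ G n → |ξ n ω| ≤ c n := by
  have h := ae_eventually_notMem (μ := P) (s := fun n => G n ∩ {ω | c n < |ξ n ω|})
    (ne_top_of_le_ne_top (b := ∑' n, ENNReal.ofReal (K * (c n) ^ (-m))) ?_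
      (ENNReal.tsum_le_tsum fun n => ?_))
  · filter_upwards [h] with ω h
    filter_upwards [h] with n h hω
    by_contra hlt
    exact h ⟨hω, not_le.1 hlt⟩
  · by_cases hK : 0 ≤ K
    · rw [← ENNReal.ofReal_tsum_of_nonneg
        (fun n => mul_nonneg hK (Real.rpow_nonneg (hc n).le _)) (hsum.mul_left K)]
      exact ENNReal.ofReal_ne_top
    · have : ∀ n, ENNReal.ofReal (K * (c n) ^ (-m)) = 0 := fun n =>
        ENNReal.ofReal_of_nonpos (mul_nonpos_of_nonpos_of_nonneg (not_le.1 hK).le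
          (Real.rpow_nonneg (hc n).le _))
      simp [this]
  · have hcm : 0 < (c n) ^ m := Real.rpow_pos_of_pos (hc n) m
    have hmeas : MeasurableSet {ω | c n < |ξ n ω|} := measurableSet_lt measurable_const (hξ n).abs
    have h1 : ENNReal.ofReal ((c n) ^ m) * P (G n ∩ {ω | c n < |ξ n ω|}) ≤ ENNReal.ofReal K := by
      refine le_trans ?_ (hmom n)
      calc _ = ∫⁻ _ in G n ∩ {ω | c n < |ξ n ω|}, ENNReal.ofReal ((c n) ^ m) ∂P := by simp
        _ ≤ ∫⁻ ω in G n ∩ {ω | c n < |ξ n ω|}, ‖ξ n ω‖ₑ ^ m ∂P := by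
            refine setLIntegral_mono' ((hG n).inter hmeas) fun ω hω => ?_
            rw [Real.enorm_eq_ofReal_abs, ENNReal.ofReal_rpow_of_nonneg (abs_nonneg _) hm.le]
            exact ENNReal.ofReal_le_ofReal (Real.rpow_le_rpow (hc n).le hω.2.le hm.le)
        _ ≤ _ := lintegral_mono_set Set.inter_subset_left
    rw [Real.rpow_neg (hc n).le, ← div_eq_mul_inv, ENNReal.ofReal_div_of_pos hcm]
    rw [ENNReal.le_div_iff_mul_le (Or.inl (by simpa using hcm)) (Or.inl ENNReal.ofReal_ne_top),
      mul_comm]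
    exact h1

/-! ### The scalar recursion driven by martingale increments -/

/-- The weight of the `k`-th input in `s (n + 1) = (1 - n ^ (-e)) s n + n ^ (-e) D n`. -/
noncomputable def dampWeight (e : ℝ) (n k : ℕ) : ℝ :=
  stepSize 1 e k * ∏ i ∈ Finset.Ico (k + 1) n, (1 - stepSize 1 e i)

lemma stepSize_one_le_one {e : ℝ} (he : 0 < e) (n : ℕ) : stepSize 1 e n ≤ 1 := by
  rcases Nat.eq_zero_or_pos n with rfl | hn
  · simp [stepSize, Real.zero_rpow (neg_ne_zero.2 he.ne')]
  · rw [stepSize, one_mul]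
    exact Real.rpow_le_one_of_one_le_of_nonpos (by exact_mod_cast hn) (by linarith)

lemma dampWeight_nonneg {e : ℝ} (he : 0 < e) (n k : ℕ) : 0 ≤ dampWeight e n k :=
  mul_nonneg (stepSize_nonneg one_pos e k)
    (Finset.prod_nonneg fun i _ => by linarith [stepSize_one_le_one he i])

lemma dampWeight_succ (e : ℝ) {n k : ℕ} (h : k < n) :
    dampWeight e (n + 1) k = (1 - stepSize 1 e n) * dampWeight e n k := by
  rw [dampWeight, dampWeight, Finset.prod_Ico_succ_top (by omega)]
  ring

lemma dampWeight_succ_self (e : ℝ) (n : ℕ) : dampWeight e (n + 1) n = stepSize 1 e n := by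
  simp [dampWeight]

lemma sum_dampWeight_succ (e : ℝ) (D : ℕ → ℝ) (n : ℕ) :
    ∑ k ∈ Finset.range (n + 1), dampWeight e (n + 1) k * D k =
      (1 - stepSize 1 e n) * (∑ k ∈ Finset.range n, dampWeight e n k * D k) +
        stepSize 1 e n * D n := by
  rw [Finset.sum_range_succ, dampWeight_succ_self, Finset.mul_sum]
  congr 1
  refine Finset.sum_congr rfl fun k hk => ?_
  rw [dampWeight_succ e (Finset.mem_range.1 hk), mul_assoc]

lemma sum_dampWeight_sq_succ (e : ℝ) (n : ℕ) :
    ∑ k ∈ Finset.range (n + 1), dampWeight e (n + 1) k ^ 2 =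
      (1 - stepSize 1 e n) ^ 2 * (∑ k ∈ Finset.range n, dampWeight e n k ^ 2) +
        stepSize 1 e n ^ 2 := by
  rw [Finset.sum_range_succ, dampWeight_succ_self, Finset.mul_sum]
  congr 1
  refine Finset.sum_congr rfl fun k hk => ?_
  rw [dampWeight_succ e (Finset.mem_range.1 hk), mul_pow]

/-- The product of a weight and its truncation level is largest, up to a constant, for the most
recent input. This verifies the smallness condition of the exponential inequality uniformly in `k`.
-/
lemma dampWeight_mul_rpow_le {e p : ℝ} (hp : 0 < p) (hpe : p ≤ e) (he1 : e ≤ 1) {n k : ℕ}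
    (h : k < n) : dampWeight e n k * ((k : ℝ) + 1) ^ p ≤ 2 * (n : ℝ) ^ (p - e) := by
  have he : 0 < e := hp.trans_le hpe
  rcases Nat.eq_zero_or_pos k with rfl | hk
  -- `0 ^ (-e) = 0` by convention, so the input of index `0` has no weight.
  · have : dampWeight e n 0 = 0 := by
      simp [dampWeight, stepSize, Real.zero_rpow (neg_ne_zero.2 he.ne')]
    rw [this, zero_mul]; positivity
  have hk0 : (0 : ℝ) < k := by exact_mod_cast hk
  have hk1 : (1 : ℝ) ≤ k := by exact_mod_cast hk
  -- The left side is nonincreasing in `n`, because `(1 - n ^ (-e)) (1 + 1/n) ≤ 1` and `e - p ≤ 1`.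
  have key : ∀ n, k + 1 ≤ n →
      dampWeight e n k * (n : ℝ) ^ (e - p) ≤ (k : ℝ) ^ (-e) * ((k : ℝ) + 1) ^ (e - p) := by
    intro n hn
    induction n, hn using Nat.le_induction with
    | base => rw [dampWeight_succ_self, stepSize, one_mul]; push_cast; exact le_rfl
    | succ n hn ih =>
      refine le_trans ?_ ih
      have hn0 : (0 : ℝ) < n := by exact_mod_cast (by omega : 0 < n)
      have hn1 : (1 : ℝ) ≤ n := by exact_mod_cast (by omega : 1 ≤ n)
      rw [dampWeight_succ e (by omega)]
      have h1 : ((n + 1 : ℕ) : ℝ) ^ (e - p) ≤ (1 + 1 / n) * (n : ℝ) ^ (e - p) := by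
        have : (((n + 1 : ℕ) : ℝ)) = (1 + 1 / n) * n := by push_cast; field_simp
        rw [this, Real.mul_rpow (by positivity) hn0.le]
        gcongr
        calc (1 + 1 / (n : ℝ)) ^ (e - p) ≤ (1 + 1 / (n : ℝ)) ^ (1 : ℝ) :=
              Real.rpow_le_rpow_of_exponent_le (by simp) (by linarith)
          _ = _ := Real.rpow_one _
      have h2 : 1 / (n : ℝ) ≤ stepSize 1 e n := by
        rw [stepSize, one_mul, one_div, ← Real.rpow_neg_one]
        exact Real.rpow_le_rpow_of_exponent_le hn1 (by linarith)
      have h3 : (1 - stepSize 1 e n) * (1 + 1 / n) ≤ 1 := by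
        have : 0 < 1 / (n : ℝ) := by positivity
        nlinarith
      have h4 : 0 ≤ 1 - stepSize 1 e n := by linarith [stepSize_one_le_one he n]
      have h5 := dampWeight_nonneg he n k
      calc (1 - stepSize 1 e n) * dampWeight e n k * ((n + 1 : ℕ) : ℝ) ^ (e - p)
          ≤ (1 - stepSize 1 e n) * dampWeight e n k * ((1 + 1 / n) * (n : ℝ) ^ (e - p)) := by
            gcongr
        _ = ((1 - stepSize 1 e n) * (1 + 1 / n)) * (dampWeight e n k * (n : ℝ) ^ (e - p)) := by
            ring
        _ ≤ 1 * (dampWeight e n k * (n : ℝ) ^ (e - p)) := by gcongr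
        _ = _ := one_mul _
  have hn0 : (0 : ℝ) < n := by exact_mod_cast (by omega : 0 < n)
  have hkk : (0 : ℝ) < (k : ℝ) + 1 := by positivity
  have h1 := key n h
  have h2 : (k : ℝ) ^ (-e) * ((k : ℝ) + 1) ^ e ≤ 2 := by
    rw [Real.rpow_neg hk0.le, inv_mul_eq_div, ← Real.div_rpow hkk.le hk0.le]
    have h3 : ((k : ℝ) + 1) / k ≤ 2 := by rw [div_le_iff₀ hk0]; linarith
    have h4 : 1 ≤ ((k : ℝ) + 1) / k := by rw [le_div_iff₀ hk0]; linarith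
    calc (((k : ℝ) + 1) / k) ^ e ≤ (((k : ℝ) + 1) / k) ^ (1 : ℝ) :=
          Real.rpow_le_rpow_of_exponent_le h4 he1
      _ ≤ 2 := by rwa [Real.rpow_one]
  calc dampWeight e n k * ((k : ℝ) + 1) ^ p
      = (dampWeight e n k * (n : ℝ) ^ (e - p)) * ((k : ℝ) + 1) ^ p * (n : ℝ) ^ (p - e) := by
        have : (n : ℝ) ^ (e - p) * (n : ℝ) ^ (p - e) = 1 := by
          rw [← Real.rpow_add hn0]; simp
        linear_combination (-(dampWeight e n k * ((k : ℝ) + 1) ^ p)) * this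
    _ ≤ ((k : ℝ) ^ (-e) * ((k : ℝ) + 1) ^ (e - p)) * ((k : ℝ) + 1) ^ p * (n : ℝ) ^ (p - e) := by
        gcongr
    _ = (k : ℝ) ^ (-e) * ((k : ℝ) + 1) ^ e * (n : ℝ) ^ (p - e) := by
        rw [mul_assoc ((k : ℝ) ^ (-e)), ← Real.rpow_add hkk]; simp
    _ ≤ _ := by gcongr

lemma eventually_rpow_succ_ge {p e l : ℝ} (hp : 0 ≤ p) (he1 : e < 1) (hl : 0 < l) :
    ∀ᶠ n : ℕ in atTop, (n : ℝ) ^ (-p) * (1 - l * stepSize 1 e n) ≤ ((n + 1 : ℕ) : ℝ) ^ (-p) := by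
  refine eventually_mul_one_sub_le (v := fun n : ℕ => (n : ℝ) ^ (-p)) (p := p) one_pos he1.le hl
    (fun h => absurd h he1.ne) ?_ ?_
  · filter_upwards [eventually_ge_atTop 1] with n hn
    have : (0 : ℝ) < n := by exact_mod_cast hn
    positivity
  · filter_upwards [eventually_ge_atTop 1] with n hn
    exact rpow_neg_succ_ge hp hn

lemma eventually_stepSize_one (e : ℝ) (he : 0 < e) :
    ∀ᶠ n in atTop, 0 ≤ stepSize 1 e n ∧ 1 * stepSize 1 e n ≤ 1 :=
  Eventually.of_forall fun n => ⟨stepSize_nonneg one_pos e n, by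
    rw [one_mul]; exact stepSize_one_le_one he n⟩

/-- The weighted sum solves the damped recursion with input `b`, so `isBigO_of_contracting` applies.
For `e < 1` a power of `n` varies more slowly than any multiple of the steps. The variance sum below
is treated in the same way. -/
lemma sum_dampWeight_mul_isBigO {e K : ℝ} (he : 0 < e) (he1 : e < 1) {b : ℕ → ℝ}
    (hb0 : ∀ n, 0 ≤ b n) (hb : ∀ n : ℕ, 1 ≤ n → b n ≤ K * (n : ℝ) ^ (-(e / 2))) :
    (fun n => ∑ k ∈ Finset.range n, dampWeight e n k * b k) =O[atTop]
      fun n : ℕ => (n : ℝ) ^ (-(e / 2)) := by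
  refine isBigO_of_contracting (g := stepSize 1 e) (l := 1) (l' := 1 / 2) (C := K) (by norm_num)
    (fun n => Finset.sum_nonneg fun k _ => mul_nonneg (dampWeight_nonneg he n k) (hb0 k))
    (eventually_stepSize_one e he) ?_ (eventually_rpow_succ_ge (by linarith) he1 (by norm_num)) ?_
  · filter_upwards [eventually_ge_atTop 1] with n hn
    have : (0 : ℝ) < n := by exact_mod_cast hn
    positivity
  · filter_upwards [eventually_ge_atTop 1] with n hn
    rw [sum_dampWeight_succ, one_mul]
    exact add_le_add le_rfl (mul_le_mul_of_nonneg_left (hb n hn) (stepSize_nonneg one_pos e n))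

lemma sum_dampWeight_sq_isBigO {e : ℝ} (he : 0 < e) (he1 : e < 1) :
    (fun n => ∑ k ∈ Finset.range n, dampWeight e n k ^ 2) =O[atTop]
      fun n : ℕ => (n : ℝ) ^ (-e) := by
  refine isBigO_of_contracting (g := stepSize 1 e) (l := 1) (l' := 1 / 2) (C := 1) (by norm_num)
    (fun n => Finset.sum_nonneg fun k _ => sq_nonneg _)
    (eventually_stepSize_one e he) ?_ (eventually_rpow_succ_ge he.le he1 (by norm_num)) ?_
  · filter_upwards [eventually_ge_atTop 1] with n hn
    have : (0 : ℝ) < n := by exact_mod_cast hn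
    positivity
  · refine Eventually.of_forall fun n => ?_
    rw [sum_dampWeight_sq_succ]
    have h0 := stepSize_nonneg one_pos e n
    have h1 := stepSize_one_le_one he n
    have hQ : 0 ≤ ∑ k ∈ Finset.range n, dampWeight e n k ^ 2 :=
      Finset.sum_nonneg fun k _ => sq_nonneg _
    have e1 : (n : ℝ) ^ (-e) = stepSize 1 e n := by simp [stepSize]
    rw [e1, one_mul, pow_two (stepSize 1 e n)]
    refine add_le_add (mul_le_mul_of_nonneg_right ?_ hQ) le_rfl
    nlinarith

lemma sum_rpow_neg_half_le (n : ℕ) :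
    ∑ k ∈ Finset.range n, ((k : ℝ) + 1) ^ (-(1 / 2) : ℝ) ≤ 2 * Real.sqrt n := by
  induction n with
  | zero => simp
  | succ n ih =>
    rw [Finset.sum_range_succ]
    have h0 : (0 : ℝ) < (n : ℝ) + 1 := by positivity
    have e1 : ((n : ℝ) + 1) ^ (-(1 / 2) : ℝ) = (Real.sqrt ((n : ℝ) + 1))⁻¹ := by
      rw [Real.rpow_neg h0.le, Real.sqrt_eq_rpow]
    have hs : 0 < Real.sqrt ((n : ℝ) + 1) := Real.sqrt_pos.2 h0
    have h1 := Real.sq_sqrt h0.le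
    have h2 := Real.sq_sqrt (Nat.cast_nonneg (α := ℝ) n)
    have h3 : 2 * Real.sqrt n * Real.sqrt ((n : ℝ) + 1) ≤ 2 * ((n : ℝ) + 1) - 1 := by
      nlinarith [sq_nonneg (Real.sqrt ((n : ℝ) + 1) - Real.sqrt n)]
    have h4 : (Real.sqrt ((n : ℝ) + 1))⁻¹ ≤ 2 * Real.sqrt ((n : ℝ) + 1) - 2 * Real.sqrt n := by
      rw [inv_le_iff_one_le_mul₀ hs]
      nlinarith
    push_cast
    rw [e1]
    linarith

/-! ### Logarithmic factors and the damped recursion for `e < 1` and `e = 1` -/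

lemma log_isBigO_log_stepSum {c e : ℝ} (hc : 0 < c) (he : 0 ≤ e) (he1 : e < 1) :
    ∃ C, ∀ᶠ n : ℕ in atTop, Real.log n ≤ C * Real.log (stepSum c e n) := by
  refine ⟨2 / (1 - e), ?_⟩
  have h1e : 0 < 1 - e := by linarith
  filter_upwards [(tendsto_log_stepSum hc he1.le).eventually_ge_atTop (-Real.log c),
    eventually_ge_atTop 1] with n h hn
  have hn0 : (0 : ℝ) < n := by exact_mod_cast hn
  have h2 := Real.log_le_log (by positivity) (le_stepSum_rpow hc he hn)
  rw [Real.log_mul hc.ne' (by positivity), Real.log_rpow hn0] at h2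
  rw [div_mul_eq_mul_div, le_div_iff₀ h1e]
  linarith

/-- The partial sums are at least of order `log n`, hence of the order of the index `Nat.log 2 n` of
the dyadic block that contains `n`. -/
lemma log_log_isBigO_log_stepSum {c : ℝ} (hc : 0 < c) :
    ∀ᶠ n : ℕ in atTop, Real.log (Nat.log 2 n) ≤ 2 * Real.log (stepSum c 1 n) := by
  have hl2 : 0 < Real.log 2 := Real.log_pos one_lt_two
  filter_upwards [(tendsto_log_stepSum hc le_rfl).eventually_ge_atTop (-Real.log (c * Real.log 2)),
    eventually_ge_atTop 2] with n h hn
  have hj : 0 < Nat.log 2 n := Nat.log_pos one_lt_two hn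
  have hj0 : (0 : ℝ) < Nat.log 2 n := by exact_mod_cast hj
  have h1 : (Nat.log 2 n : ℝ) * Real.log 2 ≤ Real.log (n + 1) := by
    rw [← Real.log_pow]
    refine Real.log_le_log (by positivity) ?_
    have := Nat.pow_log_le_self 2 (x := n) (by omega)
    have : ((2 ^ Nat.log 2 n : ℕ) : ℝ) ≤ n := by exact_mod_cast this
    push_cast at this
    linarith
  have h2 : (c * Real.log 2) * Nat.log 2 n ≤ stepSum c 1 n := by
    refine le_trans ?_ (le_stepSum_log hc le_rfl n)
    calc (c * Real.log 2) * Nat.log 2 n = c * (Nat.log 2 n * Real.log 2) := by ring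
      _ ≤ _ := by gcongr
  have h3 := Real.log_le_log (by positivity) h2
  rw [Real.log_mul (by positivity) hj0.ne'] at h3
  linarith

lemma tendsto_sqrt_log_mul_rpow_neg {q : ℝ} (hq : 0 < q) :
    Tendsto (fun n : ℕ => Real.sqrt (Real.log n) * (n : ℝ) ^ (-q)) atTop (𝓝 0) := by
  have h := (isLittleO_log_rpow_atTop (r := 2 * q) (by linarith)).tendsto_div_nhds_zero.comp
    (tendsto_natCast_atTop_atTop (R := ℝ))
  have h2 := (Real.continuous_sqrt.tendsto 0).comp h
  rw [Real.sqrt_zero] at h2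
  refine h2.congr' ?_
  filter_upwards [eventually_ge_atTop 1] with n hn
  have hn0 : (0 : ℝ) < n := by exact_mod_cast hn
  simp only [Function.comp_apply]
  rw [Real.sqrt_div' _ (by positivity), div_eq_mul_inv, Real.sqrt_eq_rpow ((n : ℝ) ^ (2 * q)),
    ← Real.rpow_mul hn0.le, ← Real.rpow_neg hn0.le]
  congr 2; ring

/-- The solution started at zero is a weighted sum of variance `O(n ^ (-e))`. The weights depend on
`n`, so the exponential bound is applied afresh for each `n`; the resulting `log n` is affordable
here. -/
lemma ae_exists_damped_of_lt_one {Ω : Type*} {m0 : MeasurableSpace Ω} {P : Measure Ω}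
    [IsProbabilityMeasure P] {ℱ : ℕ → MeasurableSpace Ω} (hℱ : Monotone ℱ) (hle : ∀ n, ℱ n ≤ m0)
    {D : ℕ → Ω → ℝ} (hD : ∀ n, Measurable[ℱ (n + 1)] (D n)) {b : ℕ → ℝ} {κ K p e c₀ : ℝ}
    (hexp : ∀ n : ℕ, ∀ l : ℝ, |l| * ((n : ℝ) + 1) ^ p ≤ 1 → ∀ F, MeasurableSet[ℱ n] F →
      ∫⁻ ω in F, ENNReal.ofReal (Real.exp (l * D n ω)) ∂P ≤
        ENNReal.ofReal (Real.exp (|l| * b n + l ^ 2 * κ)) * P F)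
    (hκ : 0 ≤ κ) (hp : 0 < p) (hpe : p < e / 2) (he1 : e < 1) (hc₀ : 0 < c₀) (hK : 0 ≤ K)
    (hb0 : ∀ n, 0 ≤ b n) (hb : ∀ n : ℕ, b n ≤ K * ((n : ℝ) + 1) ^ (-(e / 2))) :
    ∀ᵐ ω ∂P, ∃ s : ℕ → ℝ, s =O[atTop] lilRate c₀ e ∧
      ∀ᶠ n in atTop, s (n + 1) = (1 - stepSize 1 e n) * s n + stepSize 1 e n * D n ω := by
  have he : 0 < e := by linarith
  -- This balances `l n ^ (-e)` with `log n / l`: both become `n ^ (-e/2) √(log n)`. The requirement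
  -- on `l` then reduces to `√(log n) n ^ (p - e/2) → 0`, whence `p < e / 2`.
  set l : ℕ → ℝ := fun n => Real.sqrt (Real.log n) * (n : ℝ) ^ (e / 2) with hldef
  have hl0 : ∀ᶠ n in atTop, 0 < l n := by
    filter_upwards [eventually_ge_atTop 2] with n hn
    have hn0 : (1 : ℝ) < n := by exact_mod_cast hn
    have := Real.log_pos hn0
    positivity
  have hlc : ∀ᶠ j in atTop, ∀ k : ℕ, k < j → l j * (dampWeight e j k * ((k : ℝ) + 1) ^ p) ≤ 1 := by
    have h := (tendsto_sqrt_log_mul_rpow_neg (q := e / 2 - p) (by linarith)).const_mul 2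
    rw [mul_zero] at h
    filter_upwards [h.eventually_lt_const one_pos, hl0, eventually_ge_atTop 1] with j h1 h2 hj k hk
    have hj0 : (0 : ℝ) < j := by exact_mod_cast hj
    calc l j * (dampWeight e j k * ((k : ℝ) + 1) ^ p) ≤ l j * (2 * (j : ℝ) ^ (p - e)) :=
          mul_le_mul_of_nonneg_left (dampWeight_mul_rpow_le hp (by linarith) he1.le hk) h2.le
      _ = 2 * (Real.sqrt (Real.log j) * ((j : ℝ) ^ (e / 2) * (j : ℝ) ^ (p - e))) := by
          rw [hldef]; ring
      _ = 2 * (Real.sqrt (Real.log j) * (j : ℝ) ^ (-(e / 2 - p))) := by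
          rw [← Real.rpow_add hj0]; ring_nf
      _ ≤ 1 := h1.le
  have hae := ae_eventually_abs_sum_le hℱ hle hD hexp (w := fun j => dampWeight e j)
    (fun j => dampWeight_nonneg he j) (l := l) (N := fun j => j) hl0 hlc
  have hU := sum_dampWeight_mul_isBigO he he1 (K := K) hb0 (fun n hn => (hb n).trans (by
    have hn0 : (0 : ℝ) < n := by exact_mod_cast hn
    exact mul_le_mul_of_nonneg_left
      (Real.rpow_le_rpow_of_nonpos hn0 (by linarith) (by linarith)) hK))
  obtain ⟨C₁, hC₁, hU⟩ := hU.exists_pos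
  obtain ⟨C₂, hC₂, hQ⟩ := (sum_dampWeight_sq_isBigO he he1).exists_pos
  obtain ⟨C, hC⟩ := log_isBigO_log_stepSum hc₀ he.le he1
  have hlog := isBigO_lilRate (e := e) hc₀ he1.le hC
  have hone := rpow_isBigO_lilRate (e := e) hc₀ he1.le
  filter_upwards [hae] with ω hω
  refine ⟨fun n => ∑ k ∈ Finset.range n, dampWeight e n k * D k ω, ?_,
    Eventually.of_forall fun n => sum_dampWeight_succ e (fun k => D k ω) n⟩
  refine IsBigO.trans (IsBigO.of_bound 1 ?_)
    ((hone.const_mul_left C₁).add (hlog.const_mul_left (κ * C₂ + 2)))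
  filter_upwards [hω, hU.bound, hQ.bound, hl0, eventually_ge_atTop 1] with n h1 h2 h3 h4 hn
  have hn0 : (0 : ℝ) < n := by exact_mod_cast hn
  have h1 := h1 n le_rfl
  rw [Real.norm_of_nonneg (by positivity : 0 ≤ (n : ℝ) ^ (-(e / 2)))] at h2
  rw [Real.norm_of_nonneg (by positivity : 0 ≤ (n : ℝ) ^ (-e))] at h3
  rw [Real.norm_eq_abs, one_mul]
  have e1 : l n * (κ * (C₂ * (n : ℝ) ^ (-e))) =
      κ * C₂ * ((n : ℝ) ^ (-(e / 2)) * Real.sqrt (Real.log n)) := by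
    have : (n : ℝ) ^ (e / 2) * (n : ℝ) ^ (-e) = (n : ℝ) ^ (-(e / 2)) := by
      rw [← Real.rpow_add hn0]; ring_nf
    rw [← this, hldef]; ring
  have e2 : 2 * Real.log n / l n = 2 * ((n : ℝ) ^ (-(e / 2)) * Real.sqrt (Real.log n)) := by
    rw [div_eq_iff h4.ne', hldef]
    have h5 : 0 ≤ Real.log n := Real.log_nonneg (by exact_mod_cast hn)
    have h6 := Real.mul_self_sqrt h5
    have h7 : (n : ℝ) ^ (-(e / 2)) * (n : ℝ) ^ (e / 2) = 1 := by
      rw [← Real.rpow_add hn0]; simp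
    calc 2 * Real.log n = 2 * (Real.sqrt (Real.log n) * Real.sqrt (Real.log n)) *
          ((n : ℝ) ^ (-(e / 2)) * (n : ℝ) ^ (e / 2)) := by rw [h6, h7, mul_one]
      _ = _ := by ring
  refine h1.trans (le_trans ?_ (Real.le_norm_self _))
  calc _ ≤ C₁ * (n : ℝ) ^ (-(e / 2)) + l n * (κ * (C₂ * (n : ℝ) ^ (-e))) +
        2 * Real.log n / l n := by
        gcongr
        · exact (Real.le_norm_self _).trans h2
        · exact (Real.le_norm_self _).trans h3
    _ = _ := by rw [e1, e2]; ring

/-- With step `1 / n` the recursion is solved by an average of the inputs, and the weights of the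
partial sums no longer depend on `n`. One maximal bound up to `2 ^ (j + 1)` covers the block `[2 ^
j, 2 ^ (j + 1))`, so Borel-Cantelli over `j` costs only `log j`. -/
lemma ae_exists_damped_of_eq_one {Ω : Type*} {m0 : MeasurableSpace Ω} {P : Measure Ω}
    [IsProbabilityMeasure P] {ℱ : ℕ → MeasurableSpace Ω} (hℱ : Monotone ℱ) (hle : ∀ n, ℱ n ≤ m0)
    {D : ℕ → Ω → ℝ} (hD : ∀ n, Measurable[ℱ (n + 1)] (D n)) {b : ℕ → ℝ} {κ K p c₀ : ℝ}
    (hexp : ∀ n : ℕ, ∀ l : ℝ, |l| * ((n : ℝ) + 1) ^ p ≤ 1 → ∀ F, MeasurableSet[ℱ n] F →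
      ∫⁻ ω in F, ENNReal.ofReal (Real.exp (l * D n ω)) ∂P ≤
        ENNReal.ofReal (Real.exp (|l| * b n + l ^ 2 * κ)) * P F)
    (hκ : 0 ≤ κ) (hp : 0 < p) (hpe : p < 1 / 2) (hc₀ : 0 < c₀) (hK : 0 ≤ K)
    (hb : ∀ n : ℕ, b n ≤ K * ((n : ℝ) + 1) ^ (-(1 / 2) : ℝ)) :
    ∀ᵐ ω ∂P, ∃ s : ℕ → ℝ, s =O[atTop] lilRate c₀ 1 ∧
      ∀ᶠ n in atTop, s (n + 1) = (1 - stepSize 1 1 n) * s n + stepSize 1 1 n * D n ω := by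
  -- This balances the variance term `l 2 ^ j` with `log j / l`, both of order `√(2 ^ j log j)`.
  set l : ℕ → ℝ := fun j => Real.sqrt (Real.log j) / Real.sqrt (2 ^ j) with hldef
  have hl0 : ∀ᶠ n in atTop, 0 < l n := by
    filter_upwards [eventually_ge_atTop 2] with n hn
    have hn0 : (1 : ℝ) < n := by exact_mod_cast hn
    have := Real.log_pos hn0
    positivity
  have hlc : ∀ᶠ j in atTop, ∀ k : ℕ, k < 2 ^ (j + 1) → l j * ((1 : ℝ) * ((k : ℝ) + 1) ^ p) ≤ 1 := by
    set r : ℝ := (2 : ℝ) ^ (p - 1 / 2) with hr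
    have hr1 : r < 1 := Real.rpow_lt_one_of_one_lt_of_neg one_lt_two (by linarith)
    have h := (tendsto_self_mul_const_pow_of_lt_one (by positivity) hr1).const_mul (2 ^ p)
    rw [mul_zero] at h
    filter_upwards [h.eventually_lt_const one_pos, hl0, eventually_ge_atTop 1] with j h1 h2 hj k hk
    have hj1 : (1 : ℝ) ≤ j := by exact_mod_cast hj
    have hk' : (k : ℝ) + 1 ≤ 2 ^ (j + 1) := by exact_mod_cast hk
    have hlog : Real.sqrt (Real.log j) ≤ j := by
      rw [Real.sqrt_le_left (by linarith)]
      have := Real.log_le_sub_one_of_pos (by linarith : (0 : ℝ) < j)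
      nlinarith
    have e1 : ((2 : ℝ) ^ (j + 1)) ^ p / Real.sqrt (2 ^ j) = 2 ^ p * r ^ j := by
      rw [div_eq_iff (by positivity), hr, Real.sqrt_eq_rpow, ← Real.rpow_natCast,
        ← Real.rpow_natCast, ← Real.rpow_natCast, ← Real.rpow_mul (by norm_num),
        ← Real.rpow_mul (by norm_num), ← Real.rpow_mul (by norm_num),
        ← Real.rpow_add (by norm_num), ← Real.rpow_add (by norm_num)]
      congr 1; push_cast; ring
    calc l j * (1 * ((k : ℝ) + 1) ^ p) ≤ l j * (1 * ((2 : ℝ) ^ (j + 1)) ^ p) := by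
          gcongr
      _ = Real.sqrt (Real.log j) * (((2 : ℝ) ^ (j + 1)) ^ p / Real.sqrt (2 ^ j)) := by
          rw [hldef]; ring
      _ ≤ j * (2 ^ p * r ^ j) := by rw [e1]; gcongr
      _ ≤ 1 := by linarith
  have hae := ae_eventually_abs_sum_le hℱ hle hD hexp (w := fun _ _ => 1)
    (fun _ _ => zero_le_one) (l := l) (N := fun j => 2 ^ (j + 1)) hl0 hlc
  have hlog := isBigO_lilRate (e := 1) hc₀ le_rfl (log_log_isBigO_log_stepSum hc₀)
  have hone := rpow_isBigO_lilRate (e := 1) hc₀ le_rfl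
  have htl : Tendsto (Nat.log 2) atTop atTop :=
    tendsto_atTop.2 fun j => (eventually_ge_atTop (2 ^ j)).mono
      fun _ hn => Nat.le_log_of_pow_le one_lt_two hn
  filter_upwards [hae] with ω hω
  -- The divisor is `n - 1` because the step at time `n` is `1 / n`: the sum of `n + 1` inputs must
  -- be divided by `n`. The recursion is exact from `n = 2` on.
  refine ⟨fun n => ((n : ℝ) - 1)⁻¹ * ∑ k ∈ Finset.range n, D k ω, ?_, ?_⟩
  · refine IsBigO.trans (IsBigO.of_bound 1 ?_)
      ((hone.const_mul_left (4 * K)).add (hlog.const_mul_left (4 * κ + 4)))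
    filter_upwards [htl.eventually hω, htl.eventually hl0, htl.eventually (eventually_ge_atTop 1),
      eventually_ge_atTop 2] with n h1 h2 h3 hn
    have hn2 : (2 : ℝ) ≤ n := by exact_mod_cast hn
    have hn0 : (0 : ℝ) < n := by linarith
    set j := Nat.log 2 n with hj
    have hjn : (2 : ℝ) ^ j ≤ n := by exact_mod_cast Nat.pow_log_le_self 2 (by omega : n ≠ 0)
    have hnj' : n < 2 ^ (j + 1) := Nat.lt_pow_succ_log_self one_lt_two n
    have hnj : (n : ℝ) ≤ 2 * 2 ^ j := by
      have : (n : ℝ) < 2 ^ (j + 1) := by exact_mod_cast hnj'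
      rw [pow_succ] at this; linarith
    have h4 := h1 n hnj'.le
    simp only [one_mul, one_pow, Finset.sum_const, Finset.card_range, nsmul_eq_mul, mul_one] at h4
    have hsn : 0 < Real.sqrt n := Real.sqrt_pos.2 hn0
    set Lj := Real.sqrt (Real.log j) with hLj
    have hLj0 : 0 ≤ Lj := Real.sqrt_nonneg _
    have hs2 : 0 < Real.sqrt ((2 : ℝ) ^ j) := Real.sqrt_pos.2 (by positivity)
    have hs2n : Real.sqrt ((2 : ℝ) ^ j) ≤ Real.sqrt n := Real.sqrt_le_sqrt hjn
    have hsq2 := Real.mul_self_sqrt (by positivity : (0 : ℝ) ≤ 2 ^ j)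
    have hsqn := Real.mul_self_sqrt hn0.le
    have b1 : ∑ k ∈ Finset.range n, b k ≤ 2 * K * Real.sqrt n := by
      calc ∑ k ∈ Finset.range n, b k ≤ ∑ k ∈ Finset.range n, K * ((k : ℝ) + 1) ^ (-(1 / 2) : ℝ) :=
            Finset.sum_le_sum fun k _ => hb k
        _ ≤ K * (2 * Real.sqrt n) := by
            rw [← Finset.mul_sum]
            exact mul_le_mul_of_nonneg_left (sum_rpow_neg_half_le n) hK
        _ = _ := by ring
    have b2 : l j * (κ * n) ≤ 2 * κ * (Lj * Real.sqrt n) := by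
      have : (n : ℝ) / Real.sqrt (2 ^ j) ≤ 2 * Real.sqrt n := by
        rw [div_le_iff₀ hs2]
        nlinarith
      calc l j * (κ * n) = κ * Lj * (n / Real.sqrt (2 ^ j)) := by rw [hldef]; ring
        _ ≤ κ * Lj * (2 * Real.sqrt n) := by gcongr
        _ = _ := by ring
    have b3 : 2 * Real.log j / l j ≤ 2 * (Lj * Real.sqrt n) := by
      rw [div_le_iff₀ h2]
      have h5 : 0 ≤ Real.log j := Real.log_nonneg (by exact_mod_cast h3)
      have h6 := Real.mul_self_sqrt h5
      have h7 : 1 ≤ Real.sqrt n / Real.sqrt (2 ^ j) := by rwa [le_div_iff₀ hs2, one_mul]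
      calc 2 * Real.log j = 2 * (Lj * Lj) * 1 := by rw [hLj, h6]; ring
        _ ≤ 2 * (Lj * Lj) * (Real.sqrt n / Real.sqrt (2 ^ j)) := by gcongr
        _ = _ := by rw [hldef]; ring
    have e1 : (n : ℝ) ^ (-(1 / 2) : ℝ) = (Real.sqrt n)⁻¹ := by
      rw [Real.rpow_neg hn0.le, Real.sqrt_eq_rpow]
    have e2 : ((n : ℝ) - 1)⁻¹ ≤ 2 * (n : ℝ)⁻¹ := by
      rw [← div_eq_mul_inv, inv_le_comm₀ (by linarith) (by positivity), inv_div]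
      linarith
    have e3 : (n : ℝ)⁻¹ * Real.sqrt n = (Real.sqrt n)⁻¹ := by
      rw [inv_mul_eq_div, Real.sqrt_div_self]
    rw [Real.norm_eq_abs, one_mul, abs_mul, abs_of_nonneg (inv_nonneg.2 (by linarith))]
    refine le_trans ?_ (Real.le_norm_self _)
    rw [e1]
    calc ((n : ℝ) - 1)⁻¹ * |∑ k ∈ Finset.range n, D k ω|
        ≤ (2 * (n : ℝ)⁻¹) * (2 * K * Real.sqrt n + 2 * κ * (Lj * Real.sqrt n) +
            2 * (Lj * Real.sqrt n)) := by
          refine mul_le_mul e2 (h4.trans (add_le_add (add_le_add b1 b2) b3)) (abs_nonneg _)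
            (by positivity)
      _ = ((n : ℝ)⁻¹ * Real.sqrt n) * (4 * K + (4 * κ + 4) * Lj) := by ring
      _ = _ := by rw [e3]; ring
  · filter_upwards [eventually_ge_atTop 2] with n hn
    have hn2 : (2 : ℝ) ≤ n := by exact_mod_cast hn
    have hn1 : (n : ℝ) - 1 ≠ 0 := by linarith
    have hn0 : (n : ℝ) ≠ 0 := by linarith
    simp only [Finset.sum_range_succ, stepSize, Real.rpow_neg_one, one_mul]
    rw [show ((n + 1 : ℕ) : ℝ) - 1 = n by push_cast; ring]
    field_simp

/-- Almost surely, where the conditional moments are bounded, the recursion driven by the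
martingale increments `ξ` obeys the rate of the law of the iterated logarithm. -/
theorem ae_exists_damped {Ω : Type*} {m0 : MeasurableSpace Ω} {P : Measure Ω}
    [IsProbabilityMeasure P] {ℱ : ℕ → MeasurableSpace Ω} (hℱ : Monotone ℱ) (hle : ∀ n, ℱ n ≤ m0)
    {ξ : ℕ → Ω → ℝ} (hξ : ∀ n, Measurable[ℱ (n + 1)] (ξ n)) {G : ℕ → Set Ω}
    (hG : ∀ n, MeasurableSet[ℱ n] (G n)) {m K e c₀ : ℝ} (hK : 0 ≤ K) (he : 1 / 2 < e)
    (he1 : e ≤ 1) (hm : 2 / e < m) (hc₀ : 0 < c₀)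
    (hmom : ∀ n F, MeasurableSet[ℱ n] F → F ⊆ G n →
      ∫⁻ ω in F, ‖ξ n ω‖ₑ ^ m ∂P ≤ ENNReal.ofReal K * P F)
    (hmean : ∀ n F, MeasurableSet[ℱ n] F → F ⊆ G n → IntegrableOn (ξ n) F P →
      ∫ ω in F, ξ n ω ∂P = 0) :
    ∀ᵐ ω ∂P, (∀ n, 1 ≤ n → ω ∈ G n) → ∃ s : ℕ → ℝ, s =O[atTop] lilRate c₀ e ∧
      ∀ᶠ n in atTop, s (n + 1) = (1 - stepSize 1 e n) * s n + stepSize 1 e n * ξ n ω := by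
  have he0 : 0 < e := by linarith
  have hm2 : 2 < m := lt_of_le_of_lt (by rw [le_div_iff₀ he0]; linarith) hm
  have hm0 : 0 < m := by linarith
  -- `p m > 1` makes the probabilities of exceeding `(n + 1) ^ p` summable; `p < e / 2` meets the
  -- smallness condition on `l`. Together with `e ≤ 1` they give `p (1 - m) < p - 1 < -e / 2`, so
  -- the truncation bias is `O(n ^ (-e/2))`. The interval is nonempty exactly because `m > 2 / e`.
  obtain ⟨p, hp1, hp2⟩ : ∃ p, 1 / m < p ∧ p < e / 2 := by
    refine exists_between ?_
    rw [div_lt_iff₀ he0] at hm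
    rw [div_lt_iff₀ hm0]
    linarith
  have hp : 0 < p := lt_trans (by positivity) hp1
  have hpm : 1 < p * m := by rwa [div_lt_iff₀ hm0] at hp1
  have hξ0 : ∀ n, Measurable (ξ n) := fun n => (hξ n).mono (hle _) le_rfl
  have hcpos : ∀ n : ℕ, (0 : ℝ) < ((n : ℝ) + 1) ^ p := fun n => by positivity
  set D : ℕ → Ω → ℝ := fun n => clip (G n) (((n : ℝ) + 1) ^ p) (ξ n) with hDdef
  have hD : ∀ n, Measurable[ℱ (n + 1)] (D n) := fun n =>
    @measurable_clip _ (ℱ (n + 1)) _ _ _ (hℱ n.le_succ _ (hG n)) (hξ n)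
  have hexp : ∀ n : ℕ, ∀ l : ℝ, |l| * ((n : ℝ) + 1) ^ p ≤ 1 → ∀ F, MeasurableSet[ℱ n] F →
      ∫⁻ ω in F, ENNReal.ofReal (Real.exp (l * D n ω)) ∂P ≤
        ENNReal.ofReal (Real.exp (|l| * (K * (((n : ℝ) + 1) ^ p) ^ (1 - m)) + l ^ 2 * (1 + K))) *
          P F := fun n l hl F hF =>
    lintegral_exp_clip_le (hle n) (hξ0 n) (hG n) hm2.le hK (hcpos n) (hmom n) (hmean n) hl hF
  have hb0 : ∀ n : ℕ, 0 ≤ K * (((n : ℝ) + 1) ^ p) ^ (1 - m) := fun n => by positivity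
  have hb : ∀ n : ℕ, K * (((n : ℝ) + 1) ^ p) ^ (1 - m) ≤ K * ((n : ℝ) + 1) ^ (-(e / 2)) := by
    intro n
    rw [← Real.rpow_mul (by positivity)]
    gcongr
    · linarith [Nat.cast_nonneg (α := ℝ) n]
    · nlinarith
  have hdamped : ∀ᵐ ω ∂P, ∃ s : ℕ → ℝ, s =O[atTop] lilRate c₀ e ∧
      ∀ᶠ n in atTop, s (n + 1) = (1 - stepSize 1 e n) * s n + stepSize 1 e n * D n ω := by
    rcases he1.lt_or_eq with h1 | rfl
    · exact ae_exists_damped_of_lt_one hℱ hle hD hexp (by linarith) hp hp2 h1 hc₀ hK hb0 hb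
    · exact ae_exists_damped_of_eq_one hℱ hle hD hexp (by linarith) hp hp2 hc₀ hK hb
  have hjump := ae_eventually_abs_le (P := P) hξ0 (fun n => hle n _ (hG n)) (m := m) (K := K)
    hm0 hcpos (fun n => (hmom n _ (hG n) subset_rfl).trans (mul_le_of_le_one_right' prob_le_one)) ?_
  · filter_upwards [hdamped, hjump] with ω ⟨s, hs, hrec⟩ hj hω
    refine ⟨s, hs, ?_⟩
    filter_upwards [hrec, hj, eventually_ge_atTop 1] with n h1 h2 hn
    have hmem : ω ∈ G n ∩ {ω | |ξ n ω| ≤ ((n : ℝ) + 1) ^ p} := ⟨hω n hn, h2 (hω n hn)⟩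
    have : D n ω = ξ n ω := Set.indicator_of_mem hmem (ξ n)
    rw [h1, this]
  · have h1 : Summable fun n : ℕ => ((n : ℝ)) ^ (-(p * m)) :=
      Real.summable_nat_rpow.2 (by linarith)
    have h2 := (summable_nat_add_iff 1).2 h1
    refine h2.congr fun n => ?_
    rw [← Real.rpow_mul (by positivity)]
    push_cast
    ring_nf

/-! ### From scalar increments to the vector noise -/

/-- `W` is integrable only on the pieces `A k`. Cutting `F` along their disjoint versions gives
pieces of integral zero, and integrability of `L ∘ W` on all of `F` permits summing them. -/
lemma IsCondExp.setIntegral_comp_eq_zero {Ω : Type*} {𝓖 m0 : MeasurableSpace Ω} {P : Measure Ω}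
    [IsProbabilityMeasure P] (h𝓖 : 𝓖 ≤ m0) {E : Type*} [NormedAddCommGroup E] [NormedSpace ℝ E]
    [CompleteSpace E] {W : Ω → E} (h : IsCondExp 𝓖 P W (fun _ => 0)) (L : E →L[ℝ] ℝ) {F : Set Ω}
    (hF : MeasurableSet[𝓖] F) (hint : IntegrableOn (fun ω => L (W ω)) F P) :
    ∫ ω in F, L (W ω) ∂P = 0 := by
  obtain ⟨A, hA, hcov, hAint, hAeq⟩ := h
  have hA0 : ∀ k, MeasurableSet (A k) := fun k => h𝓖 _ (hA k)
  have hzero : ∀ k S, MeasurableSet[𝓖] S → S ⊆ A k → ∫ ω in S, L (W ω) ∂P = 0 := by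
    intro k S hS hSA
    rw [L.integral_comp_comm ((hAint k).mono_set hSA)]
    have h1 : ∫ ω in S, W ω ∂P = ∫ ω in S, (A k).indicator W ω ∂P :=
      setIntegral_congr_fun (h𝓖 _ hS) fun ω hω => (Set.indicator_of_mem (hSA hω) W).symm
    have h2 : ∫ ω in S, (P[(A k).indicator W | 𝓖]) ω ∂P = ∫ ω in S, (A k).indicator W ω ∂P :=
      setIntegral_condExp h𝓖 ((integrable_indicator_iff (hA0 k)).2 (hAint k)) hS
    have h3 : ∫ ω in S, (P[(A k).indicator W | 𝓖]) ω ∂P = 0 := by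
      rw [integral_congr_ae (ae_restrict_of_ae (hAeq k))]
      simp
    rw [h1, ← h2, h3, map_zero]
  have hB : ∀ k, MeasurableSet[𝓖] (disjointed A k) := fun k =>
    @MeasurableSet.disjointed _ 𝓖 _ hA k
  have hFB : ∀ k, MeasurableSet[𝓖] (F ∩ disjointed A k) := fun k =>
    @MeasurableSet.inter _ 𝓖 _ _ hF (hB k)
  have hae : F =ᵐ[P] ⋃ k, F ∩ disjointed A k := by
    rw [← Set.inter_iUnion, iUnion_disjointed]
    filter_upwards [hcov] with ω hω
    have : ω ∈ ⋃ k, A k := Set.mem_iUnion.2 hω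
    exact propext ⟨fun h => ⟨h, this⟩, fun h => h.1⟩
  rw [setIntegral_congr_set hae, integral_iUnion (fun k => h𝓖 _ (hFB k)) ?_ ?_]
  · rw [tsum_congr fun k => hzero k _ (hFB k)
      (Set.inter_subset_right.trans (disjointed_subset A k))]
    simp
  · intro i j hij
    exact (disjoint_disjointed A hij).mono Set.inter_subset_right Set.inter_subset_right
  · exact hint.mono_set (Set.iUnion_subset fun k => Set.inter_subset_left)

/-- The vector version of `ae_exists_damped`, for martingale increments with almost surely bounded
conditional moments. -/
theorem ae_exists_damped_vector {Ω : Type*} {m0 : MeasurableSpace Ω} {P : Measure Ω}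
    [IsProbabilityMeasure P] {ℱ : ℕ → MeasurableSpace Ω} (hℱ : Monotone ℱ) (hle : ∀ n, ℱ n ≤ m0)
    {q : ℕ} {W : ℕ → Ω → EuclideanSpace ℝ (Fin q)} (hW : ∀ n, Measurable[ℱ n] (W n))
    {m e c₀ : ℝ} (he : 1 / 2 < e) (he1 : e ≤ 1) (hm : 2 / e < m) (hc₀ : 0 < c₀)
    (hW0 : ∀ n, 1 ≤ n → IsCondExp (ℱ n) P (W (n + 1)) (fun _ => 0))
    (hmom : ∀ᵐ ω ∂P, (⨆ (n : ℕ) (_ : 1 ≤ n),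
      condLExp (ℱ n) P (fun ω' => ‖W (n + 1) ω'‖ₑ ^ m) ω) < ⊤) :
    ∀ᵐ ω ∂P, ∃ s : ℕ → EuclideanSpace ℝ (Fin q), s =O[atTop] lilRate c₀ e ∧
      ∀ᶠ n in atTop, s (n + 1) =
        (1 - stepSize 1 e n) • s n + stepSize 1 e n • W (n + 1) ω := by
  have hm0 : 0 < m := lt_trans (div_pos two_pos (by linarith)) hm
  set M : ℕ → Ω → ENNReal := fun n => condLExp (ℱ n) P (fun ω' => ‖W (n + 1) ω'‖ₑ ^ m) with hM
  -- The moment bound is random, so it is localised at integer levels `K`; almost every path lies in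
  -- `G K n` for all `n ≥ 1` and some `K`. The clause `1 ≤ n` empties `G K 0`, where the noise is
  -- not assumed centred.
  set G : ℕ → ℕ → Set Ω := fun K n => {ω | 1 ≤ n ∧ M n ω ≤ (K : ENNReal)} with hG
  have hGm : ∀ K n, MeasurableSet[ℱ n] (G K n) := fun K n => by
    have : G K n = {ω | 1 ≤ n} ∩ M n ⁻¹' Set.Iic (K : ENNReal) := by ext; simp [hG]
    rw [this]
    exact @MeasurableSet.inter _ (ℱ n) _ _ (@MeasurableSet.const _ (ℱ n) _)
      (measurable_condLExp (ℱ n) P _ measurableSet_Iic)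
  have hcoord : ∀ (K : ℕ) (i : Fin q), ∀ᵐ ω ∂P, (∀ n, 1 ≤ n → ω ∈ G K n) →
      ∃ s : ℕ → ℝ, s =O[atTop] lilRate c₀ e ∧ ∀ᶠ n in atTop,
        s (n + 1) = (1 - stepSize 1 e n) * s n + stepSize 1 e n * W (n + 1) ω i := by
    intro K i
    set L : EuclideanSpace ℝ (Fin q) →L[ℝ] ℝ := EuclideanSpace.proj i
    refine ae_exists_damped (ξ := fun n ω => L (W (n + 1) ω)) hℱ hle
      (fun n => L.continuous.measurable.comp (hW (n + 1))) (hGm K) (m := m) (K := K)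
      (Nat.cast_nonneg K) he he1 hm hc₀ ?_ ?_
    · intro n F hF hFG
      have h1 : ∫⁻ ω in F, ‖L (W (n + 1) ω)‖ₑ ^ m ∂P ≤ ∫⁻ ω in F, ‖W (n + 1) ω‖ₑ ^ m ∂P := by
        refine lintegral_mono fun ω => ENNReal.rpow_le_rpow ?_ hm0.le
        rw [enorm_le_iff_norm_le]
        exact PiLp.norm_apply_le (W (n + 1) ω) i
      have h2 : ∫⁻ ω in F, M n ω ∂P = ∫⁻ ω in F, ‖W (n + 1) ω‖ₑ ^ m ∂P :=
        setLIntegral_condLExp (hle n) P _ hF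
      rw [← h2] at h1
      refine h1.trans ((setLIntegral_mono' (hle n _ hF) fun ω hω => (hFG hω).2).trans_eq ?_)
      simp
    · intro n F hF hFG hint
      rcases Nat.eq_zero_or_pos n with rfl | hn
      · have : F = ∅ := Set.eq_empty_of_forall_notMem fun ω hω => by
          have := (hFG hω).1
          omega
        simp [this]
      · exact (hW0 n hn).setIntegral_comp_eq_zero (hle n) L hF hint
  filter_upwards [ae_all_iff.2 fun K => ae_all_iff.2 (hcoord K), hmom] with ω h1 h2
  obtain ⟨K, hK⟩ := ENNReal.exists_nat_gt h2.ne
  have hmem : ∀ n, 1 ≤ n → ω ∈ G K n := fun n hn =>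
    ⟨hn, (le_iSup₂_of_le (f := fun n (_ : 1 ≤ n) => M n ω) n hn le_rfl).trans hK.le⟩
  choose s hsO hs using fun i => h1 K i hmem
  refine ⟨fun n => ∑ i, s i n • EuclideanSpace.single i (1 : ℝ), ?_, ?_⟩
  · have key : ∀ i ∈ (Finset.univ : Finset (Fin q)),
        (fun n => s i n • EuclideanSpace.single i (1 : ℝ)) =O[atTop] lilRate c₀ e := fun i _ =>
      (IsBigO.of_bound 1 (Eventually.of_forall fun n => by rw [norm_smul]; simp)).trans (hsO i)
    exact IsBigO.fun_sum key
  · filter_upwards [eventually_all.2 hs] with n hn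
    ext i
    simp [Finset.sum_apply, hn, Pi.single_apply]

/-! ### Assembling the theorem -/

lemma history_mono {Ω : Type*} {d d' : ℕ}
    (V : ℕ → Ω → EuclideanSpace ℝ (Fin d)) (W : ℕ → Ω → EuclideanSpace ℝ (Fin d'))
    (θ : ℕ → Ω → EuclideanSpace ℝ (Fin d)) (μ : ℕ → Ω → EuclideanSpace ℝ (Fin d'))
    (ψθ : ℕ → Ω → EuclideanSpace ℝ (Fin d)) (ψμ : ℕ → Ω → EuclideanSpace ℝ (Fin d')) :
    Monotone (history V W θ μ ψθ ψμ) := fun _ _ h =>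
  iSup₂_le fun i hi => le_iSup₂_of_le i (hi.trans h) le_rfl

/-- For `b = 1` the target rate loses a fraction `1 / (2n)` per step, against a contraction `l β₀ /
n`. The choice `l' = 1 / (2 β₀)` is critical, and the hypothesis on `β₀` leaves room for `l` between
it and `Λ`. -/
lemma exists_contraction_rates {Λ β₀ b : ℝ} (hΛ : 0 < Λ) (hβ₀ : 0 < β₀)
    (hb1 : b = 1 → 1 / (2 * Λ) < β₀) :
    ∃ l' l, 0 < l' ∧ l' < l ∧ l < Λ ∧ (b = 1 → 1 / 2 ≤ l' * β₀) := by
  by_cases h : b = 1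
  · have h1 := hb1 h
    rw [div_lt_iff₀ (by positivity)] at h1
    have h2 : 1 / 2 / β₀ < Λ := by rw [div_lt_iff₀ hβ₀]; linarith
    refine ⟨1 / 2 / β₀, (1 / 2 / β₀ + Λ) / 2, by positivity, by linarith, by linarith, fun _ => ?_⟩
    rw [div_mul_cancel₀ _ hβ₀.ne']
  · exact ⟨Λ / 3, Λ / 2, by linarith, by linarith, by linarith, fun h' => absurd h' h⟩

/-- The remainder of one component along a trajectory. -/
lemma remainder_isBigO {E F : Type*} [NormedAddCommGroup E] [NormedAddCommGroup F]
    {G : Type*} [NormedAddCommGroup G] {h lin : E × F → G} {p₀ : E × F}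
    (hh : (fun p => h p - lin p) =O[𝓝 p₀] fun p => ‖p.1 - p₀.1‖ ^ 2 + ‖p.2 - p₀.2‖ ^ 2)
    {θ : ℕ → E} {μ : ℕ → F} (hθ : Tendsto θ atTop (𝓝 p₀.1)) (hμ : Tendsto μ atTop (𝓝 p₀.2))
    {ψ r : ℕ → G} {ρ : ℕ → ℝ} (hρ : ∀ n, 0 ≤ ρ n) (hr : r =O[atTop] ρ)
    (hψ : (fun n => ψ n - r n) =O[atTop] fun n => ‖θ n - p₀.1‖ ^ 2 + ‖μ n - p₀.2‖ ^ 2) :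
    (fun n => h (θ n, μ n) - lin (θ n, μ n) + ψ n) =O[atTop]
      fun n => ‖θ n - p₀.1‖ ^ 2 + ‖μ n - p₀.2‖ ^ 2 + ρ n := by
  have hsq : ∀ n, 0 ≤ ‖θ n - p₀.1‖ ^ 2 + ‖μ n - p₀.2‖ ^ 2 := fun n => by positivity
  have h1 : (fun n => ‖θ n - p₀.1‖ ^ 2 + ‖μ n - p₀.2‖ ^ 2) =O[atTop]
      fun n => ‖θ n - p₀.1‖ ^ 2 + ‖μ n - p₀.2‖ ^ 2 + ρ n :=
    IsBigO.of_bound 1 (Eventually.of_forall fun n => by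
      rw [Real.norm_of_nonneg (hsq n), Real.norm_of_nonneg (add_nonneg (hsq n) (hρ n))]
      linarith [hρ n])
  have h2 : ρ =O[atTop] fun n => ‖θ n - p₀.1‖ ^ 2 + ‖μ n - p₀.2‖ ^ 2 + ρ n :=
    IsBigO.of_bound 1 (Eventually.of_forall fun n => by
      rw [Real.norm_of_nonneg (hρ n), Real.norm_of_nonneg (add_nonneg (hsq n) (hρ n))]
      linarith [hsq n])
  have h3 := (hh.comp_tendsto (hθ.prodMk_nhds hμ)).trans h1
  have h4 := (h3.add (hψ.trans h1)).add (hr.trans h2)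
  refine h4.congr_left fun n => ?_
  simp only [Function.comp_apply]
  abel

theorem proposition1
    {Ω : Type*} [MeasurableSpace Ω] (P : Measure Ω) [IsProbabilityMeasure P]
    {d d' : ℕ}
    -- the functions, the limit point, the random sequences (random variables)
    (f : EuclideanSpace ℝ (Fin d) → EuclideanSpace ℝ (Fin d') → EuclideanSpace ℝ (Fin d))
    (g : EuclideanSpace ℝ (Fin d) → EuclideanSpace ℝ (Fin d') → EuclideanSpace ℝ (Fin d'))
    (θstar : EuclideanSpace ℝ (Fin d)) (μstar : EuclideanSpace ℝ (Fin d'))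
    (θ X V ψθ rθ : ℕ → Ω → EuclideanSpace ℝ (Fin d))
    (μ Y W ψμ rμ : ℕ → Ω → EuclideanSpace ℝ (Fin d'))
    (hθm : ∀ n, Measurable (θ n)) (hμm : ∀ n, Measurable (μ n))
    (hVm : ∀ n, Measurable (V n)) (hWm : ∀ n, Measurable (W n))
    (hψθm : ∀ n, Measurable (ψθ n)) (hψμm : ∀ n, Measurable (ψμ n))
    -- the algorithm, with step sizes `β₀ n ^ (-b)` and `γ₀ n ^ (-a)`
    (β₀ γ₀ a b : ℝ)
    (hrecθ : ∀ n, 1 ≤ n → ∀ ω, θ (n + 1) ω = θ n ω + stepSize β₀ b n • X (n + 1) ω)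
    (hrecμ : ∀ n, 1 ≤ n → ∀ ω, μ (n + 1) ω = μ n ω + stepSize γ₀ a n • Y (n + 1) ω)
    -- (A1)
    (hθlim : ∀ᵐ ω ∂P, Tendsto (fun n => θ n ω) atTop (𝓝 θstar))
    (hμlim : ∀ᵐ ω ∂P, Tendsto (fun n => μ n ω) atTop (𝓝 μstar))
    -- (A2)
    (Q₁₁ : Matrix (Fin d) (Fin d) ℝ) (Q₁₂ : Matrix (Fin d) (Fin d') ℝ)
    (Q₂₁ : Matrix (Fin d') (Fin d) ℝ) (Q₂₂ : Matrix (Fin d') (Fin d') ℝ)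
    (hf : (fun p : EuclideanSpace ℝ (Fin d) × EuclideanSpace ℝ (Fin d') =>
        f p.1 p.2 - (matVec Q₁₁ (p.1 - θstar) + matVec Q₁₂ (p.2 - μstar)))
      =O[𝓝 (θstar, μstar)] fun p => ‖p.1 - θstar‖ ^ 2 + ‖p.2 - μstar‖ ^ 2)
    (hg : (fun p : EuclideanSpace ℝ (Fin d) × EuclideanSpace ℝ (Fin d') =>
        g p.1 p.2 - (matVec Q₂₁ (p.1 - θstar) + matVec Q₂₂ (p.2 - μstar)))
      =O[𝓝 (θstar, μstar)] fun p => ‖p.1 - θstar‖ ^ 2 + ‖p.2 - μstar‖ ^ 2)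
    (hH : 0 < spectralDecay (Q₁₁ - Q₁₂ * Q₂₂⁻¹ * Q₂₁))
    (hQ₂₂ : 0 < spectralDecay Q₂₂)
    -- (A3)
    (hβ₀ : 0 < β₀) (hγ₀ : 0 < γ₀) (ha : 1 / 2 < a) (hab : a < b) (hb : b ≤ 1)
    (hb1 : b = 1 → 1 / (2 * spectralDecay (Q₁₁ - Q₁₂ * Q₂₂⁻¹ * Q₂₁)) < β₀)
    -- (A4)
    (hX : ∀ n, 1 ≤ n → ∀ ω, X (n + 1) ω = f (θ n ω) (μ n ω) + ψθ n ω + V (n + 1) ω)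
    (hY : ∀ n, 1 ≤ n → ∀ ω, Y (n + 1) ω = g (θ n ω) (μ n ω) + ψμ n ω + W (n + 1) ω)
    -- (A4)(i)
    (hV0 : ∀ n, 1 ≤ n → IsCondExp (history V W θ μ ψθ ψμ n) P (V (n + 1)) (fun _ => 0))
    (hW0 : ∀ n, 1 ≤ n → IsCondExp (history V W θ μ ψθ ψμ n) P (W (n + 1)) (fun _ => 0))
    -- (A4)(ii): `C n` is the conditional second moment matrix of `(V (n+1), W (n+1))`
    (Γ : Matrix (Fin d ⊕ Fin d') (Fin d ⊕ Fin d') ℝ) (hΓ : Γ.PosSemidef)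
    (C : ℕ → Ω → Matrix (Fin d ⊕ Fin d') (Fin d ⊕ Fin d') ℝ)
    (hC : ∀ n, 1 ≤ n → ∀ i j, IsCondExp (history V W θ μ ψθ ψμ n) P
      (fun ω => Sum.elim (fun k => V (n + 1) ω k) (fun k => W (n + 1) ω k) i *
        Sum.elim (fun k => V (n + 1) ω k) (fun k => W (n + 1) ω k) j)
      (fun ω => C n ω i j))
    (hClim : ∀ᵐ ω ∂P, Tendsto (fun n => C n ω) atTop (𝓝 Γ))
    -- (A4)(iii), with conditional expectations of nonnegative variables valued in `[0, ∞]`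
    (m : ℝ) (hm : 2 / a < m)
    (hVmom : ∀ᵐ ω ∂P, (⨆ (n : ℕ) (_ : 1 ≤ n),
      condLExp (history V W θ μ ψθ ψμ n) P (fun ω' => ‖V (n + 1) ω'‖ₑ ^ m) ω) < ⊤)
    (hWmom : ∀ᵐ ω ∂P, (⨆ (n : ℕ) (_ : 1 ≤ n),
      condLExp (history V W θ μ ψθ ψμ n) P (fun ω' => ‖W (n + 1) ω'‖ₑ ^ m) ω) < ⊤)
    -- (A4)(iv)
    (hψθ : ∀ᵐ ω ∂P, (fun n => ψθ n ω - rθ n ω)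
      =O[atTop] fun n => ‖θ n ω - θstar‖ ^ 2 + ‖μ n ω - μstar‖ ^ 2)
    (hψμ : ∀ᵐ ω ∂P, (fun n => ψμ n ω - rμ n ω)
      =O[atTop] fun n => ‖θ n ω - θstar‖ ^ 2 + ‖μ n ω - μstar‖ ^ 2)
    (hr : ∀ᵐ ω ∂P, (fun n => ‖rθ n ω‖ + ‖rμ n ω‖)
      =o[atTop] fun n => Real.sqrt (stepSize β₀ b n)) :
    (∀ᵐ ω ∂P, (fun n => ‖θ n ω - θstar‖) =O[atTop] fun n =>
      Real.sqrt (stepSize β₀ b n * Real.log (∑ k ∈ Finset.Icc 1 n, stepSize β₀ b k))) ∧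
    (∀ᵐ ω ∂P, (fun n => ‖μ n ω - μstar‖) =O[atTop] fun n =>
      Real.sqrt (stepSize γ₀ a n * Real.log (∑ k ∈ Finset.Icc 1 n, stepSize γ₀ a k))) := by
  set H := Q₁₁ - Q₁₂ * Q₂₂⁻¹ * Q₂₁ with hHdef
  have ha1 : a ≤ 1 := by linarith
  have hbhalf : 1 / 2 < b := by linarith
  have hmb : 2 / b < m := lt_of_le_of_lt
    (div_le_div_of_nonneg_left two_pos.le (by linarith) hab.le) hm
  obtain ⟨l₁', l₁, hl₁', hl₁, hl₁H, hl₁b⟩ := exists_contraction_rates hH hβ₀ hb1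
  obtain ⟨N₁, C₁, t₁, ht₁, hN₁, hN₁C, hN₁a, hN₁c⟩ :=
    exists_lyapunov_norm H (hl₁'.trans hl₁) hl₁H
  obtain ⟨N₂, C₂, t₂, ht₂, hN₂, hN₂C, hN₂a, hN₂c⟩ :=
    exists_lyapunov_norm Q₂₂ (half_pos hQ₂₂) (half_lt_self hQ₂₂)
  -- the filtration and the recursions driven by the noise
  set ℱ := history V W θ μ ψθ ψμ with hℱ
  have hmono : Monotone ℱ := history_mono V W θ μ ψθ ψμ
  have hle : ∀ n, ℱ n ≤ ‹MeasurableSpace Ω› := fun n => iSup₂_le fun i _ =>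
    sup_le (sup_le (sup_le (sup_le (sup_le (hVm i).comap_le (hWm i).comap_le) (hθm i).comap_le)
      (hμm i).comap_le) (hψθm i).comap_le) (hψμm i).comap_le
  have hVad : ∀ n, Measurable[ℱ n] (V n) := fun n => measurable_iff_comap_le.2
    (le_iSup₂_of_le n le_rfl (le_sup_of_le_left (le_sup_of_le_left (le_sup_of_le_left
      (le_sup_of_le_left le_sup_left)))))
  have hWad : ∀ n, Measurable[ℱ n] (W n) := fun n => measurable_iff_comap_le.2
    (le_iSup₂_of_le n le_rfl (le_sup_of_le_left (le_sup_of_le_left (le_sup_of_le_left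
      (le_sup_of_le_left le_sup_right)))))
  -- `W` is damped at both scales: with exponent `a` to correct `y`, and with exponent `b` because
  -- `M W` enters the corrected slow variable. The moment condition at exponent `b` follows from `2
  -- / b < 2 / a < m`.
  have hsV := ae_exists_damped_vector hmono hle hVad hbhalf hb hmb hβ₀ hV0 hVmom
  have hsW := ae_exists_damped_vector hmono hle hWad hbhalf hb hmb hβ₀ hW0 hWmom
  have htW := ae_exists_damped_vector hmono hle hWad ha ha1 hm hγ₀ hW0 hWmom
  rw [← eventually_and]
  filter_upwards [hsV, hsW, htW, hθlim, hμlim, hψθ, hψμ, hr] with ω ⟨sV, hsVO, hsV⟩ ⟨sW, hsWO, hsW⟩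
    ⟨tW, htWO, htW⟩ hθl hμl hψθ hψμ hr
  have hdet : IsUnit Q₂₂.det := isUnit_det_of_spectralDecay_pos Q₂₂ hQ₂₂
  have hrb : (fun n => ‖rθ n ω‖ + ‖rμ n ω‖) =O[atTop] fun n : ℕ => (n : ℝ) ^ (-(b / 2)) := by
    refine hr.isBigO.trans ?_
    simp_rw [sqrt_stepSize hβ₀]
    exact (isBigO_refl _ _).const_mul_left _
  have hrθ : (fun n => rθ n ω) =O[atTop] fun n : ℕ => (n : ℝ) ^ (-(b / 2)) :=
    (IsBigO.of_bound 1 (Eventually.of_forall fun n => by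
      rw [Real.norm_of_nonneg (by positivity)]; linarith [norm_nonneg (rμ n ω)])).trans hrb
  have hrμ : (fun n => rμ n ω) =O[atTop] fun n : ℕ => (n : ℝ) ^ (-(b / 2)) :=
    (IsBigO.of_bound 1 (Eventually.of_forall fun n => by
      rw [Real.norm_of_nonneg (by positivity)]; linarith [norm_nonneg (rθ n ω)])).trans hrb
  have hρ : ∀ n : ℕ, 0 ≤ (n : ℝ) ^ (-(b / 2)) := fun n => by positivity
  have hRx := remainder_isBigO (p₀ := (θstar, μstar)) hf hθl hμl hρ hrθ hψθ
  have hRy := remainder_isBigO (p₀ := (θstar, μstar)) hg hθl hμl hρ hrμ hψμ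
  obtain ⟨K, -, hK⟩ := (hRx.norm_left.add hRy.norm_left).exists_pos
  have hmain := two_time_scale_rate (matCLM Q₁₁) (matCLM H) (matCLM Q₁₂) (matCLM (Q₁₂ * Q₂₂⁻¹))
    (matCLM Q₂₁) (matCLM Q₂₂)
    (fun y => by
      rw [matCLM_apply, matCLM_apply, matCLM_apply, ← matVec_mul, Matrix.mul_assoc,
        Matrix.nonsing_inv_mul _ hdet, Matrix.mul_one])
    (fun x => by
      simp only [matCLM_apply]
      rw [← matVec_mul, ← matVec_sub_left])
    ht₁ hN₁ hN₁C hN₁a hN₁c ht₂ hN₂ hN₂C hN₂a hN₂c hβ₀ hγ₀ ha hab hb hl₁' hl₁ (half_pos hQ₂₂) hl₁b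
    (x := fun n => θ n ω - θstar) (y := fun n => μ n ω - μstar)
    (V := fun n => V (n + 1) ω) (W := fun n => W (n + 1) ω) (K := K)
    (Rx := fun n => f (θ n ω) (μ n ω) - (matVec Q₁₁ (θ n ω - θstar) +
      matVec Q₁₂ (μ n ω - μstar)) + ψθ n ω)
    (Ry := fun n => g (θ n ω) (μ n ω) - (matVec Q₂₁ (θ n ω - θstar) +
      matVec Q₂₂ (μ n ω - μstar)) + ψμ n ω)
    ?_ ?_ ?_ ?_ ?_ hsV hsW htW hsVO hsWO htWO
  · exact ⟨hmain.1.norm_left, hmain.2.norm_left⟩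
  · filter_upwards [eventually_ge_atTop 1] with n hn
    rw [hrecθ n hn ω, hX n hn ω]
    simp only [matCLM_apply]
    module
  · filter_upwards [eventually_ge_atTop 1] with n hn
    rw [hrecμ n hn ω, hY n hn ω]
    simp only [matCLM_apply]
    module
  · simpa using hθl.sub_const θstar
  · simpa using hμl.sub_const μstar
  · filter_upwards [hK.bound] with n hn
    rw [Real.norm_of_nonneg (by positivity), Real.norm_of_nonneg (by positivity)] at hn
    exact hn
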